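/- Kinds are $*$ and $\kappa_1\Rightarrow\kappa_2$. Type constructors over the single type constant $\mathtt{nat}:*$ are: variables (infinitely many of each kind), $\mathtt{nat}$, applications $\varphi\psi:\kappa_2$ (for $\varphi:\kappa_1\Rightarrow\kappa_2$, $\psi:\kappa_1$), abstractions $\lambda\alpha{:}\kappa_1.\varphi:\kappa_1\Rightarrow\kappa_2$ (for $\varphi:\kappa_2$), and, for $\sigma,\tau:*$, $\forall\alpha{:}\kappa.\sigma:*$ and $\sigma\to\tau:*$. They are taken up to $\alpha$-conversion; $=_\beta$ is the convertibility generated by $(\lambda\alpha.\varphi)\psi\to\varphi[\alpha:=\psi]$ in any position. Types are the type constructors of kind $*$. Put $\chi_*=\mathtt{nat}$ and $\chi_{\kappa_1\Rightarrow\kappa_2}=\lambda\alpha{:}\kappa_1.\chi_{\kappa_2}$. Each term variable is declared with one fixed type. The function symbols are $n:\mathtt{nat}$ for each $n\in\mathbb N$, $\oplus,\otimes:\forall\alpha{:}{*}.\,\alpha\to\alpha\to\alpha$, $\mathtt{flatten}:\forall\alpha{:}{*}.\,\alpha\to\mathtt{nat}$ and $\mathtt{lift}:\forall\alpha{:}{*}.\,\mathtt{nat}\to\alpha$.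 Preterms are the expressions, up to $\alpha$-conversion, that can be given a type by the following rules: variables and function symbols have their declared types; $\lambda x{:}\sigma.s:\sigma\to\tau$ if $s:\tau$ and $x:\sigma$; $\Lambda\alpha{:}\kappa.s:\forall\alpha{:}\kappa.\sigma$ if $s:\sigma$ and $\alpha$ is not free in the type of a free variable of $s$; $s\cdot t:\tau$ if $s:\sigma\to\tau$ and $t:\sigma$; $s*\varphi:\sigma[\alpha:=\varphi]$ if $s:\forall\alpha{:}\kappa.\sigma$ and $\varphi$ has kind $\kappa$; $s:\tau$ if $s:\sigma$ and $\sigma=_\beta\tau$. An interpretation term is a class of preterms modulo $\beta$-conversion in the types written in them. It is closed if its representative with all types $\beta$-normal has no free term variables and no free type constructor variables. Write $\circ_\sigma,\mathtt{flatten}_\sigma,\mathtt{lift}_\sigma$ for $\circ*\sigma,\mathtt{flatten}*\sigma,\mathtt{lift}*\sigma$. The relation $\leadsto$ is the smallest relation on interpretation terms that is closed under all term constructions (that is, $s\leadsto t$ implies $\lambda x.s\leadsto\lambda x.t$, $\Lambda\alpha.s\leadsto\Lambda\alpha.t$, $u\cdot s\leadsto u\cdot t$, $s\cdot u\leadsto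 t\cdot u$, $s*\varphi\leadsto t*\varphi$) and contains, for $\circ\in\{\oplus,\otimes\}$ and every kind $\kappa$, with bound variables chosen fresh: \[ \begin{array}{ll} (\lambda x{:}\sigma.s)\cdot t\leadsto s[x:=t], & (\Lambda\alpha{:}\kappa.s)*\varphi\leadsto s[\alpha:=\varphi],\\ \oplus_{\mathtt{nat}}\cdot n\cdot m\leadsto n+m, & \otimes_{\mathtt{nat}}\cdot n\cdot m\leadsto n\times m\quad(n,m\in\mathbb N),\\ \circ_{\sigma\to\tau}\cdot s\cdot t\leadsto\lambda x{:}\sigma.\,\circ_\tau\cdot(s\cdot x)\cdot(t\cdot x), & \circ_{\forall\alpha:\kappa.\sigma}\cdot s\cdot t\leadsto\Lambda\alpha{:}\kappa.\,\circ_\sigma\cdot(s*\alpha)\cdot(t*\alpha),\\ \mathtt{flatten}_{\mathtt{nat}}\cdot s\leadsto s, & \mathtt{flatten}_{\sigma\to\tau}\cdot s\leadsto\mathtt{flatten}_\tau\cdot(s\cdot(\mathtt{lift}_\sigma\cdot 0)),\\ \mathtt{flatten}_{\forall\alpha:\kappa.\sigma}\cdot s\leadsto\mathtt{flatten}_{\sigma[\alpha:=\chi_\kappa]}\cdot(s*\chi_\kappa),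 & \mathtt{lift}_{\mathtt{nat}}\cdot s\leadsto s,\\ \mathtt{lift}_{\sigma\to\tau}\cdot s\leadsto\lambda x{:}\sigma.\,\mathtt{lift}_\tau\cdot s, & \mathtt{lift}_{\forall\alpha:\kappa.\sigma}\cdot s\leadsto\Lambda\alpha{:}\kappa.\,\mathtt{lift}_\sigma\cdot s. \end{array} \] A term is normal if it has no $\leadsto$-successor; $u$ is a normal form of $s$ if $s\leadsto^* u$ and $u$ is normal. Theorem. (1) Every interpretation term $s$ has exactly one normal form. (2) If $s$ is closed, then so is its normal form. (3) An interpretation term is closed, normal and of type $\mathtt{nat}$ if and only if it is a natural number $n\in\mathbb N$ (as a function symbol). -/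

import Mathlib

namespace Interp

/-- Kinds: `*` and `κ₁ ⇒ κ₂`. -/
inductive Kind : Type
  | star : Kind
  | arr : Kind → Kind → Kind
  deriving DecidableEq

/-- Type constructors of each kind over the single type constant `nat : *`, up to
`α`-conversion (de Bruijn indices). The variables of kind `κ` are `var κ 0, var κ 1, …`:
an infinite set for each kind, and indices are counted separately for each kind, that is,
`var κ n` is bound by the `n`-th enclosing binder of kind `κ`, if there is one, and is
free otherwise. -/
inductive TyCon : Kind → Type
  | var (κ : Kind) (n : ℕ) : TyCon κ
  | nat : TyCon Kind.star
  | app {κ₁ κ₂ : Kind} (φ : TyCon (Kind.arr κ₁ κ₂)) (ψ : TyCon κ₁) : TyCon κ₂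
  | lam (κ₁ : Kind) {κ₂ : Kind} (φ : TyCon κ₂) : TyCon (Kind.arr κ₁ κ₂)
  | all (κ : Kind) (σ : TyCon Kind.star) : TyCon Kind.star
  | arr (σ τ : TyCon Kind.star) : TyCon Kind.star

/-- Interpretation types: the type constructors of kind `*`. -/
abbrev Ty : Type := TyCon Kind.star

/-- The closed type constructor `χ_κ`: `χ_* = nat` and `χ_{κ₁ ⇒ κ₂} = λ α : κ₁. χ_{κ₂}`. -/
def chi : (κ : Kind) → TyCon κ
  | Kind.star => TyCon.nat
  | Kind.arr κ₁ κ₂ => TyCon.lam κ₁ (chi κ₂)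

/-- Renamings of type constructor variables. -/
abbrev TyRen : Type := Kind → ℕ → ℕ

/-- Weakening by one fresh variable of kind `κ`. -/
def TyRen.wk (κ : Kind) : TyRen := fun κ' n => if κ' = κ then n + 1 else n

/-- A renaming moved under a binder of kind `κ`. -/
def TyRen.up (κ : Kind) (ξ : TyRen) : TyRen := fun κ' n =>
  if κ' = κ then
    match n with
    | 0 => 0
    | m + 1 => ξ κ' m + 1
  else ξ κ' n

def TyCon.rename : {κ : Kind} → TyRen → TyCon κ → TyCon κ
  | _, ξ, .var κ n => .var κ (ξ κ n)
  | _, _, .nat => .nat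
  | _, ξ, .app φ ψ => .app (φ.rename ξ) (ψ.rename ξ)
  | _, ξ, .lam κ₁ φ => .lam κ₁ (φ.rename (ξ.up κ₁))
  | _, ξ, .all κ σ => .all κ (σ.rename (ξ.up κ))
  | _, ξ, .arr σ τ => .arr (σ.rename ξ) (τ.rename ξ)

/-- `φ` seen in the scope of one more binder of kind `κ`. -/
def TyCon.weaken (κ : Kind) {κ' : Kind} (φ : TyCon κ') : TyCon κ' := φ.rename (TyRen.wk κ)

/-- Simultaneous substitutions for type constructor variables, respecting kinds. -/
abbrev TySub : Type := (κ : Kind) → ℕ → TyCon κ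

/-- A substitution moved under a binder of kind `κ`. -/
def TySub.up (κ : Kind) (θ : TySub) : TySub := fun κ' n =>
  if κ' = κ then
    match n with
    | 0 => .var κ' 0
    | m + 1 => (θ κ' m).weaken κ
  else (θ κ' n).weaken κ

def TyCon.subst : {κ : Kind} → TySub → TyCon κ → TyCon κ
  | _, θ, .var κ n => θ κ n
  | _, _, .nat => .nat
  | _, θ, .app φ ψ => .app (φ.subst θ) (ψ.subst θ)
  | _, θ, .lam κ₁ φ => .lam κ₁ (φ.subst (θ.up κ₁))
  | _, θ, .all κ σ => .all κ (σ.subst (θ.up κ))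
  | _, θ, .arr σ τ => .arr (σ.subst θ) (τ.subst θ)

/-- The substitution that replaces the innermost variable of kind `κ` by `ψ` and removes its
binder. -/
def TySub.single {κ : Kind} (ψ : TyCon κ) : TySub := fun κ' n =>
  if h : κ' = κ then
    match n with
    | 0 => h ▸ ψ
    | m + 1 => .var κ' m
  else .var κ' n

/-- `φ[α := ψ]`, where `α` is the innermost variable of the kind of `ψ`. -/
def TyCon.inst {κ κ' : Kind} (φ : TyCon κ') (ψ : TyCon κ) : TyCon κ' :=
  φ.subst (TySub.single ψ)

/-- `FTV(φ)`: the free type constructor variables of `φ`, as pairs of a kind and an index. -/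
def TyCon.ftv : {κ : Kind} → TyCon κ → Set (Kind × ℕ)
  | _, .var κ n => {(κ, n)}
  | _, .nat => ∅
  | _, .app φ ψ => φ.ftv ∪ ψ.ftv
  | _, .lam κ φ => {v | (v.1, TyRen.wk κ v.1 v.2) ∈ φ.ftv}
  | _, .all κ σ => {v | (v.1, TyRen.wk κ v.1 v.2) ∈ σ.ftv}
  | _, .arr σ τ => σ.ftv ∪ τ.ftv

/-- One step of `β`-reduction on type constructors: the compatible closure of
`(λ α. φ) ψ → φ[α := ψ]`. -/
inductive TyCon.Beta : {κ : Kind} → TyCon κ → TyCon κ → Prop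
  | beta {κ₁ κ₂ : Kind} (φ : TyCon κ₂) (ψ : TyCon κ₁) :
      Beta (.app (.lam κ₁ φ) ψ) (φ.inst ψ)
  | appL {κ₁ κ₂ : Kind} {φ φ' : TyCon (Kind.arr κ₁ κ₂)} (ψ : TyCon κ₁) :
      Beta φ φ' → Beta (.app φ ψ) (.app φ' ψ)
  | appR {κ₁ κ₂ : Kind} (φ : TyCon (Kind.arr κ₁ κ₂)) {ψ ψ' : TyCon κ₁} :
      Beta ψ ψ' → Beta (.app φ ψ) (.app φ ψ')
  | lam (κ₁ : Kind) {κ₂ : Kind} {φ φ' : TyCon κ₂} :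
      Beta φ φ' → Beta (.lam κ₁ φ) (.lam κ₁ φ')
  | all (κ : Kind) {σ σ' : Ty} : Beta σ σ' → Beta (.all κ σ) (.all κ σ')
  | arrL {σ σ' : Ty} (τ : Ty) : Beta σ σ' → Beta (.arr σ τ) (.arr σ' τ)
  | arrR (σ : Ty) {τ τ' : Ty} : Beta τ τ' → Beta (.arr σ τ) (.arr σ τ')

/-- `β`-convertibility `=_β` of type constructors. -/
def TyCon.Conv {κ : Kind} (φ ψ : TyCon κ) : Prop := Relation.EqvGen TyCon.Beta φ ψ

/-- `β`-normal type constructors. -/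
def TyCon.IsNormal {κ : Kind} (φ : TyCon κ) : Prop := ∀ ψ : TyCon κ, ¬ TyCon.Beta φ ψ

/-- The two operations `⊕` and `⊗`. -/
inductive Op : Type
  | plus : Op
  | times : Op

/-- The operation on natural numbers that `⊕`, respectively `⊗`, denotes. -/
def Op.eval : Op → ℕ → ℕ → ℕ
  | .plus, n, m => n + m
  | .times, n, m => n * m

/-- The function symbols: the natural numbers, `⊕`, `⊗`, `flatten` and `lift`. -/
inductive FSym : Type
  | num (n : ℕ) : FSym
  | op (o : Op) : FSym
  | flatten : FSym
  | lift : FSym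

/-- The (closed) type of each function symbol. -/
def FSym.type : FSym → Ty
  | .num _ => .nat
  | .op _ => .all .star (.arr (.var .star 0) (.arr (.var .star 0) (.var .star 0)))
  | .flatten => .all .star (.arr (.var .star 0) .nat)
  | .lift => .all .star (.arr .nat (.var .star 0))

/-- Raw Church-style expressions up to `α`-conversion. Term variables are de Bruijn indices
that count the enclosing term abstractions (`lam`) only; type constructor variables are
indexed as in `TyCon`, with `tlam κ` as a binder of kind `κ`. -/
inductive Expr : Type
  | var (i : ℕ) : Expr
  | sym (f : FSym) : Expr
  | lam (σ : Ty) (s : Expr) : Expr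
  | tlam (κ : Kind) (s : Expr) : Expr
  | app (s t : Expr) : Expr
  | tapp {κ : Kind} (s : Expr) (φ : TyCon κ) : Expr

/-- Renaming of type constructor variables in expressions. -/
def Expr.tyRename : TyRen → Expr → Expr
  | _, .var i => .var i
  | _, .sym f => .sym f
  | ξ, .lam σ s => .lam (σ.rename ξ) (s.tyRename ξ)
  | ξ, .tlam κ s => .tlam κ (s.tyRename (ξ.up κ))
  | ξ, .app s t => .app (s.tyRename ξ) (t.tyRename ξ)
  | ξ, .tapp s φ => .tapp (s.tyRename ξ) (φ.rename ξ)

/-- `s` seen in the scope of one more type abstraction of kind `κ`. -/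
def Expr.tyWeaken (κ : Kind) (s : Expr) : Expr := s.tyRename (TyRen.wk κ)

/-- Substitution for type constructor variables in expressions. -/
def Expr.tySubst : TySub → Expr → Expr
  | _, .var i => .var i
  | _, .sym f => .sym f
  | θ, .lam σ s => .lam (σ.subst θ) (s.tySubst θ)
  | θ, .tlam κ s => .tlam κ (s.tySubst (θ.up κ))
  | θ, .app s t => .app (s.tySubst θ) (t.tySubst θ)
  | θ, .tapp s φ => .tapp (s.tySubst θ) (φ.subst θ)

/-- `s[α := φ]`, where `α` is the innermost variable of the kind of `φ`. -/
def Expr.tyInst {κ : Kind} (s : Expr) (φ : TyCon κ) : Expr := s.tySubst (TySub.single φ)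

/-- A renaming of term variables moved under a term abstraction. -/
def renUp (r : ℕ → ℕ) : ℕ → ℕ
  | 0 => 0
  | i + 1 => r i + 1

/-- Renaming of term variables. -/
def Expr.rename : (ℕ → ℕ) → Expr → Expr
  | r, .var i => .var (r i)
  | _, .sym f => .sym f
  | r, .lam σ s => .lam σ (s.rename (renUp r))
  | r, .tlam κ s => .tlam κ (s.rename r)
  | r, .app s t => .app (s.rename r) (t.rename r)
  | r, .tapp s φ => .tapp (s.rename r) φ

/-- `s` seen in the scope of one more term abstraction. -/
def Expr.weaken (s : Expr) : Expr := s.rename Nat.succ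

/-- A substitution for term variables moved under a term abstraction. -/
def subUp (u : ℕ → Expr) : ℕ → Expr
  | 0 => .var 0
  | i + 1 => (u i).weaken

/-- Simultaneous substitution for term variables. -/
def Expr.subst : (ℕ → Expr) → Expr → Expr
  | u, .var i => u i
  | _, .sym f => .sym f
  | u, .lam σ s => .lam σ (s.subst (subUp u))
  | u, .tlam κ s => .tlam κ (s.subst (fun i => (u i).tyWeaken κ))
  | u, .app s t => .app (s.subst u) (t.subst u)
  | u, .tapp s φ => .tapp (s.subst u) φ

/-- The substitution that replaces variable `0` by `t` and removes its binder. -/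
def subSingle (t : Expr) : ℕ → Expr
  | 0 => t
  | i + 1 => .var i

/-- `s[x := t]`, where `x` is the innermost term variable. -/
def Expr.inst (s t : Expr) : Expr := s.subst (subSingle t)

/-- The declaration of the variables: the free variable `i` has the type `Γ i`. -/
abbrev Decl : Type := ℕ → Ty

/-- The declarations in force below a term abstraction over a variable of type `σ`. -/
def Decl.cons (σ : Ty) (Γ : Decl) : Decl
  | 0 => σ
  | i + 1 => Γ i

/-- The declarations in force below a type abstraction of kind `κ`; the abstracted variable
occurs in none of them. -/
def Decl.weaken (κ : Kind) (Γ : Decl) : Decl := fun i => (Γ i).weaken κ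

/-- The typing judgement `s : σ`. -/
inductive HasType : Decl → Expr → Ty → Prop
  | var (Γ : Decl) (i : ℕ) : HasType Γ (.var i) (Γ i)
  | sym (Γ : Decl) (f : FSym) : HasType Γ (.sym f) f.type
  | lam {Γ : Decl} {σ τ : Ty} {s : Expr} :
      HasType (Γ.cons σ) s τ → HasType Γ (.lam σ s) (.arr σ τ)
  | tlam {Γ : Decl} {κ : Kind} {σ : Ty} {s : Expr} :
      HasType (Γ.weaken κ) s σ → HasType Γ (.tlam κ s) (.all κ σ)
  | app {Γ : Decl} {σ τ : Ty} {s t : Expr} :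
      HasType Γ s (.arr σ τ) → HasType Γ t σ → HasType Γ (.app s t) τ
  | tapp {Γ : Decl} {κ : Kind} {σ : Ty} {s : Expr} (φ : TyCon κ) :
      HasType Γ s (.all κ σ) → HasType Γ (.tapp s φ) (σ.inst φ)
  | conv {Γ : Decl} {σ τ : Ty} {s : Expr} :
      HasType Γ s σ → TyCon.Conv σ τ → HasType Γ s τ

/-- `s ≡ t`: the expressions are identical modulo `β`-conversion in types. -/
inductive Expr.Equiv : Expr → Expr → Prop
  | var (i : ℕ) : Equiv (.var i) (.var i)
  | sym (f : FSym) : Equiv (.sym f) (.sym f)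
  | lam {σ σ' : Ty} {s s' : Expr} :
      TyCon.Conv σ σ' → Equiv s s' → Equiv (.lam σ s) (.lam σ' s')
  | tlam (κ : Kind) {s s' : Expr} : Equiv s s' → Equiv (.tlam κ s) (.tlam κ s')
  | app {s s' t t' : Expr} : Equiv s s' → Equiv t t' → Equiv (.app s t) (.app s' t')
  | tapp {κ : Kind} {s s' : Expr} {φ φ' : TyCon κ} :
      Equiv s s' → TyCon.Conv φ φ' → Equiv (.tapp s φ) (.tapp s' φ')

theorem Expr.Equiv.refl (s : Expr) : Expr.Equiv s s := by
  induction s with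
  | var i => exact .var i
  | sym f => exact .sym f
  | lam σ s ih => exact .lam (Relation.EqvGen.refl _) ih
  | tlam κ s ih => exact .tlam κ ih
  | app s t ihs iht => exact .app ihs iht
  | tapp s φ ih => exact .tapp ih (Relation.EqvGen.refl _)

theorem Expr.Equiv.symm {s t : Expr} (h : Expr.Equiv s t) : Expr.Equiv t s := by
  induction h with
  | var i => exact .var i
  | sym f => exact .sym f
  | lam hσ _ ih => exact .lam (Relation.EqvGen.symm _ _ hσ) ih
  | tlam κ _ ih => exact .tlam κ ih
  | app _ _ ihs iht => exact .app ihs iht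
  | tapp _ hφ ih => exact .tapp ih (Relation.EqvGen.symm _ _ hφ)

theorem Expr.Equiv.trans {s t u : Expr} (h : Expr.Equiv s t) :
    Expr.Equiv t u → Expr.Equiv s u := by
  induction h generalizing u with
  | var i => exact id
  | sym f => exact id
  | lam hσ _ ih =>
    intro h'
    cases h' with
    | lam hσ' h' => exact .lam (Relation.EqvGen.trans _ _ _ hσ hσ') (ih h')
  | tlam κ _ ih =>
    intro h'
    cases h' with
    | tlam _ h' => exact .tlam κ (ih h')
  | app _ _ ihs iht =>
    intro h'
    cases h' with
    | app h₁ h₂ => exact .app (ihs h₁) (iht h₂)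
  | tapp _ hφ ih =>
    intro h'
    cases h' with
    | tapp h' hφ' => exact .tapp (ih h') (Relation.EqvGen.trans _ _ _ hφ hφ')

/-- `∘_σ s t`, that is, `((∘ * σ) · s) · t`, for `∘ ∈ {⊕, ⊗}`. -/
def Expr.circ (o : Op) (σ : Ty) (s t : Expr) : Expr :=
  .app (.app (.tapp (.sym (.op o)) σ) s) t

/-- `flatten_σ s`. -/
def Expr.flat (σ : Ty) (s : Expr) : Expr := .app (.tapp (.sym .flatten) σ) s

/-- `lift_σ s`. -/
def Expr.lft (σ : Ty) (s : Expr) : Expr := .app (.tapp (.sym .lift) σ) s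

/-- The numeral `n`. -/
def Expr.num (n : ℕ) : Expr := .sym (.num n)

/-- The reduction rules on expressions, with the types written exactly as in the rules. The
relation `⇝` on terms is obtained from it by passing to classes modulo `≡`
(`ITerm.Red` below). -/
inductive Expr.Step : Expr → Expr → Prop
  | lam (σ : Ty) {s t : Expr} : Step s t → Step (.lam σ s) (.lam σ t)
  | tlam (κ : Kind) {s t : Expr} : Step s t → Step (.tlam κ s) (.tlam κ t)
  | appR (u : Expr) {s t : Expr} : Step s t → Step (.app u s) (.app u t)
  | appL (u : Expr) {s t : Expr} : Step s t → Step (.app s u) (.app t u)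
  | tapp {κ : Kind} (φ : TyCon κ) {s t : Expr} : Step s t → Step (.tapp s φ) (.tapp t φ)
  | beta (σ : Ty) (s t : Expr) : Step (.app (.lam σ s) t) (s.inst t)
  | tbeta {κ : Kind} (s : Expr) (φ : TyCon κ) : Step (.tapp (.tlam κ s) φ) (s.tyInst φ)
  | circNat (o : Op) (n m : ℕ) : Step (.circ o .nat (.num n) (.num m)) (.num (o.eval n m))
  | circArr (o : Op) (σ τ : Ty) (s t : Expr) :
      Step (.circ o (.arr σ τ) s t)
        (.lam σ (.circ o τ (.app s.weaken (.var 0)) (.app t.weaken (.var 0))))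
  | circAll (o : Op) (κ : Kind) (σ : Ty) (s t : Expr) :
      Step (.circ o (.all κ σ) s t)
        (.tlam κ (.circ o σ (.tapp (s.tyWeaken κ) (.var κ 0))
          (.tapp (t.tyWeaken κ) (.var κ 0))))
  | flatNat (s : Expr) : Step (.flat .nat s) s
  | flatArr (σ τ : Ty) (s : Expr) :
      Step (.flat (.arr σ τ) s) (.flat τ (.app s (.lft σ (.num 0))))
  | flatAll (κ : Kind) (σ : Ty) (s : Expr) :
      Step (.flat (.all κ σ) s) (.flat (σ.inst (chi κ)) (.tapp s (chi κ)))
  | liftNat (s : Expr) : Step (.lft .nat s) s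
  | liftArr (σ τ : Ty) (s : Expr) :
      Step (.lft (.arr σ τ) s) (.lam σ (.lft τ s.weaken))
  | liftAll (κ : Kind) (σ : Ty) (s : Expr) :
      Step (.lft (.all κ σ) s) (.tlam κ (.lft σ (s.tyWeaken κ)))

/-- `FV(s)`: the free term variables. -/
def Expr.fv : Expr → Set ℕ
  | .var i => {i}
  | .sym _ => ∅
  | .lam _ s => {i | i + 1 ∈ s.fv}
  | .tlam _ s => s.fv
  | .app s t => s.fv ∪ t.fv
  | .tapp s _ => s.fv

/-- The type constructor variables with a free occurrence in a type written in `s`. (Those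
that occur in the types of the free term variables of `s` are not counted here; this makes no
difference for closed expressions, which have no free term variables.) -/
def Expr.ftv : Expr → Set (Kind × ℕ)
  | .var _ => ∅
  | .sym _ => ∅
  | .lam σ s => σ.ftv ∪ s.ftv
  | .tlam κ s => {v | (v.1, TyRen.wk κ v.1 v.2) ∈ s.ftv}
  | .app s t => s.ftv ∪ t.ftv
  | .tapp s φ => s.ftv ∪ φ.ftv

/-- All types written in the expression are `β`-normal. -/
def Expr.IsCanonical : Expr → Prop
  | .var _ => True
  | .sym _ => True
  | .lam σ s => σ.IsNormal ∧ s.IsCanonical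
  | .tlam _ s => s.IsCanonical
  | .app s t => s.IsCanonical ∧ t.IsCanonical
  | .tapp s φ => s.IsCanonical ∧ φ.IsNormal

/-- Preterms: the typable expressions. -/
def Preterm (Γ : Decl) : Type := {s : Expr // ∃ σ : Ty, HasType Γ s σ}

/-- The relation `≡` on preterms. -/
instance Preterm.setoid (Γ : Decl) : Setoid (Preterm Γ) where
  r s t := Expr.Equiv s.1 t.1
  iseqv := ⟨fun s => Expr.Equiv.refl s.1, fun h => Expr.Equiv.symm h,
    fun h h' => Expr.Equiv.trans h h'⟩

/-- Interpretation terms: the equivalence classes of preterms modulo `≡`. -/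
def ITerm (Γ : Decl) : Type := Quotient (Preterm.setoid Γ)

/-- The interpretation term that a preterm represents. -/
def Preterm.toTerm {Γ : Decl} (s : Preterm Γ) : ITerm Γ := Quotient.mk (Preterm.setoid Γ) s

namespace ITerm

variable {Γ : Decl}

/-- `t : σ` for interpretation terms. -/
def HasType (t : ITerm Γ) (σ : Ty) : Prop :=
  ∃ p : Preterm Γ, p.toTerm = t ∧ Interp.HasType Γ p.1 σ

/-- The relation `s ⇝ t` on interpretation terms: some representative of `s` is rewritten to
some representative of `t`. -/
def Red (s t : ITerm Γ) : Prop :=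
  ∃ p q : Preterm Γ, p.toTerm = s ∧ q.toTerm = t ∧ Expr.Step p.1 q.1

/-- Terms in normal form with respect to `⇝`. -/
def IsNormal (t : ITerm Γ) : Prop := ∀ t' : ITerm Γ, ¬ Red t t'

/-- `u` is a normal form of `s`: `s ⇝* u` and `u` is normal. -/
def HasNormalForm (s u : ITerm Γ) : Prop := Relation.ReflTransGen Red s u ∧ IsNormal u

/-- A term is closed if its canonical representative (the one in which all types are
`β`-normal) has neither free term variables nor free type constructor variables. -/
def IsClosed (t : ITerm Γ) : Prop :=
  ∃ p : Preterm Γ, p.toTerm = t ∧ p.1.IsCanonical ∧ p.1.fv = ∅ ∧ p.1.ftv = ∅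

/-- Final interpretation terms: the closed ones in normal form. -/
def IsFinal (t : ITerm Γ) : Prop := IsClosed t ∧ IsNormal t

/-- The natural number `n` as an interpretation term. -/
def num (n : ℕ) : ITerm Γ :=
  Preterm.toTerm ⟨Expr.num n, TyCon.nat, Interp.HasType.sym Γ (FSym.num n)⟩

end ITerm

end Interp

namespace Interp

/-! ### Substitution calculus for type constructors -/

/-! The system is higher-order polymorphic λ-calculus with symbols that compute by inspecting the
head of a type argument. Since only existence and uniqueness of normal forms are at stake, weak
normalization together with confluence is enough.

Confluence. Expressions and the types written in them are reduced in parallel, and a redex may be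
contracted after its parts have been reduced. Redexes are recognised by abstractions, function
symbols and the type formers `nat`, `→`, `∀`, all of which survive reduction, and no two rules apply
to one redex. So the diamond property (`TyCon.Par.diamond`, `Expr.Par.diamond`) is an induction on
the expression. For types it also yields injectivity of `→` and `∀` modulo convertibility, on which
inversion of typing and subject reduction (`HasType.step`) rest.

Normalization. Type constructors are normalizing by the usual reducibility argument over kinds
(`TyCon.wn`). For expressions Girard's candidates are used (`mem_interpTy_of_hasType`). The
difficulty is that `flatten` at `∀α.σ` continues at `σ[α := χ]`, and that a symbol may be
instantiated at any type whatsoever, so there is no induction on the type argument. The remedy is to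
make closure under `∘_σ`, `lift_σ` and `flatten_σ` part of the definition of a candidate at `σ`;
every possible value of a type variable then carries the behaviour of the symbols with it. As these
conditions mention `σ`, candidates are relative to a syntactic type, and `Good` extends this
relation between syntax and semantics to all kinds. A quantifier ranges over the related pairs,
among them `χ_κ` with its denotation `base κ`, which settles `flatten` at `∀`. Candidates are closed
under conversion in both directions; the price is that normalization of a body has to be recovered
from its instance at a variable. Such an instance is a renaming, and renamings reflect normal forms
and reductions.

Classes modulo `≡`. Parallel reduction decomposes into rule steps and changes of types within a
class, and a representative with normal types admits a step as soon as any representative does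
(`Step.exists_of_equiv`). So normal classes are those represented by redex-free expressions, and
such a representative is unique.

Closedness. Reduction commutes with renaming. Shifting all free variables fixes a closed expression,
hence also its unique normal form, and an expression fixed by the shift has no free variables.
Finally, a closed normal expression is an abstraction, a symbol or a partially applied symbol
(`Nf.value`), and among these only numerals have type `nat`. -/

theorem TyRen.up_comp (κ : Kind) (ξ ζ : TyRen) :
    (fun κ' n => ζ.up κ κ' (ξ.up κ κ' n)) = TyRen.up κ (fun κ' n => ζ κ' (ξ κ' n)) := by
  funext κ' n
  by_cases h : κ' = κ <;> cases n <;> simp [TyRen.up, h]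

theorem TyRen.up_id (κ : Kind) : TyRen.up κ (fun _ n => n) = fun _ n => n := by
  funext κ' n
  by_cases h : κ' = κ <;> cases n <;> simp [TyRen.up, h]

theorem TyRen.up_wk (κ : Kind) (ξ : TyRen) :
    (fun κ' n => ξ.up κ κ' (TyRen.wk κ κ' n)) = fun κ' n => TyRen.wk κ κ' (ξ κ' n) := by
  funext κ' n
  by_cases h : κ' = κ <;> simp [TyRen.up, TyRen.wk, h]

theorem TyCon.rename_rename {κ : Kind} (φ : TyCon κ) (ξ ζ : TyRen) :
    (φ.rename ξ).rename ζ = φ.rename (fun κ' n => ζ κ' (ξ κ' n)) := by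
  induction φ generalizing ξ ζ with
  | var κ n => rfl
  | nat => rfl
  | app φ ψ ih₁ ih₂ => simp [rename, ih₁, ih₂]
  | lam κ φ ih => simp [rename, ih, TyRen.up_comp]
  | all κ σ ih => simp [rename, ih, TyRen.up_comp]
  | arr σ τ ih₁ ih₂ => simp [rename, ih₁, ih₂]

theorem TyCon.rename_id {κ : Kind} (φ : TyCon κ) : φ.rename (fun _ n => n) = φ := by
  induction φ with
  | var κ n => rfl
  | nat => rfl
  | app φ ψ ih₁ ih₂ => simp [rename, ih₁, ih₂]
  | lam κ φ ih => simp [rename, ih, TyRen.up_id]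
  | all κ σ ih => simp [rename, ih, TyRen.up_id]
  | arr σ τ ih₁ ih₂ => simp [rename, ih₁, ih₂]

theorem TyCon.weaken_rename_up (κ : Kind) {κ' : Kind} (φ : TyCon κ') (ξ : TyRen) :
    (φ.weaken κ).rename (ξ.up κ) = (φ.rename ξ).weaken κ := by
  simp only [weaken, rename_rename, TyRen.up_wk]

theorem TySub.up_ren (κ : Kind) (ξ : TyRen) (θ : TySub) :
    (fun κ' n => θ.up κ κ' (ξ.up κ κ' n)) = TySub.up κ (fun κ' n => θ κ' (ξ κ' n)) := by
  funext κ' n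
  by_cases h : κ' = κ <;> cases n <;> simp [TyRen.up, TySub.up, h]

theorem TySub.up_wk (κ : Kind) (θ : TySub) :
    (fun κ' n => θ.up κ κ' (TyRen.wk κ κ' n)) = fun κ' n => (θ κ' n).weaken κ := by
  funext κ' n
  by_cases h : κ' = κ <;> simp [TySub.up, TyRen.wk, h]

theorem TySub.ren_up (κ : Kind) (θ : TySub) (ξ : TyRen) :
    (fun κ' n => (θ.up κ κ' n).rename (ξ.up κ)) =
      TySub.up κ (fun κ' n => (θ κ' n).rename ξ) := by
  funext κ' n
  by_cases h : κ' = κ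
  · subst h
    cases n with
    | zero => simp [TySub.up, TyRen.up, TyCon.rename]
    | succ n => simp [TySub.up, TyCon.weaken_rename_up]
  · simp [TySub.up, h, TyCon.weaken_rename_up]

theorem TySub.up_var (κ : Kind) (ξ : TyRen) :
    TySub.up κ (fun κ' n => .var κ' (ξ κ' n)) = fun κ' n => .var κ' (ξ.up κ κ' n) := by
  funext κ' n
  by_cases h : κ' = κ <;> cases n <;>
    simp [TySub.up, TyRen.up, h, TyCon.weaken, TyCon.rename, TyRen.wk]

theorem TyCon.rename_eq_subst {κ : Kind} (φ : TyCon κ) (ξ : TyRen) :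
    φ.rename ξ = φ.subst (fun κ' n => .var κ' (ξ κ' n)) := by
  induction φ generalizing ξ with
  | var κ n => rfl
  | nat => rfl
  | app φ ψ ih₁ ih₂ => simp [rename, subst, ih₁, ih₂]
  | lam κ φ ih => simp [rename, subst, ih, TySub.up_var]
  | all κ σ ih => simp [rename, subst, ih, TySub.up_var]
  | arr σ τ ih₁ ih₂ => simp [rename, subst, ih₁, ih₂]

theorem TyCon.subst_var {κ : Kind} (φ : TyCon κ) : φ.subst TyCon.var = φ :=
  (φ.rename_eq_subst fun _ n => n).symm.trans φ.rename_id

theorem TyCon.subst_rename {κ : Kind} (φ : TyCon κ) (ξ : TyRen) (θ : TySub) :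
    (φ.rename ξ).subst θ = φ.subst (fun κ' n => θ κ' (ξ κ' n)) := by
  induction φ generalizing ξ θ with
  | var κ n => rfl
  | nat => rfl
  | app φ ψ ih₁ ih₂ => simp [rename, subst, ih₁, ih₂]
  | lam κ φ ih => simp [rename, subst, ih, TySub.up_ren]
  | all κ σ ih => simp [rename, subst, ih, TySub.up_ren]
  | arr σ τ ih₁ ih₂ => simp [rename, subst, ih₁, ih₂]

theorem TyCon.rename_subst {κ : Kind} (φ : TyCon κ) (θ : TySub) (ξ : TyRen) :
    (φ.subst θ).rename ξ = φ.subst (fun κ' n => (θ κ' n).rename ξ) := by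
  induction φ generalizing ξ θ with
  | var κ n => rfl
  | nat => rfl
  | app φ ψ ih₁ ih₂ => simp [rename, subst, ih₁, ih₂]
  | lam κ φ ih => simp [rename, subst, ih, TySub.ren_up]
  | all κ σ ih => simp [rename, subst, ih, TySub.ren_up]
  | arr σ τ ih₁ ih₂ => simp [rename, subst, ih₁, ih₂]

theorem TyCon.weaken_subst_up (κ : Kind) {κ' : Kind} (φ : TyCon κ') (θ : TySub) :
    (φ.weaken κ).subst (θ.up κ) = (φ.subst θ).weaken κ := by
  simp only [weaken, subst_rename, rename_subst, TySub.up_wk]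

theorem TySub.up_comp (κ : Kind) (θ η : TySub) :
    (fun κ' n => (θ.up κ κ' n).subst (η.up κ)) =
      TySub.up κ (fun κ' n => (θ κ' n).subst η) := by
  funext κ' n
  by_cases h : κ' = κ
  · subst h
    cases n with
    | zero => simp [TySub.up, TyCon.subst]
    | succ n => simp [TySub.up, TyCon.weaken_subst_up]
  · simp [TySub.up, h, TyCon.weaken_subst_up]

theorem TyCon.subst_subst {κ : Kind} (φ : TyCon κ) (θ η : TySub) :
    (φ.subst θ).subst η = φ.subst (fun κ' n => (θ κ' n).subst η) := by
  induction φ generalizing θ η with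
  | var κ n => rfl
  | nat => rfl
  | app φ ψ ih₁ ih₂ => simp [subst, ih₁, ih₂]
  | lam κ φ ih => simp [subst, ih, TySub.up_comp]
  | all κ σ ih => simp [subst, ih, TySub.up_comp]
  | arr σ τ ih₁ ih₂ => simp [subst, ih₁, ih₂]

/-- The substitution `θ` extended by `ψ` for the innermost variable of kind `κ`. -/
def TySub.cons {κ : Kind} (ψ : TyCon κ) (θ : TySub) : TySub := fun κ' n =>
  if h : κ' = κ then
    match n with
    | 0 => h ▸ ψ
    | m + 1 => θ κ' m
  else θ κ' n

theorem TySub.single_wk {κ : Kind} (ψ : TyCon κ) :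
    (fun κ' n => TySub.single ψ κ' (TyRen.wk κ κ' n)) = TyCon.var := by
  funext κ' n
  by_cases h : κ' = κ <;> simp [TySub.single, TyRen.wk, h]

theorem TyCon.weaken_inst {κ κ' : Kind} (φ : TyCon κ') (ψ : TyCon κ) :
    (φ.weaken κ).inst ψ = φ := by
  rw [weaken, inst, subst_rename, TySub.single_wk, subst_var]

theorem TySub.up_single {κ : Kind} (θ : TySub) (ψ : TyCon κ) :
    (fun κ' n => (θ.up κ κ' n).subst (TySub.single ψ)) = TySub.cons ψ θ := by
  funext κ' n
  by_cases h : κ' = κ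
  · subst h
    cases n with
    | zero => simp [TySub.up, TyCon.subst, TySub.single, TySub.cons]
    | succ n =>
      simp only [TySub.up, TySub.cons, if_true, dif_pos]
      exact TyCon.weaken_inst _ _
  · simp only [TySub.up, TySub.cons, h, if_false, dite_false]
    exact TyCon.weaken_inst _ _

theorem TySub.single_subst {κ : Kind} (ψ : TyCon κ) (θ : TySub) :
    (fun κ' n => (TySub.single ψ κ' n).subst θ) = TySub.cons (ψ.subst θ) θ := by
  funext κ' n
  by_cases h : κ' = κ
  · subst h
    cases n <;> simp [TyCon.subst, TySub.single, TySub.cons]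
  · simp [TySub.single, TySub.cons, h, TyCon.subst]

theorem TyCon.subst_up_inst {κ κ' : Kind} (φ : TyCon κ') (θ : TySub) (ψ : TyCon κ) :
    (φ.subst (θ.up κ)).inst ψ = φ.subst (TySub.cons ψ θ) := by
  rw [inst, subst_subst, TySub.up_single]

theorem TyCon.inst_subst {κ κ' : Kind} (φ : TyCon κ') (ψ : TyCon κ) (θ : TySub) :
    (φ.inst ψ).subst θ = (φ.subst (θ.up κ)).inst (ψ.subst θ) := by
  rw [subst_up_inst, inst, subst_subst, TySub.single_subst]

theorem TyCon.inst_rename {κ κ' : Kind} (φ : TyCon κ') (ψ : TyCon κ) (ξ : TyRen) :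
    (φ.inst ψ).rename ξ = (φ.rename (ξ.up κ)).inst (ψ.rename ξ) := by
  rw [rename_eq_subst, inst_subst, rename_eq_subst, rename_eq_subst, TySub.up_var]

/-- The renaming that identifies the innermost variable of kind `κ` with the next one. -/
def TyRen.merge (κ : Kind) : TyRen := fun κ' n => if κ' = κ then n - 1 else n

theorem TySub.single_var (κ : Kind) :
    TySub.single (.var κ 0) = fun κ' n => .var κ' (TyRen.merge κ κ' n) := by
  funext κ' n
  by_cases h : κ' = κ
  · subst h
    cases n <;> simp [TySub.single, TyRen.merge]
  · simp [TySub.single, TyRen.merge, h]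

/-- Normalization proofs instantiate a binder with a variable. As this is a mere renaming (not an
injective one), normal forms can be carried back from the instance to the body. -/
theorem TyCon.inst_var {κ κ' : Kind} (φ : TyCon κ') :
    φ.inst (.var κ 0) = φ.rename (TyRen.merge κ) := by
  rw [inst, TySub.single_var, rename_eq_subst]

/-- The typing rule assigns this instance to a weakened term applied to the fresh type variable; it
has to collapse to the original body of the quantifier. -/
theorem TyCon.weaken_up_inst_var {κ κ' : Kind} (φ : TyCon κ') :
    (φ.rename ((TyRen.wk κ).up κ)).inst (.var κ 0) = φ := by
  have : (fun κ' n => TyRen.merge κ κ' ((TyRen.wk κ).up κ κ' n)) = fun _ n => n := by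
    funext κ' n
    by_cases h : κ' = κ <;> cases n <;> simp [TyRen.merge, TyRen.wk, TyRen.up, h]
  rw [inst_var, rename_rename, this, rename_id]

theorem chi_subst (κ : Kind) (θ : TySub) : (chi κ).subst θ = chi κ := by
  induction κ generalizing θ with
  | star => rfl
  | arr κ₁ κ₂ _ ih => simp [chi, TyCon.subst, ih]

/-! ### Confluence of `β`-reduction on type constructors -/

/-- Parallel reduction of type constructors, in the liberal form that may contract redexes
created by the reduction of their parts. -/
inductive TyCon.Par : {κ : Kind} → TyCon κ → TyCon κ → Prop
  | var (κ : Kind) (n : ℕ) : Par (.var κ n) (.var κ n)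
  | nat : Par .nat .nat
  | app {κ₁ κ₂ : Kind} {φ φ' : TyCon (Kind.arr κ₁ κ₂)} {ψ ψ' : TyCon κ₁} :
      Par φ φ' → Par ψ ψ' → Par (.app φ ψ) (.app φ' ψ')
  | lam (κ₁ : Kind) {κ₂ : Kind} {φ φ' : TyCon κ₂} :
      Par φ φ' → Par (.lam κ₁ φ) (.lam κ₁ φ')
  | all (κ : Kind) {σ σ' : Ty} : Par σ σ' → Par (.all κ σ) (.all κ σ')
  | arr {σ σ' τ τ' : Ty} : Par σ σ' → Par τ τ' → Par (.arr σ τ) (.arr σ' τ')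
  | beta {κ₁ κ₂ : Kind} {φ : TyCon (Kind.arr κ₁ κ₂)} {φ' : TyCon κ₂} {ψ ψ' : TyCon κ₁} :
      Par φ (.lam κ₁ φ') → Par ψ ψ' → Par (.app φ ψ) (φ'.inst ψ')

theorem TyCon.Par.refl {κ : Kind} (φ : TyCon κ) : TyCon.Par φ φ := by
  induction φ with
  | var κ n => exact .var κ n
  | nat => exact .nat
  | app φ ψ ih₁ ih₂ => exact .app ih₁ ih₂
  | lam κ φ ih => exact .lam κ ih
  | all κ σ ih => exact .all κ ih
  | arr σ τ ih₁ ih₂ => exact .arr ih₁ ih₂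

theorem TyCon.Par.rename {κ : Kind} {φ φ' : TyCon κ} (h : TyCon.Par φ φ') (ξ : TyRen) :
    TyCon.Par (φ.rename ξ) (φ'.rename ξ) := by
  induction h generalizing ξ with
  | var κ n => exact .refl _
  | nat => exact .nat
  | app _ _ ih₁ ih₂ => exact .app (ih₁ ξ) (ih₂ ξ)
  | lam κ _ ih => exact .lam κ (ih _)
  | all κ _ ih => exact .all κ (ih _)
  | arr _ _ ih₁ ih₂ => exact .arr (ih₁ ξ) (ih₂ ξ)
  | beta _ _ ih₁ ih₂ =>
    rw [TyCon.inst_rename]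
    exact .beta (ih₁ ξ) (ih₂ ξ)

theorem TySub.par_up {θ θ' : TySub} (h : ∀ κ n, TyCon.Par (θ κ n) (θ' κ n)) (κ : Kind) :
    ∀ κ' n, TyCon.Par (θ.up κ κ' n) (θ'.up κ κ' n) := by
  intro κ' n
  by_cases hκ : κ' = κ
  · cases n with
    | zero => simpa [TySub.up, hκ] using .refl _
    | succ n => simpa [TySub.up, hκ, TyCon.weaken] using (h _ n).rename _
  · simpa [TySub.up, hκ, TyCon.weaken] using (h _ n).rename _

theorem TyCon.Par.subst {κ : Kind} {φ φ' : TyCon κ} (h : TyCon.Par φ φ') {θ θ' : TySub}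
    (hθ : ∀ κ n, TyCon.Par (θ κ n) (θ' κ n)) : TyCon.Par (φ.subst θ) (φ'.subst θ') := by
  induction h generalizing θ θ' with
  | var κ n => exact hθ κ n
  | nat => exact .nat
  | app _ _ ih₁ ih₂ => exact .app (ih₁ hθ) (ih₂ hθ)
  | lam κ _ ih => exact .lam κ (ih (TySub.par_up hθ κ))
  | all κ _ ih => exact .all κ (ih (TySub.par_up hθ κ))
  | arr _ _ ih₁ ih₂ => exact .arr (ih₁ hθ) (ih₂ hθ)
  | beta _ _ ih₁ ih₂ =>
    rw [TyCon.inst_subst]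
    exact .beta (ih₁ hθ) (ih₂ hθ)

theorem TySub.par_single {κ : Kind} {ψ ψ' : TyCon κ} (h : TyCon.Par ψ ψ') :
    ∀ κ' n, TyCon.Par (TySub.single ψ κ' n) (TySub.single ψ' κ' n) := by
  intro κ' n
  by_cases hκ : κ' = κ
  · subst hκ
    cases n with
    | zero => simpa [TySub.single] using h
    | succ n => simpa [TySub.single] using .refl _
  · simpa [TySub.single, hκ] using .refl _

theorem TyCon.Par.inst {κ κ' : Kind} {φ φ' : TyCon κ'} {ψ ψ' : TyCon κ}
    (h : TyCon.Par φ φ') (h' : TyCon.Par ψ ψ') : TyCon.Par (φ.inst ψ) (φ'.inst ψ') :=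
  h.subst (TySub.par_single h')

theorem TyCon.Par.lam_inv {κ₁ κ₂ : Kind} {φ : TyCon κ₂} {χ : TyCon (.arr κ₁ κ₂)}
    (h : TyCon.Par (.lam κ₁ φ) χ) : ∃ φ', χ = .lam κ₁ φ' ∧ TyCon.Par φ φ' := by
  cases h with
  | lam _ h => exact ⟨_, rfl, h⟩

theorem TyCon.Par.all_inv {κ : Kind} {σ ρ : Ty} (h : TyCon.Par (.all κ σ) ρ) :
    ∃ σ', ρ = .all κ σ' ∧ TyCon.Par σ σ' := by
  cases h with
  | all _ h => exact ⟨_, rfl, h⟩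

theorem TyCon.Par.arr_inv {σ τ ρ : Ty} (h : TyCon.Par (.arr σ τ) ρ) :
    ∃ σ' τ', ρ = .arr σ' τ' ∧ TyCon.Par σ σ' ∧ TyCon.Par τ τ' := by
  cases h with
  | arr h h' => exact ⟨_, _, rfl, h, h'⟩

theorem TyCon.Par.nat_inv {ρ : Ty} (h : TyCon.Par .nat ρ) : ρ = .nat := by
  cases h; rfl

/-- Induction on `φ`. When only one side contracts the root, the operators are first joined. Their
common reduct is still an abstraction, so the other side can contract too; the liberal rule allows
this in a single parallel step. -/
theorem TyCon.Par.diamond {κ : Kind} {φ φ₁ φ₂ : TyCon κ} (h₁ : TyCon.Par φ φ₁)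
    (h₂ : TyCon.Par φ φ₂) : ∃ φ₃, TyCon.Par φ₁ φ₃ ∧ TyCon.Par φ₂ φ₃ := by
  induction φ with
  | var κ n => cases h₁; cases h₂; exact ⟨_, .refl _, .refl _⟩
  | nat => cases h₁; cases h₂; exact ⟨_, .refl _, .refl _⟩
  | lam κ φ ih =>
    obtain ⟨_, rfl, k₁⟩ := h₁.lam_inv
    obtain ⟨_, rfl, k₂⟩ := h₂.lam_inv
    obtain ⟨φ₃, h₁, h₂⟩ := ih k₁ k₂
    exact ⟨_, .lam κ h₁, .lam κ h₂⟩
  | all κ φ ih =>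
    obtain ⟨_, rfl, k₁⟩ := h₁.all_inv
    obtain ⟨_, rfl, k₂⟩ := h₂.all_inv
    obtain ⟨φ₃, h₁, h₂⟩ := ih k₁ k₂
    exact ⟨_, .all κ h₁, .all κ h₂⟩
  | arr σ τ ihσ ihτ =>
    obtain ⟨_, _, rfl, h₁, h₁'⟩ := h₁.arr_inv
    obtain ⟨_, _, rfl, h₂, h₂'⟩ := h₂.arr_inv
    obtain ⟨σ₃, h₁, h₂⟩ := ihσ h₁ h₂
    obtain ⟨τ₃, h₁', h₂'⟩ := ihτ h₁' h₂'
    exact ⟨_, .arr h₁ h₁', .arr h₂ h₂'⟩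
  | app φ ψ ihφ ihψ =>
    cases h₁ with
    | app h₁ h₁' =>
      cases h₂ with
      | app h₂ h₂' =>
        obtain ⟨φ₃, h₁, h₂⟩ := ihφ h₁ h₂
        obtain ⟨ψ₃, h₁', h₂'⟩ := ihψ h₁' h₂'
        exact ⟨_, .app h₁ h₁', .app h₂ h₂'⟩
      | beta h₂ h₂' =>
        obtain ⟨φ₃, h₁, h₂⟩ := ihφ h₁ h₂
        obtain ⟨ψ₃, h₁', h₂'⟩ := ihψ h₁' h₂'
        obtain ⟨_, rfl, k₂⟩ := h₂.lam_inv
        exact ⟨_, .beta h₁ h₁', k₂.inst h₂'⟩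
    | beta h₁ h₁' =>
      cases h₂ with
      | app h₂ h₂' =>
        obtain ⟨φ₃, h₁, h₂⟩ := ihφ h₁ h₂
        obtain ⟨ψ₃, h₁', h₂'⟩ := ihψ h₁' h₂'
        obtain ⟨_, rfl, k₁⟩ := h₁.lam_inv
        exact ⟨_, k₁.inst h₁', .beta h₂ h₂'⟩
      | beta h₂ h₂' =>
        obtain ⟨φ₃, h₁, h₂⟩ := ihφ h₁ h₂
        obtain ⟨ψ₃, h₁', h₂'⟩ := ihψ h₁' h₂'
        obtain ⟨_, rfl, k₁⟩ := h₁.lam_inv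
        obtain ⟨_, he, k₂⟩ := h₂.lam_inv
        cases he
        exact ⟨_, k₁.inst h₁', k₂.inst h₂'⟩

/-- Iterated parallel reduction of type constructors. -/
abbrev TyCon.Pars {κ : Kind} (φ ψ : TyCon κ) : Prop := Relation.ReflTransGen TyCon.Par φ ψ

theorem TyCon.Pars.confluent {κ : Kind} {φ φ₁ φ₂ : TyCon κ} (h₁ : TyCon.Pars φ φ₁)
    (h₂ : TyCon.Pars φ φ₂) : Relation.Join TyCon.Pars φ₁ φ₂ :=
  Relation.church_rosser
    (fun _ _ _ h h' => let ⟨d, h, h'⟩ := h.diamond h'; ⟨d, .single h, .single h'⟩) h₁ h₂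

theorem TyCon.Beta.par {κ : Kind} {φ ψ : TyCon κ} (h : TyCon.Beta φ ψ) : TyCon.Par φ ψ := by
  induction h with
  | beta φ ψ => exact .beta (.refl _) (.refl _)
  | appL ψ _ ih => exact .app ih (.refl _)
  | appR φ _ ih => exact .app (.refl _) ih
  | lam κ _ ih => exact .lam κ ih
  | all κ _ ih => exact .all κ ih
  | arrL τ _ ih => exact .arr ih (.refl _)
  | arrR σ _ ih => exact .arr (.refl _) ih

namespace TyCon.Conv

theorem refl {κ : Kind} (φ : TyCon κ) : TyCon.Conv φ φ := Relation.EqvGen.refl φ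

theorem symm {κ : Kind} {φ ψ : TyCon κ} (h : TyCon.Conv φ ψ) : TyCon.Conv ψ φ :=
  Relation.EqvGen.symm _ _ h

theorem trans {κ : Kind} {φ ψ χ : TyCon κ} (h : TyCon.Conv φ ψ) (h' : TyCon.Conv ψ χ) :
    TyCon.Conv φ χ := Relation.EqvGen.trans _ _ _ h h'

theorem map {κ κ' : Kind} {f : TyCon κ → TyCon κ'}
    (hf : ∀ φ ψ, TyCon.Beta φ ψ → TyCon.Conv (f φ) (f ψ)) {φ ψ : TyCon κ}
    (h : TyCon.Conv φ ψ) : TyCon.Conv (f φ) (f ψ) := by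
  induction h with
  | rel φ ψ h => exact hf φ ψ h
  | refl φ => exact refl _
  | symm _ _ _ ih => exact ih.symm
  | trans _ _ _ _ _ ih₁ ih₂ => exact ih₁.trans ih₂

theorem app {κ₁ κ₂ : Kind} {φ φ' : TyCon (.arr κ₁ κ₂)} {ψ ψ' : TyCon κ₁}
    (h : TyCon.Conv φ φ') (h' : TyCon.Conv ψ ψ') :
    TyCon.Conv (TyCon.app φ ψ) (TyCon.app φ' ψ') :=
  (map (f := fun φ => TyCon.app φ ψ) (fun _ _ h => .rel _ _ (.appL _ h)) h).trans
    (map (f := fun ψ => TyCon.app φ' ψ) (fun _ _ h => .rel _ _ (.appR _ h)) h')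

theorem lam (κ₁ : Kind) {κ₂ : Kind} {φ φ' : TyCon κ₂} (h : TyCon.Conv φ φ') :
    TyCon.Conv (TyCon.lam κ₁ φ) (TyCon.lam κ₁ φ') :=
  map (fun _ _ h => .rel _ _ (.lam κ₁ h)) h

theorem all (κ : Kind) {σ σ' : Ty} (h : TyCon.Conv σ σ') :
    TyCon.Conv (TyCon.all κ σ) (TyCon.all κ σ') :=
  map (fun _ _ h => .rel _ _ (.all κ h)) h

theorem arr {σ σ' τ τ' : Ty} (h : TyCon.Conv σ σ') (h' : TyCon.Conv τ τ') :
    TyCon.Conv (TyCon.arr σ τ) (TyCon.arr σ' τ') :=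
  (map (f := fun φ => TyCon.arr φ τ) (fun _ _ h => .rel _ _ (.arrL _ h)) h).trans
    (map (f := fun ψ => TyCon.arr σ' ψ) (fun _ _ h => .rel _ _ (.arrR _ h)) h')

theorem of_par {κ : Kind} {φ ψ : TyCon κ} (h : TyCon.Par φ ψ) : TyCon.Conv φ ψ := by
  induction h with
  | var κ n => exact refl _
  | nat => exact refl _
  | app _ _ ih₁ ih₂ => exact ih₁.app ih₂
  | lam κ _ ih => exact ih.lam κ
  | all κ _ ih => exact ih.all κ
  | arr _ _ ih₁ ih₂ => exact ih₁.arr ih₂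
  | beta _ _ ih₁ ih₂ => exact (ih₁.app ih₂).trans (.rel _ _ (.beta _ _))

theorem of_pars {κ : Kind} {φ ψ : TyCon κ} (h : TyCon.Pars φ ψ) : TyCon.Conv φ ψ := by
  induction h with
  | refl => exact refl _
  | tail _ h ih => exact ih.trans (of_par h)

theorem join {κ : Kind} {φ ψ : TyCon κ} (h : TyCon.Conv φ ψ) :
    ∃ χ, TyCon.Pars φ χ ∧ TyCon.Pars ψ χ := by
  induction h with
  | rel φ ψ h => exact ⟨_, .single h.par, .refl⟩
  | refl φ => exact ⟨_, .refl, .refl⟩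
  | symm _ _ _ ih => exact let ⟨χ, h, h'⟩ := ih; ⟨χ, h', h⟩
  | trans _ _ _ _ _ ih₁ ih₂ =>
    obtain ⟨χ₁, h₁, h₁'⟩ := ih₁
    obtain ⟨χ₂, h₂, h₂'⟩ := ih₂
    obtain ⟨χ, h, h'⟩ := h₁'.confluent h₂
    exact ⟨χ, h₁.trans h, h₂'.trans h'⟩

theorem subst {κ : Kind} {φ ψ : TyCon κ} (h : TyCon.Conv φ ψ) (θ : TySub) :
    TyCon.Conv (φ.subst θ) (ψ.subst θ) :=
  map (f := fun φ => φ.subst θ)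
    (fun _ _ h => of_par (h.par.subst fun _ _ => .refl _)) h

theorem rename {κ : Kind} {φ ψ : TyCon κ} (h : TyCon.Conv φ ψ) (ξ : TyRen) :
    TyCon.Conv (φ.rename ξ) (ψ.rename ξ) :=
  map (f := fun φ => φ.rename ξ) (fun _ _ h => of_par (h.par.rename ξ)) h

theorem inst {κ κ' : Kind} {φ φ' : TyCon κ'} {ψ ψ' : TyCon κ} (h : TyCon.Conv φ φ')
    (h' : TyCon.Conv ψ ψ') : TyCon.Conv (φ.inst ψ) (φ'.inst ψ') :=
  (h.subst _).trans <| map (f := fun ψ => φ'.inst ψ)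
    (fun _ _ h => of_par ((Par.refl φ').inst h.par)) h'

end TyCon.Conv

/-! ### Injectivity and disjointness of the type formers modulo convertibility. -/

theorem TyCon.Pars.arr_inv {σ τ ρ : Ty} (h : TyCon.Pars (.arr σ τ) ρ) :
    ∃ σ' τ', ρ = .arr σ' τ' ∧ TyCon.Pars σ σ' ∧ TyCon.Pars τ τ' := by
  induction h with
  | refl => exact ⟨_, _, rfl, .refl, .refl⟩
  | tail _ h ih =>
    obtain ⟨σ', τ', rfl, h₁, h₂⟩ := ih
    obtain ⟨_, _, rfl, h₁', h₂'⟩ := h.arr_inv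
    exact ⟨_, _, rfl, h₁.tail h₁', h₂.tail h₂'⟩

theorem TyCon.Pars.all_inv {κ : Kind} {σ ρ : Ty} (h : TyCon.Pars (.all κ σ) ρ) :
    ∃ σ', ρ = .all κ σ' ∧ TyCon.Pars σ σ' := by
  induction h with
  | refl => exact ⟨_, rfl, .refl⟩
  | tail _ h ih =>
    obtain ⟨σ', rfl, h₁⟩ := ih
    obtain ⟨_, rfl, h₁'⟩ := h.all_inv
    exact ⟨_, rfl, h₁.tail h₁'⟩

theorem TyCon.Pars.nat_inv {ρ : Ty} (h : TyCon.Pars .nat ρ) : ρ = .nat := by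
  induction h with
  | refl => rfl
  | tail _ h ih => subst ih; exact h.nat_inv

/-- Every reduct of an arrow is an arrow reduced componentwise, so a common reduct joins the
components. Inversion of typing for applications depends on this. -/
theorem TyCon.Conv.arr_arr {σ τ σ' τ' : Ty} (h : TyCon.Conv (.arr σ τ) (.arr σ' τ')) :
    TyCon.Conv σ σ' ∧ TyCon.Conv τ τ' := by
  obtain ⟨χ, h₁, h₂⟩ := h.join
  obtain ⟨_, _, rfl, h₁, h₁'⟩ := h₁.arr_inv
  obtain ⟨_, _, he, h₂, h₂'⟩ := h₂.arr_inv
  cases he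
  exact ⟨(of_pars h₁).trans (of_pars h₂).symm, (of_pars h₁').trans (of_pars h₂').symm⟩

theorem TyCon.Conv.all_all {κ κ' : Kind} {σ σ' : Ty}
    (h : TyCon.Conv (.all κ σ) (.all κ' σ')) : κ = κ' ∧ TyCon.Conv σ σ' := by
  obtain ⟨χ, h₁, h₂⟩ := h.join
  obtain ⟨_, rfl, k₁⟩ := h₁.all_inv
  obtain ⟨_, he, k₂⟩ := h₂.all_inv
  cases he
  exact ⟨rfl, (of_pars k₁).trans (of_pars k₂).symm⟩

theorem TyCon.Conv.not_arr_all {κ : Kind} {σ τ ρ : Ty} :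
    ¬ TyCon.Conv (.arr σ τ) (.all κ ρ) := by
  intro h
  obtain ⟨χ, h₁, h₂⟩ := h.join
  obtain ⟨_, _, rfl, -⟩ := h₁.arr_inv
  obtain ⟨_, he, -⟩ := h₂.all_inv
  cases he

theorem TyCon.Conv.not_nat_arr {σ τ : Ty} : ¬ TyCon.Conv .nat (.arr σ τ) := by
  intro h
  obtain ⟨χ, h₁, h₂⟩ := h.join
  obtain ⟨_, _, rfl, -⟩ := h₂.arr_inv
  cases h₁.nat_inv

theorem TyCon.Conv.not_nat_all {κ : Kind} {σ : Ty} : ¬ TyCon.Conv .nat (.all κ σ) := by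
  intro h
  obtain ⟨χ, h₁, h₂⟩ := h.join
  obtain ⟨_, rfl, -⟩ := h₂.all_inv
  cases h₁.nat_inv

/-! ### Normalization of type constructors -/

/-- A type constructor without `β`-redexes, by its structure. -/
def TyCon.Nf : {κ : Kind} → TyCon κ → Prop
  | _, .var _ _ => True
  | _, .nat => True
  | _, .app (κ₁ := κ₁) φ ψ => φ.Nf ∧ ψ.Nf ∧ ∀ φ', φ ≠ .lam κ₁ φ'
  | _, .lam _ φ => φ.Nf
  | _, .all _ σ => σ.Nf
  | _, .arr σ τ => σ.Nf ∧ τ.Nf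

theorem TyCon.Nf.isNormal {κ : Kind} {φ : TyCon κ} (h : φ.Nf) : φ.IsNormal := by
  intro ψ hb
  induction hb with
  | beta φ ψ => exact h.2.2 _ rfl
  | appL ψ _ ih => exact ih h.1
  | appR φ _ ih => exact ih h.2.1
  | lam κ _ ih => exact ih h
  | all κ _ ih => exact ih h
  | arrL τ _ ih => exact ih h.1
  | arrR σ _ ih => exact ih h.2

theorem TyCon.IsNormal.nf {κ : Kind} {φ : TyCon κ} (h : φ.IsNormal) : φ.Nf := by
  induction φ with
  | var κ n => trivial
  | nat => trivial
  | app φ ψ ih₁ ih₂ =>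
    refine ⟨ih₁ fun _ h' => h _ (.appL _ h'), ih₂ fun _ h' => h _ (.appR _ h'), ?_⟩
    rintro φ' rfl
    exact h _ (.beta _ _)
  | lam κ φ ih => exact ih fun _ h' => h _ (.lam κ h')
  | all κ φ ih => exact ih fun _ h' => h _ (.all κ h')
  | arr σ τ ih₁ ih₂ => exact ⟨ih₁ fun _ h' => h _ (.arrL _ h'), ih₂ fun _ h' => h _ (.arrR _ h')⟩

theorem TyCon.Nf.par_eq {κ : Kind} {φ ψ : TyCon κ} (h : φ.Nf) (hp : TyCon.Par φ ψ) :
    ψ = φ := by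
  induction hp with
  | var κ n => rfl
  | nat => rfl
  | app _ _ ih₁ ih₂ => rw [ih₁ h.1, ih₂ h.2.1]
  | lam κ _ ih => rw [ih h]
  | all κ _ ih => rw [ih h]
  | arr _ _ ih₁ ih₂ => rw [ih₁ h.1, ih₂ h.2]
  | beta _ _ ih₁ _ => exact absurd (ih₁ h.1).symm (h.2.2 _)

theorem TyCon.Nf.pars_eq {κ : Kind} {φ ψ : TyCon κ} (h : φ.Nf) (hp : TyCon.Pars φ ψ) :
    ψ = φ := by
  induction hp with
  | refl => rfl
  | tail _ hp ih => subst ih; exact h.par_eq hp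

/-- A normal constructor has only itself as a reduct, so the common reduct supplied by confluence is
`ψ`. -/
theorem TyCon.Conv.pars_nf {κ : Kind} {φ ψ : TyCon κ} (h : TyCon.Conv φ ψ) (hψ : ψ.Nf) :
    TyCon.Pars φ ψ := by
  obtain ⟨χ, h₁, h₂⟩ := h.join
  rwa [hψ.pars_eq h₂] at h₁

/-! ### Renamings reflect normal forms and reductions of type constructors. -/

theorem TyCon.rename_eq_lam {κ₁ κ₂ : Kind} {φ : TyCon (.arr κ₁ κ₂)} {ξ : TyRen}
    {φ' : TyCon κ₂} (h : φ.rename ξ = .lam κ₁ φ') :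
    ∃ ψ, φ = .lam κ₁ ψ ∧ φ' = ψ.rename (ξ.up κ₁) := by
  cases φ with
  | lam κ ψ =>
    simp only [TyCon.rename, TyCon.lam.injEq] at h
    exact ⟨ψ, rfl, h.symm⟩
  | var κ n => simp [TyCon.rename] at h
  | app φ ψ => simp [TyCon.rename] at h

/-- Holds for non-injective renamings as well: whether an application is a redex depends on the
presence of an abstraction, never on the identity of variables. -/
theorem TyCon.nf_rename {κ : Kind} {φ : TyCon κ} {ξ : TyRen} :
    (φ.rename ξ).Nf ↔ φ.Nf := by
  induction φ generalizing ξ with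
  | var κ n => rfl
  | nat => rfl
  | app φ ψ ih₁ ih₂ =>
    simp only [rename, Nf, ih₁, ih₂]
    refine and_congr_right fun _ => and_congr_right fun _ => ⟨?_, ?_⟩
    · rintro h φ' rfl
      exact h _ rfl
    · intro h φ' he
      obtain ⟨ψ, rfl, -⟩ := rename_eq_lam he
      exact h _ rfl
  | lam κ φ ih => simp only [rename, Nf, ih]
  | all κ σ ih => simp only [rename, Nf, ih]
  | arr σ τ ih₁ ih₂ => simp only [rename, Nf, ih₁, ih₂]

theorem TyCon.Par.of_rename {κ : Kind} {φ χ : TyCon κ} {ξ : TyRen}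
    (h : TyCon.Par (φ.rename ξ) χ) : ∃ ψ, χ = ψ.rename ξ ∧ TyCon.Par φ ψ := by
  induction φ generalizing ξ with
  | var κ n => cases h; exact ⟨_, rfl, .refl _⟩
  | nat => cases h; exact ⟨_, rfl, .refl _⟩
  | app φ ψ ih₁ ih₂ =>
    cases h with
    | app h₁ h₂ =>
      obtain ⟨φ', rfl, k₁⟩ := ih₁ h₁
      obtain ⟨ψ', rfl, k₂⟩ := ih₂ h₂
      exact ⟨.app φ' ψ', rfl, .app k₁ k₂⟩
    | beta h₁ h₂ =>
      obtain ⟨_, he, k₁⟩ := ih₁ h₁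
      obtain ⟨ψ', rfl, k₂⟩ := ih₂ h₂
      obtain ⟨_, rfl, rfl⟩ := rename_eq_lam he.symm
      exact ⟨_, (inst_rename _ _ _).symm, .beta k₁ k₂⟩
  | lam κ φ ih =>
    obtain ⟨_, rfl, h'⟩ := h.lam_inv
    obtain ⟨φ', rfl, k⟩ := ih h'
    exact ⟨.lam κ φ', rfl, .lam κ k⟩
  | all κ φ ih =>
    obtain ⟨_, rfl, h'⟩ := h.all_inv
    obtain ⟨φ', rfl, k⟩ := ih h'
    exact ⟨.all κ φ', rfl, .all κ k⟩
  | arr σ τ ih₁ ih₂ =>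
    obtain ⟨_, _, rfl, h₁, h₂⟩ := h.arr_inv
    obtain ⟨σ', rfl, k₁⟩ := ih₁ h₁
    obtain ⟨τ', rfl, k₂⟩ := ih₂ h₂
    exact ⟨.arr σ' τ', rfl, .arr k₁ k₂⟩

theorem TyCon.Pars.of_rename {κ : Kind} {φ χ : TyCon κ} {ξ : TyRen}
    (h : TyCon.Pars (φ.rename ξ) χ) : ∃ ψ, χ = ψ.rename ξ ∧ TyCon.Pars φ ψ := by
  induction h with
  | refl => exact ⟨_, rfl, .refl⟩
  | tail _ h ih =>
    obtain ⟨_, rfl, h'⟩ := ih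
    obtain ⟨_, rfl, k⟩ := h.of_rename
    exact ⟨_, rfl, h'.tail k⟩

/-- `φ` has a normal form. -/
def TyCon.Wn {κ : Kind} (φ : TyCon κ) : Prop := ∃ ψ : TyCon κ, ψ.Nf ∧ TyCon.Conv φ ψ

theorem TyCon.Wn.of_conv {κ : Kind} {φ ψ : TyCon κ} (h : ψ.Wn) (hc : TyCon.Conv φ ψ) :
    φ.Wn :=
  let ⟨χ, hχ, h⟩ := h
  ⟨χ, hχ, hc.trans h⟩

theorem TyCon.Wn.of_rename {κ : Kind} {φ : TyCon κ} {ξ : TyRen} (h : (φ.rename ξ).Wn) :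
    φ.Wn := by
  obtain ⟨χ, hχ, h⟩ := h
  obtain ⟨ψ, rfl, k⟩ := (h.pars_nf hχ).of_rename
  exact ⟨ψ, nf_rename.1 hχ, .of_pars k⟩

/-- Type constructors that consist of a variable applied to arguments. -/
inductive TyCon.Neutral : {κ : Kind} → TyCon κ → Prop
  | var (κ : Kind) (n : ℕ) : Neutral (.var κ n)
  | app {κ₁ κ₂ : Kind} {φ : TyCon (Kind.arr κ₁ κ₂)} (ψ : TyCon κ₁) :
      Neutral φ → Neutral (.app φ ψ)

theorem TyCon.Neutral.par {κ : Kind} {φ ψ : TyCon κ} (h : φ.Neutral) (hp : TyCon.Par φ ψ) :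
    ψ.Neutral := by
  induction hp with
  | var κ n => exact h
  | nat => cases h
  | app _ _ ih₁ _ => cases h with | app _ h => exact .app _ (ih₁ h)
  | lam _ _ _ => cases h
  | all _ _ _ => cases h
  | arr _ _ _ _ => cases h
  | beta _ _ ih₁ _ => cases h with | app _ h => cases ih₁ h

theorem TyCon.Neutral.pars {κ : Kind} {φ ψ : TyCon κ} (h : φ.Neutral)
    (hp : TyCon.Pars φ ψ) : ψ.Neutral := by
  induction hp with
  | refl => exact h
  | tail _ hp ih => exact ih.par hp

/-- The normal form of a neutral operator is a reduct of it, hence neutral and not an abstraction;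
applying it creates no redex. -/
theorem TyCon.Neutral.wn_app {κ₁ κ₂ : Kind} {φ : TyCon (.arr κ₁ κ₂)} {ψ : TyCon κ₁}
    (h : φ.Neutral) (hφ : φ.Wn) (hψ : ψ.Wn) : (TyCon.app φ ψ).Wn := by
  obtain ⟨φ', hφ', hc⟩ := hφ
  obtain ⟨ψ', hψ', hc'⟩ := hψ
  refine ⟨.app φ' ψ', ⟨hφ', hψ', ?_⟩, hc.app hc'⟩
  rintro χ rfl
  cases h.pars (hc.pars_nf hφ')

/-- Reducibility of type constructors. -/
def TyCon.Reducible : {κ : Kind} → TyCon κ → Prop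
  | .star, σ => σ.Wn
  | .arr κ₁ _, φ => φ.Wn ∧ ∀ ψ : TyCon κ₁, ψ.Reducible → (TyCon.app φ ψ).Reducible

theorem TyCon.Reducible.wn {κ : Kind} {φ : TyCon κ} (h : φ.Reducible) : φ.Wn := by
  cases κ with
  | star => simpa [TyCon.Reducible] using h
  | arr κ₁ κ₂ => simp only [TyCon.Reducible] at h; exact h.1

theorem TyCon.Reducible.of_conv {κ : Kind} {φ ψ : TyCon κ} (h : ψ.Reducible)
    (hc : TyCon.Conv φ ψ) : φ.Reducible := by
  induction κ with
  | star =>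
    simp only [TyCon.Reducible] at h ⊢
    exact h.of_conv hc
  | arr κ₁ κ₂ _ ih =>
    simp only [TyCon.Reducible] at h ⊢
    exact ⟨h.1.of_conv hc, fun χ hχ => ih (h.2 χ hχ) (hc.app (.refl _))⟩

theorem TyCon.Neutral.reducible {κ : Kind} {φ : TyCon κ} (h : φ.Neutral) (hw : φ.Wn) :
    φ.Reducible := by
  induction κ with
  | star => simpa [TyCon.Reducible] using hw
  | arr κ₁ κ₂ _ ih =>
    simp only [TyCon.Reducible]
    exact ⟨hw, fun ψ hψ => ih (.app ψ h) (h.wn_app hw hψ.wn)⟩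

theorem TyCon.reducible_var (κ : Kind) (n : ℕ) : (TyCon.var κ n).Reducible :=
  (Neutral.var κ n).reducible ⟨.var κ n, trivial, .refl _⟩

theorem TyCon.reducible_cons {κ : Kind} {ψ : TyCon κ} (h : ψ.Reducible) {θ : TySub}
    (hθ : ∀ κ n, (θ κ n).Reducible) (κ' : Kind) (n : ℕ) :
    (TySub.cons ψ θ κ' n).Reducible := by
  by_cases hκ : κ' = κ
  · subst hκ
    cases n with
    | zero => simpa [TySub.cons] using h
    | succ n => simpa [TySub.cons] using hθ _ n
  · simpa [TySub.cons, hκ] using hθ _ n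

/-- Fundamental lemma of the reducibility method, with an arbitrary reducible substitution so that
the induction passes through binders. -/
theorem TyCon.reducible_subst {κ : Kind} (φ : TyCon κ) {θ : TySub}
    (hθ : ∀ κ n, (θ κ n).Reducible) : (φ.subst θ).Reducible := by
  -- Below a binder, the induction hypothesis is applied to `θ` extended by the variable `0`. The
  -- result is a renaming of `φ.subst (θ.up κ)`, and renamings reflect normalization.
  have wn_body {κ κ' : Kind} {φ : TyCon κ'} {θ : TySub} (hθ : ∀ κ n, (θ κ n).Reducible)
      (ih : ∀ {θ : TySub}, (∀ κ n, (θ κ n).Reducible) → (φ.subst θ).Reducible) :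
      (φ.subst (θ.up κ)).Wn := by
    have h := (ih (reducible_cons (reducible_var κ 0) hθ)).wn
    rw [← subst_up_inst, inst_var] at h
    exact h.of_rename
  induction φ generalizing θ with
  | var κ n => exact hθ κ n
  | nat => exact ⟨.nat, trivial, .refl _⟩
  | app φ ψ ih₁ ih₂ =>
    have h := ih₁ hθ
    simp only [Reducible] at h
    exact h.2 _ (ih₂ hθ)
  | lam κ φ ih =>
    simp only [subst, Reducible]
    obtain ⟨χ, hχ, hc⟩ := wn_body hθ ih (κ := κ)
    refine ⟨⟨.lam κ χ, hχ, hc.lam κ⟩, fun ψ hψ => ?_⟩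
    -- Reducibility is invariant under conversion, so it suffices to treat the β-contractum.
    refine (ih (reducible_cons hψ hθ)).of_conv ?_
    rw [← subst_up_inst]
    exact .rel _ _ (.beta _ _)
  | all κ σ ih =>
    obtain ⟨χ, hχ, hc⟩ := wn_body hθ ih (κ := κ)
    exact ⟨.all κ χ, hχ, hc.all κ⟩
  | arr σ τ ih₁ ih₂ =>
    obtain ⟨χ₁, hχ₁, hc₁⟩ := (ih₁ hθ).wn
    obtain ⟨χ₂, hχ₂, hc₂⟩ := (ih₂ hθ).wn
    exact ⟨.arr χ₁ χ₂, ⟨hχ₁, hχ₂⟩, hc₁.arr hc₂⟩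

theorem TyCon.wn {κ : Kind} (φ : TyCon κ) : φ.Wn := by
  have h := (φ.reducible_subst reducible_var).wn
  rwa [subst_var] at h

/-! ### Substitution calculus for expressions -/

namespace Expr

theorem tyRename_id (s : Expr) : s.tyRename (fun _ n => n) = s := by
  induction s with
  | var i => rfl
  | sym f => rfl
  | lam σ s ih => simp [tyRename, ih, TyCon.rename_id]
  | tlam κ s ih => simp [tyRename, ih, TyRen.up_id]
  | app s t ihs iht => simp [tyRename, ihs, iht]
  | tapp s φ ih => simp [tyRename, ih, TyCon.rename_id]

theorem tyRename_eq_tySubst (s : Expr) (ξ : TyRen) :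
    s.tyRename ξ = s.tySubst (fun κ n => .var κ (ξ κ n)) := by
  induction s generalizing ξ with
  | var i => rfl
  | sym f => rfl
  | lam σ s ih => simp [tyRename, tySubst, ih, TyCon.rename_eq_subst]
  | tlam κ s ih => simp [tyRename, tySubst, ih, TySub.up_var]
  | app s t ihs iht => simp [tyRename, tySubst, ihs, iht]
  | tapp s φ ih => simp [tyRename, tySubst, ih, TyCon.rename_eq_subst]

theorem tySubst_var (s : Expr) : s.tySubst TyCon.var = s :=
  (s.tyRename_eq_tySubst fun _ n => n).symm.trans s.tyRename_id

theorem tySubst_tyRename (s : Expr) (ξ : TyRen) (θ : TySub) :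
    (s.tyRename ξ).tySubst θ = s.tySubst (fun κ n => θ κ (ξ κ n)) := by
  induction s generalizing ξ θ with
  | var i => rfl
  | sym f => rfl
  | lam σ s ih => simp [tyRename, tySubst, ih, TyCon.subst_rename]
  | tlam κ s ih => simp [tyRename, tySubst, ih, TySub.up_ren]
  | app s t ihs iht => simp [tyRename, tySubst, ihs, iht]
  | tapp s φ ih => simp [tyRename, tySubst, ih, TyCon.subst_rename]

theorem tyRename_tySubst (s : Expr) (θ : TySub) (ξ : TyRen) :
    (s.tySubst θ).tyRename ξ = s.tySubst (fun κ n => (θ κ n).rename ξ) := by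
  induction s generalizing ξ θ with
  | var i => rfl
  | sym f => rfl
  | lam σ s ih => simp [tyRename, tySubst, ih, TyCon.rename_subst]
  | tlam κ s ih => simp [tyRename, tySubst, ih, TySub.ren_up]
  | app s t ihs iht => simp [tyRename, tySubst, ihs, iht]
  | tapp s φ ih => simp [tyRename, tySubst, ih, TyCon.rename_subst]

theorem tySubst_tySubst (s : Expr) (θ η : TySub) :
    (s.tySubst θ).tySubst η = s.tySubst (fun κ n => (θ κ n).subst η) := by
  induction s generalizing θ η with
  | var i => rfl
  | sym f => rfl
  | lam σ s ih => simp [tySubst, ih, TyCon.subst_subst]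
  | tlam κ s ih => simp [tySubst, ih, TySub.up_comp]
  | app s t ihs iht => simp [tySubst, ihs, iht]
  | tapp s φ ih => simp [tySubst, ih, TyCon.subst_subst]

theorem tyWeaken_tySubst_up (κ : Kind) (s : Expr) (θ : TySub) :
    (s.tyWeaken κ).tySubst (θ.up κ) = (s.tySubst θ).tyWeaken κ := by
  simp only [tyWeaken, tySubst_tyRename, tyRename_tySubst, TySub.up_wk]
  rfl

theorem tyWeaken_tyInst {κ : Kind} (s : Expr) (φ : TyCon κ) :
    (s.tyWeaken κ).tyInst φ = s := by
  rw [tyWeaken, tyInst, tySubst_tyRename, TySub.single_wk, tySubst_var]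

theorem tySubst_up_tyInst {κ : Kind} (s : Expr) (θ : TySub) (φ : TyCon κ) :
    (s.tySubst (θ.up κ)).tyInst φ = s.tySubst (TySub.cons φ θ) := by
  rw [tyInst, tySubst_tySubst, TySub.up_single]

theorem tyInst_tySubst {κ : Kind} (s : Expr) (φ : TyCon κ) (θ : TySub) :
    (s.tyInst φ).tySubst θ = (s.tySubst (θ.up κ)).tyInst (φ.subst θ) := by
  rw [tySubst_up_tyInst, tyInst, tySubst_tySubst, TySub.single_subst]

theorem tyInst_var {κ : Kind} (s : Expr) :
    s.tyInst (.var κ 0) = s.tyRename (TyRen.merge κ) := by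
  rw [tyInst, TySub.single_var, tyRename_eq_tySubst]

/-! ### Renaming and substitution of term variables. -/

theorem renUp_comp (r q : ℕ → ℕ) : (fun i => renUp q (renUp r i)) = renUp fun i => q (r i) := by
  funext i
  cases i <;> rfl

theorem renUp_id : renUp (fun i => i) = fun i => i := by
  funext i
  cases i <;> rfl

theorem rename_rename (s : Expr) (r q : ℕ → ℕ) :
    (s.rename r).rename q = s.rename (fun i => q (r i)) := by
  induction s generalizing r q with
  | var i => rfl
  | sym f => rfl
  | lam σ s ih => simp [rename, ih, renUp_comp]
  | tlam κ s ih => simp [rename, ih]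
  | app s t ihs iht => simp [rename, ihs, iht]
  | tapp s φ ih => simp [rename, ih]

theorem rename_id (s : Expr) : s.rename (fun i => i) = s := by
  induction s with
  | var i => rfl
  | sym f => rfl
  | lam σ s ih => simp [rename, ih, renUp_id]
  | tlam κ s ih => simp [rename, ih]
  | app s t ihs iht => simp [rename, ihs, iht]
  | tapp s φ ih => simp [rename, ih]

theorem weaken_rename_renUp (s : Expr) (r : ℕ → ℕ) :
    s.weaken.rename (renUp r) = (s.rename r).weaken := by
  simp only [weaken, rename_rename, renUp]

theorem rename_tySubst (s : Expr) (r : ℕ → ℕ) (θ : TySub) :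
    (s.rename r).tySubst θ = (s.tySubst θ).rename r := by
  induction s generalizing r θ with
  | var i => rfl
  | sym f => rfl
  | lam σ s ih => simp [rename, tySubst, ih]
  | tlam κ s ih => simp [rename, tySubst, ih]
  | app s t ihs iht => simp [rename, tySubst, ihs, iht]
  | tapp s φ ih => simp [rename, tySubst, ih]

theorem rename_tyRename (s : Expr) (r : ℕ → ℕ) (ξ : TyRen) :
    (s.rename r).tyRename ξ = (s.tyRename ξ).rename r := by
  simp only [tyRename_eq_tySubst, rename_tySubst]

theorem subUp_var (r : ℕ → ℕ) :
    subUp (fun i => .var (r i)) = fun i => .var (renUp r i) := by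
  funext i
  cases i <;> rfl

theorem rename_eq_subst (s : Expr) (r : ℕ → ℕ) :
    s.rename r = s.subst (fun i => .var (r i)) := by
  induction s generalizing r with
  | var i => rfl
  | sym f => rfl
  | lam σ s ih => simp [rename, subst, ih, subUp_var]
  | tlam κ s ih => simp [rename, subst, ih, tyWeaken, tyRename]
  | app s t ihs iht => simp [rename, subst, ihs, iht]
  | tapp s φ ih => simp [rename, subst, ih]

theorem subst_var (s : Expr) : s.subst Expr.var = s :=
  (s.rename_eq_subst fun i => i).symm.trans s.rename_id

theorem subUp_renUp (r : ℕ → ℕ) (u : ℕ → Expr) :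
    (fun i => subUp u (renUp r i)) = subUp fun i => u (r i) := by
  funext i
  cases i <;> rfl

theorem subst_rename (s : Expr) (r : ℕ → ℕ) (u : ℕ → Expr) :
    (s.rename r).subst u = s.subst (fun i => u (r i)) := by
  induction s generalizing r u with
  | var i => rfl
  | sym f => rfl
  | lam σ s ih => simp [rename, subst, ih, subUp_renUp]
  | tlam κ s ih => simp [rename, subst, ih]
  | app s t ihs iht => simp [rename, subst, ihs, iht]
  | tapp s φ ih => simp [rename, subst, ih]

theorem subUp_rename (u : ℕ → Expr) (r : ℕ → ℕ) :
    (fun i => (subUp u i).rename (renUp r)) = subUp fun i => (u i).rename r := by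
  funext i
  cases i with
  | zero => rfl
  | succ i => exact weaken_rename_renUp _ _

theorem rename_subst (s : Expr) (u : ℕ → Expr) (r : ℕ → ℕ) :
    (s.subst u).rename r = s.subst (fun i => (u i).rename r) := by
  induction s generalizing r u with
  | var i => rfl
  | sym f => rfl
  | lam σ s ih => simp [rename, subst, ih, subUp_rename]
  | tlam κ s ih => simp [rename, subst, ih, tyWeaken, rename_tyRename]
  | app s t ihs iht => simp [rename, subst, ihs, iht]
  | tapp s φ ih => simp [rename, subst, ih]

theorem subUp_tySubst (u : ℕ → Expr) (θ : TySub) :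
    (fun i => (subUp u i).tySubst θ) = subUp fun i => (u i).tySubst θ := by
  funext i
  cases i with
  | zero => rfl
  | succ i => exact rename_tySubst _ _ _

theorem subst_tySubst (s : Expr) (u : ℕ → Expr) (θ : TySub) :
    (s.subst u).tySubst θ = (s.tySubst θ).subst (fun i => (u i).tySubst θ) := by
  induction s generalizing u θ with
  | var i => rfl
  | sym f => rfl
  | lam σ s ih => simp [tySubst, subst, ih, subUp_tySubst]
  | tlam κ s ih => simp [tySubst, subst, ih, tyWeaken_tySubst_up]
  | app s t ihs iht => simp [tySubst, subst, ihs, iht]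
  | tapp s φ ih => simp [tySubst, subst, ih]

theorem subst_tyRename (s : Expr) (u : ℕ → Expr) (ξ : TyRen) :
    (s.subst u).tyRename ξ = (s.tyRename ξ).subst (fun i => (u i).tyRename ξ) := by
  simp only [tyRename_eq_tySubst, subst_tySubst]

theorem weaken_subst_subUp (s : Expr) (u : ℕ → Expr) :
    s.weaken.subst (subUp u) = (s.subst u).weaken := by
  simp only [weaken, subst_rename, rename_subst]
  rfl

theorem subUp_subst (u v : ℕ → Expr) :
    (fun i => (subUp u i).subst (subUp v)) = subUp fun i => (u i).subst v := by
  funext i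
  cases i with
  | zero => rfl
  | succ i => exact weaken_subst_subUp _ _

theorem subst_subst (s : Expr) (u v : ℕ → Expr) :
    (s.subst u).subst v = s.subst (fun i => (u i).subst v) := by
  induction s generalizing u v with
  | var i => rfl
  | sym f => rfl
  | lam σ s ih => simp [subst, ih, subUp_subst]
  | tlam κ s ih => simp [subst, ih, tyWeaken, subst_tyRename]
  | app s t ihs iht => simp [subst, ihs, iht]
  | tapp s φ ih => simp [subst, ih]

/-- The substitution `u` extended by `t` for the innermost variable. -/
def subCons (t : Expr) (u : ℕ → Expr) : ℕ → Expr
  | 0 => t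
  | i + 1 => u i

theorem weaken_inst (s t : Expr) : s.weaken.inst t = s := by
  rw [weaken, inst, subst_rename]
  exact s.subst_var

theorem subst_subUp_inst (s : Expr) (u : ℕ → Expr) (t : Expr) :
    (s.subst (subUp u)).inst t = s.subst (subCons t u) := by
  rw [inst, subst_subst]
  congr 1
  funext i
  cases i with
  | zero => rfl
  | succ i => exact weaken_inst _ _

theorem inst_subst (s t : Expr) (u : ℕ → Expr) :
    (s.inst t).subst u = (s.subst (subUp u)).inst (t.subst u) := by
  rw [subst_subUp_inst, inst, subst_subst]
  congr 1
  funext i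
  cases i <;> rfl

theorem inst_tySubst (s t : Expr) (θ : TySub) :
    (s.inst t).tySubst θ = (s.tySubst θ).inst (t.tySubst θ) := by
  rw [inst, subst_tySubst, inst]
  congr 1
  funext i
  cases i <;> rfl

theorem tyInst_subst {κ : Kind} (s : Expr) (φ : TyCon κ) (u : ℕ → Expr) :
    (s.tyInst φ).subst u = (s.subst fun i => (u i).tyWeaken κ).tyInst φ := by
  rw [tyInst, tyInst, subst_tySubst]
  congr 1
  funext i
  exact (tyWeaken_tyInst _ φ).symm

theorem inst_var (s : Expr) : s.inst (.var 0) = s.rename Nat.pred := by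
  rw [inst, rename_eq_subst]
  congr 1
  funext i
  cases i <;> rfl

theorem weaken_subst_tyWeaken (s : Expr) (u : ℕ → Expr) (κ : Kind) :
    (s.tyWeaken κ).subst (fun i => (u i).tyWeaken κ) = (s.subst u).tyWeaken κ :=
  (subst_tyRename s u _).symm

end Expr

/-! ### Confluence on expressions -/

namespace Expr

/-- The reduction rules at the root of an expression. -/
inductive Root : Expr → Expr → Prop
  | beta (σ : Ty) (s t : Expr) : Root (.app (.lam σ s) t) (s.inst t)
  | tbeta {κ : Kind} (s : Expr) (φ : TyCon κ) : Root (.tapp (.tlam κ s) φ) (s.tyInst φ)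
  | circNat (o : Op) (n m : ℕ) :
      Root (.app (.app (.tapp (.sym (.op o)) TyCon.nat) (.sym (.num n))) (.sym (.num m)))
        (.sym (.num (o.eval n m)))
  | circArr (o : Op) (σ τ : Ty) (s t : Expr) :
      Root (.app (.app (.tapp (.sym (.op o)) (TyCon.arr σ τ)) s) t)
        (.lam σ (.app (.app (.tapp (.sym (.op o)) τ) (.app s.weaken (.var 0)))
          (.app t.weaken (.var 0))))
  | circAll (o : Op) (κ : Kind) (σ : Ty) (s t : Expr) :
      Root (.app (.app (.tapp (.sym (.op o)) (TyCon.all κ σ)) s) t)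
        (.tlam κ (.app (.app (.tapp (.sym (.op o)) σ) (.tapp (s.tyWeaken κ) (TyCon.var κ 0)))
          (.tapp (t.tyWeaken κ) (TyCon.var κ 0))))
  | flatNat (s : Expr) : Root (.app (.tapp (.sym .flatten) TyCon.nat) s) s
  | flatArr (σ τ : Ty) (s : Expr) :
      Root (.app (.tapp (.sym .flatten) (TyCon.arr σ τ)) s)
        (.app (.tapp (.sym .flatten) τ)
          (.app s (.app (.tapp (.sym .lift) σ) (.sym (.num 0)))))
  | flatAll (κ : Kind) (σ : Ty) (s : Expr) :
      Root (.app (.tapp (.sym .flatten) (TyCon.all κ σ)) s)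
        (.app (.tapp (.sym .flatten) (σ.inst (chi κ))) (.tapp s (chi κ)))
  | liftNat (s : Expr) : Root (.app (.tapp (.sym .lift) TyCon.nat) s) s
  | liftArr (σ τ : Ty) (s : Expr) :
      Root (.app (.tapp (.sym .lift) (TyCon.arr σ τ)) s)
        (.lam σ (.app (.tapp (.sym .lift) τ) s.weaken))
  | liftAll (κ : Kind) (σ : Ty) (s : Expr) :
      Root (.app (.tapp (.sym .lift) (TyCon.all κ σ)) s)
        (.tlam κ (.app (.tapp (.sym .lift) σ) (s.tyWeaken κ)))

theorem Root.step {s t : Expr} (h : Root s t) : Step s t := by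
  cases h with
  | beta σ s t => exact .beta σ s t
  | tbeta s φ => exact .tbeta s φ
  | circNat o n m => exact .circNat o n m
  | circArr o σ τ s t => exact .circArr o σ τ s t
  | circAll o κ σ s t => exact .circAll o κ σ s t
  | flatNat => exact .flatNat _
  | flatArr σ τ s => exact .flatArr σ τ s
  | flatAll κ σ s => exact .flatAll κ σ s
  | liftNat => exact .liftNat _
  | liftArr σ τ s => exact .liftArr σ τ s
  | liftAll κ σ s => exact .liftAll κ σ s

/-- The outermost form, the function symbol and the head of its type argument leave at most one
rule, and its contractum is a function of the redex. -/
theorem Root.det {s t t' : Expr} (h : Root s t) (h' : Root s t') : t = t' := by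
  cases h <;> cases h' <;> rfl

theorem Root.subst {s t : Expr} (h : Root s t) (u : ℕ → Expr) :
    Root (s.subst u) (t.subst u) := by
  cases h with
  | beta σ s t => rw [inst_subst]; exact .beta σ _ _
  | tbeta s φ => rw [tyInst_subst]; exact .tbeta _ φ
  | circNat o n m => exact .circNat o n m
  | circArr o σ τ s t =>
    simp only [Expr.subst, weaken_subst_subUp]
    exact .circArr o σ τ _ _
  | circAll o κ σ s t =>
    simp only [Expr.subst, weaken_subst_tyWeaken]
    exact .circAll o κ σ _ _
  | flatNat s => exact .flatNat _
  | flatArr σ τ s => exact .flatArr σ τ _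
  | flatAll κ σ s => exact .flatAll κ σ _
  | liftNat s => exact .liftNat _
  | liftArr σ τ s =>
    simp only [Expr.subst, weaken_subst_subUp]
    exact .liftArr σ τ _
  | liftAll κ σ s =>
    simp only [Expr.subst, weaken_subst_tyWeaken]
    exact .liftAll κ σ _

/-- The rules inspect a type only for the formers `nat`, `→` and `∀`, which substitution preserves.
The rule for `flatten` at `∀` is stable because `chi κ` is closed. -/
theorem Root.tySubst {s t : Expr} (h : Root s t) (θ : TySub) :
    Root (s.tySubst θ) (t.tySubst θ) := by
  have hw (s : Expr) : s.weaken.tySubst θ = (s.tySubst θ).weaken := rename_tySubst s _ θ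
  have hv (κ : Kind) : θ.up κ κ 0 = .var κ 0 := by simp [TySub.up]
  cases h with
  | beta σ s t => rw [inst_tySubst]; exact .beta _ _ _
  | tbeta s φ => rw [tyInst_tySubst]; exact .tbeta _ _
  | circNat o n m => exact .circNat o n m
  | circArr o σ τ s t =>
    simp only [Expr.tySubst, hw]
    exact .circArr o _ _ _ _
  | circAll o κ σ s t =>
    simp only [Expr.tySubst, tyWeaken_tySubst_up, TyCon.subst, hv]
    exact .circAll o κ _ _ _
  | flatNat s => exact .flatNat _
  | flatArr σ τ s => exact .flatArr _ _ _
  | flatAll κ σ s =>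
    simp only [Expr.tySubst, TyCon.inst_subst, chi_subst]
    exact .flatAll κ _ _
  | liftNat s => exact .liftNat _
  | liftArr σ τ s =>
    simp only [Expr.tySubst, hw]
    exact .liftArr _ _ _
  | liftAll κ σ s =>
    simp only [Expr.tySubst, tyWeaken_tySubst_up]
    exact .liftAll κ _ _

theorem Root.rename {s t : Expr} (h : Root s t) (r : ℕ → ℕ) :
    Root (s.rename r) (t.rename r) := by
  simpa only [rename_eq_subst] using h.subst _

theorem Root.tyRename {s t : Expr} (h : Root s t) (ξ : TyRen) :
    Root (s.tyRename ξ) (t.tyRename ξ) := by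
  simpa only [tyRename_eq_tySubst] using h.tySubst _

/-- Parallel reduction of expressions and of the types written in them. -/
inductive Par : Expr → Expr → Prop
  | var (i : ℕ) : Par (.var i) (.var i)
  | sym (f : FSym) : Par (.sym f) (.sym f)
  | lam {σ σ' : Ty} {s s' : Expr} : TyCon.Par σ σ' → Par s s' → Par (.lam σ s) (.lam σ' s')
  | tlam (κ : Kind) {s s' : Expr} : Par s s' → Par (.tlam κ s) (.tlam κ s')
  | app {s s' t t' : Expr} : Par s s' → Par t t' → Par (.app s t) (.app s' t')
  | tapp {κ : Kind} {s s' : Expr} {φ φ' : TyCon κ} :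
      Par s s' → TyCon.Par φ φ' → Par (.tapp s φ) (.tapp s' φ')
  | appRoot {s s' t t' r : Expr} :
      Par s s' → Par t t' → Root (.app s' t') r → Par (.app s t) r
  | tappRoot {κ : Kind} {s s' r : Expr} {φ φ' : TyCon κ} :
      Par s s' → TyCon.Par φ φ' → Root (.tapp s' φ') r → Par (.tapp s φ) r

theorem Par.refl (s : Expr) : Par s s := by
  induction s with
  | var i => exact .var i
  | sym f => exact .sym f
  | lam σ s ih => exact .lam (.refl σ) ih
  | tlam κ s ih => exact .tlam κ ih
  | app s t ihs iht => exact .app ihs iht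
  | tapp s φ ih => exact .tapp ih (.refl φ)

theorem Root.par {s t : Expr} (h : Root s t) : Par s t := by
  cases s with
  | app s t => exact .appRoot (.refl _) (.refl _) h
  | tapp s φ => exact .tappRoot (.refl _) (.refl _) h
  | _ => cases h

theorem Step.par {s t : Expr} (h : Step s t) : Par s t := by
  induction h with
  | lam σ _ ih => exact .lam (.refl _) ih
  | tlam κ _ ih => exact .tlam κ ih
  | appR u _ ih => exact .app (.refl _) ih
  | appL u _ ih => exact .app ih (.refl _)
  | tapp φ _ ih => exact .tapp ih (.refl _)
  | beta σ s t => exact (Root.beta σ s t).par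
  | tbeta s φ => exact (Root.tbeta s φ).par
  | circNat o n m => exact (Root.circNat o n m).par
  | circArr o σ τ s t => exact (Root.circArr o σ τ s t).par
  | circAll o κ σ s t => exact (Root.circAll o κ σ s t).par
  | flatNat s => exact (Root.flatNat _).par
  | flatArr σ τ s => exact (Root.flatArr σ τ s).par
  | flatAll κ σ s => exact (Root.flatAll κ σ s).par
  | liftNat s => exact (Root.liftNat s).par
  | liftArr σ τ s => exact (Root.liftArr σ τ s).par
  | liftAll κ σ s => exact (Root.liftAll κ σ s).par

theorem Par.tySubst {s s' : Expr} (h : Par s s') {θ θ' : TySub}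
    (hθ : ∀ κ n, TyCon.Par (θ κ n) (θ' κ n)) : Par (s.tySubst θ) (s'.tySubst θ') := by
  induction h generalizing θ θ' with
  | var i => exact .var i
  | sym f => exact .sym f
  | lam hσ _ ih => exact .lam (hσ.subst hθ) (ih hθ)
  | tlam κ _ ih => exact .tlam κ (ih (TySub.par_up hθ κ))
  | app _ _ ihs iht => exact .app (ihs hθ) (iht hθ)
  | tapp _ hφ ih => exact .tapp (ih hθ) (hφ.subst hθ)
  | appRoot _ _ hr ihs iht => exact .appRoot (ihs hθ) (iht hθ) (hr.tySubst θ')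
  | tappRoot _ hφ hr ih => exact .tappRoot (ih hθ) (hφ.subst hθ) (hr.tySubst θ')

theorem Par.tyRename {s s' : Expr} (h : Par s s') (ξ : TyRen) :
    Par (s.tyRename ξ) (s'.tyRename ξ) := by
  simpa only [tyRename_eq_tySubst] using h.tySubst fun _ _ => .refl _

theorem Par.rename {s s' : Expr} (h : Par s s') (r : ℕ → ℕ) :
    Par (s.rename r) (s'.rename r) := by
  induction h generalizing r with
  | var i => exact .var _
  | sym f => exact .sym f
  | lam hσ _ ih => exact .lam hσ (ih _)
  | tlam κ _ ih => exact .tlam κ (ih _)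
  | app _ _ ihs iht => exact .app (ihs r) (iht r)
  | tapp _ hφ ih => exact .tapp (ih r) hφ
  | appRoot _ _ hr ihs iht => exact .appRoot (ihs r) (iht r) (hr.rename r)
  | tappRoot _ hφ hr ih => exact .tappRoot (ih r) hφ (hr.rename r)

theorem Par.subst {s s' : Expr} (h : Par s s') {u u' : ℕ → Expr}
    (hu : ∀ i, Par (u i) (u' i)) : Par (s.subst u) (s'.subst u') := by
  induction h generalizing u u' with
  | var i => exact hu i
  | sym f => exact .sym f
  | lam hσ _ ih =>
    refine .lam hσ (ih fun i => ?_)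
    cases i with
    | zero => exact .var 0
    | succ i => exact (hu i).rename _
  | tlam κ _ ih => exact .tlam κ (ih fun i => (hu i).tyRename _)
  | app _ _ ihs iht => exact .app (ihs hu) (iht hu)
  | tapp _ hφ ih => exact .tapp (ih hu) hφ
  | appRoot _ _ hr ihs iht => exact .appRoot (ihs hu) (iht hu) (hr.subst u')
  | tappRoot _ hφ hr ih => exact .tappRoot (ih hu) hφ (hr.subst u')

theorem Par.inst {s s' t t' : Expr} (h : Par s s') (h' : Par t t') :
    Par (s.inst t) (s'.inst t') := by
  refine h.subst fun i => ?_
  cases i with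
  | zero => exact h'
  | succ i => exact .var i

theorem Par.tyInst {κ : Kind} {s s' : Expr} {φ φ' : TyCon κ} (h : Par s s')
    (h' : TyCon.Par φ φ') : Par (s.tyInst φ) (s'.tyInst φ') :=
  h.tySubst (TySub.par_single h')

theorem Par.sym_inv {f : FSym} {t : Expr} (h : Par (.sym f) t) : t = .sym f := by
  cases h; rfl

theorem Par.lam_inv {σ : Ty} {s t : Expr} (h : Par (.lam σ s) t) :
    ∃ σ' s', t = .lam σ' s' ∧ TyCon.Par σ σ' ∧ Par s s' := by
  cases h with
  | lam h h' => exact ⟨_, _, rfl, h, h'⟩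

theorem Par.tlam_inv {κ : Kind} {s t : Expr} (h : Par (.tlam κ s) t) :
    ∃ s', t = .tlam κ s' ∧ Par s s' := by
  cases h with
  | tlam _ h => exact ⟨_, rfl, h⟩

theorem Par.tapp_sym_inv {f : FSym} {κ : Kind} {φ : TyCon κ} {t : Expr}
    (h : Par (.tapp (.sym f) φ) t) : ∃ φ', t = .tapp (.sym f) φ' ∧ TyCon.Par φ φ' := by
  cases h with
  | tapp h h' => cases h; exact ⟨_, rfl, h'⟩
  | tappRoot h _ hr => cases h; cases hr

theorem Par.app_op_inv {o : Op} {σ : Ty} {s t : Expr}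
    (h : Par (.app (.tapp (.sym (.op o)) σ) s) t) :
    ∃ σ' s', t = .app (.tapp (.sym (.op o)) σ') s' ∧ TyCon.Par σ σ' ∧ Par s s' := by
  cases h with
  | app h h' =>
    obtain ⟨σ', rfl, hσ⟩ := h.tapp_sym_inv
    exact ⟨_, _, rfl, hσ, h'⟩
  | appRoot h _ hr =>
    obtain ⟨σ', rfl, hσ⟩ := h.tapp_sym_inv
    cases hr

/-- Reducing the parts of a redex does not destroy it: abstractions and numerals keep their form,
`∘_σ` and `∘_σ · s` are never redexes themselves, and a type headed by `nat`, `→` or `∀` keeps its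
head. The contractum then follows by congruence and substitution. -/
theorem Root.par_app {s t s' t' r : Expr} (h : Root (.app s t) r) (hs : Par s s')
    (ht : Par t t') : ∃ r', Root (.app s' t') r' ∧ Par r r' := by
  cases h with
  | beta σ s t =>
    obtain ⟨σ', s', rfl, -, hs'⟩ := hs.lam_inv
    exact ⟨_, .beta _ _ _, hs'.inst ht⟩
  | circNat o n m =>
    obtain ⟨σ', s', rfl, hσ, hs'⟩ := hs.app_op_inv
    obtain rfl := hσ.nat_inv
    obtain rfl := hs'.sym_inv
    obtain rfl := ht.sym_inv
    exact ⟨_, .circNat _ _ _, .refl _⟩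
  | circArr o σ τ s t =>
    obtain ⟨σ', s', rfl, hσ, hs'⟩ := hs.app_op_inv
    obtain ⟨_, _, rfl, h₁, h₂⟩ := hσ.arr_inv
    exact ⟨_, .circArr _ _ _ _ _, .lam h₁ (.app (.app (.tapp (.sym _) h₂)
      (.app (hs'.rename _) (.var 0))) (.app (ht.rename _) (.var 0)))⟩
  | circAll o κ σ s t =>
    obtain ⟨σ', s', rfl, hσ, hs'⟩ := hs.app_op_inv
    obtain ⟨_, rfl, h₁⟩ := hσ.all_inv
    exact ⟨_, .circAll _ _ _ _ _, .tlam κ (.app (.app (.tapp (.sym _) h₁)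
      (.tapp (hs'.tyRename _) (.refl _))) (.tapp (ht.tyRename _) (.refl _)))⟩
  | flatNat s =>
    obtain ⟨σ', rfl, hσ⟩ := hs.tapp_sym_inv
    obtain rfl := hσ.nat_inv
    exact ⟨_, .flatNat _, ht⟩
  | flatArr σ τ s =>
    obtain ⟨σ', rfl, hσ⟩ := hs.tapp_sym_inv
    obtain ⟨_, _, rfl, h₁, h₂⟩ := hσ.arr_inv
    exact ⟨_, .flatArr _ _ _, .app (.tapp (.sym _) h₂)
      (.app ht (.app (.tapp (.sym _) h₁) (.sym _)))⟩
  | flatAll κ σ s =>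
    obtain ⟨σ', rfl, hσ⟩ := hs.tapp_sym_inv
    obtain ⟨_, rfl, h₁⟩ := hσ.all_inv
    exact ⟨_, .flatAll _ _ _, .app (.tapp (.sym _) (h₁.inst (.refl _)))
      (.tapp ht (.refl _))⟩
  | liftNat s =>
    obtain ⟨σ', rfl, hσ⟩ := hs.tapp_sym_inv
    obtain rfl := hσ.nat_inv
    exact ⟨_, .liftNat _, ht⟩
  | liftArr σ τ s =>
    obtain ⟨σ', rfl, hσ⟩ := hs.tapp_sym_inv
    obtain ⟨_, _, rfl, h₁, h₂⟩ := hσ.arr_inv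
    exact ⟨_, .liftArr _ _ _, .lam h₁ (.app (.tapp (.sym _) h₂) (ht.rename _))⟩
  | liftAll κ σ s =>
    obtain ⟨σ', rfl, hσ⟩ := hs.tapp_sym_inv
    obtain ⟨_, rfl, h₁⟩ := hσ.all_inv
    exact ⟨_, .liftAll _ _ _, .tlam κ (.app (.tapp (.sym _) h₁) (ht.tyRename _))⟩

theorem Root.par_tapp {κ : Kind} {s s' r : Expr} {φ φ' : TyCon κ} (h : Root (.tapp s φ) r)
    (hs : Par s s') (hφ : TyCon.Par φ φ') : ∃ r', Root (.tapp s' φ') r' ∧ Par r r' := by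
  cases h with
  | tbeta s φ =>
    obtain ⟨s', rfl, hs'⟩ := hs.tlam_inv
    exact ⟨_, .tbeta _ _, hs'.tyInst hφ⟩

/-- The parts are joined by induction. A root redex contracted on either side persists in the joined
parts, and contracting it there closes the diagram; if both sides contract the root, `Root.det`
identifies the two contracta. -/
theorem Par.diamond {s s₁ s₂ : Expr} (h₁ : Par s s₁) (h₂ : Par s s₂) :
    ∃ s₃, Par s₁ s₃ ∧ Par s₂ s₃ := by
  induction s generalizing s₁ s₂ with
  | var i => cases h₁; cases h₂; exact ⟨_, .refl _, .refl _⟩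
  | sym f => cases h₁; cases h₂; exact ⟨_, .refl _, .refl _⟩
  | lam σ s ih =>
    obtain ⟨_, _, rfl, hσ₁, hs₁⟩ := h₁.lam_inv
    obtain ⟨_, _, rfl, hσ₂, hs₂⟩ := h₂.lam_inv
    obtain ⟨_, k₁, k₂⟩ := ih hs₁ hs₂
    obtain ⟨_, l₁, l₂⟩ := hσ₁.diamond hσ₂
    exact ⟨_, .lam l₁ k₁, .lam l₂ k₂⟩
  | tlam κ s ih =>
    obtain ⟨_, rfl, hs₁⟩ := h₁.tlam_inv
    obtain ⟨_, rfl, hs₂⟩ := h₂.tlam_inv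
    obtain ⟨_, k₁, k₂⟩ := ih hs₁ hs₂
    exact ⟨_, .tlam κ k₁, .tlam κ k₂⟩
  | app s t ihs iht =>
    cases h₁ with
    | app hs₁ ht₁ =>
      cases h₂ with
      | app hs₂ ht₂ =>
        obtain ⟨_, k₁, k₂⟩ := ihs hs₁ hs₂
        obtain ⟨_, l₁, l₂⟩ := iht ht₁ ht₂
        exact ⟨_, .app k₁ l₁, .app k₂ l₂⟩
      | appRoot hs₂ ht₂ hr₂ =>
        obtain ⟨_, k₁, k₂⟩ := ihs hs₁ hs₂
        obtain ⟨_, l₁, l₂⟩ := iht ht₁ ht₂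
        obtain ⟨_, m, m'⟩ := hr₂.par_app k₂ l₂
        exact ⟨_, .appRoot k₁ l₁ m, m'⟩
    | appRoot hs₁ ht₁ hr₁ =>
      cases h₂ with
      | app hs₂ ht₂ =>
        obtain ⟨_, k₁, k₂⟩ := ihs hs₁ hs₂
        obtain ⟨_, l₁, l₂⟩ := iht ht₁ ht₂
        obtain ⟨_, m, m'⟩ := hr₁.par_app k₁ l₁
        exact ⟨_, m', .appRoot k₂ l₂ m⟩
      | appRoot hs₂ ht₂ hr₂ =>
        obtain ⟨_, k₁, k₂⟩ := ihs hs₁ hs₂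
        obtain ⟨_, l₁, l₂⟩ := iht ht₁ ht₂
        obtain ⟨_, m, m'⟩ := hr₁.par_app k₁ l₁
        obtain ⟨_, n, n'⟩ := hr₂.par_app k₂ l₂
        obtain rfl := m.det n
        exact ⟨_, m', n'⟩
  | tapp s φ ih =>
    cases h₁ with
    | tapp hs₁ hφ₁ =>
      cases h₂ with
      | tapp hs₂ hφ₂ =>
        obtain ⟨_, k₁, k₂⟩ := ih hs₁ hs₂
        obtain ⟨_, l₁, l₂⟩ := hφ₁.diamond hφ₂
        exact ⟨_, .tapp k₁ l₁, .tapp k₂ l₂⟩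
      | tappRoot hs₂ hφ₂ hr₂ =>
        obtain ⟨_, k₁, k₂⟩ := ih hs₁ hs₂
        obtain ⟨_, l₁, l₂⟩ := hφ₁.diamond hφ₂
        obtain ⟨_, m, m'⟩ := hr₂.par_tapp k₂ l₂
        exact ⟨_, .tappRoot k₁ l₁ m, m'⟩
    | tappRoot hs₁ hφ₁ hr₁ =>
      cases h₂ with
      | tapp hs₂ hφ₂ =>
        obtain ⟨_, k₁, k₂⟩ := ih hs₁ hs₂
        obtain ⟨_, l₁, l₂⟩ := hφ₁.diamond hφ₂
        obtain ⟨_, m, m'⟩ := hr₁.par_tapp k₁ l₁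
        exact ⟨_, m', .tappRoot k₂ l₂ m⟩
      | tappRoot hs₂ hφ₂ hr₂ =>
        obtain ⟨_, k₁, k₂⟩ := ih hs₁ hs₂
        obtain ⟨_, l₁, l₂⟩ := hφ₁.diamond hφ₂
        obtain ⟨_, m, m'⟩ := hr₁.par_tapp k₁ l₁
        obtain ⟨_, n, n'⟩ := hr₂.par_tapp k₂ l₂
        obtain rfl := m.det n
        exact ⟨_, m', n'⟩

/-- Iterated parallel reduction of expressions. -/
abbrev Pars (s t : Expr) : Prop := Relation.ReflTransGen Par s t

theorem Pars.confluent {s s₁ s₂ : Expr} (h₁ : Pars s s₁) (h₂ : Pars s s₂) :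
    Relation.Join Pars s₁ s₂ :=
  Relation.church_rosser
    (fun _ _ _ h h' => let ⟨d, h, h'⟩ := h.diamond h'; ⟨d, .single h, .single h'⟩) h₁ h₂

/-- Convertibility of expressions: a common reduct under parallel reduction. -/
def Conv (s t : Expr) : Prop := ∃ u, Pars s u ∧ Pars t u

namespace Conv

theorem of_pars {s t : Expr} (h : Pars s t) : Conv s t := ⟨t, h, .refl⟩

theorem of_par {s t : Expr} (h : Par s t) : Conv s t := of_pars (.single h)

theorem refl (s : Expr) : Conv s s := of_pars .refl

theorem symm {s t : Expr} (h : Conv s t) : Conv t s :=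
  let ⟨u, h, h'⟩ := h
  ⟨u, h', h⟩

theorem trans {s t u : Expr} (h : Conv s t) (h' : Conv t u) : Conv s u := by
  obtain ⟨v, h₁, h₂⟩ := h
  obtain ⟨w, h₃, h₄⟩ := h'
  obtain ⟨x, h₅, h₆⟩ := h₂.confluent h₃
  exact ⟨x, h₁.trans h₅, h₄.trans h₆⟩

theorem map {f : Expr → Expr} (hf : ∀ s t, Par s t → Par (f s) (f t)) {s t : Expr}
    (h : Conv s t) : Conv (f s) (f t) :=
  let ⟨u, h, h'⟩ := h
  ⟨f u, h.lift f hf, h'.lift f hf⟩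

theorem map_ty {κ : Kind} {f : TyCon κ → Expr}
    (hf : ∀ φ ψ, TyCon.Par φ ψ → Par (f φ) (f ψ)) {φ ψ : TyCon κ} (h : TyCon.Conv φ ψ) :
    Conv (f φ) (f ψ) :=
  let ⟨χ, h, h'⟩ := h.join
  ⟨f χ, h.lift f hf, h'.lift f hf⟩

theorem lam {σ σ' : Ty} {s s' : Expr} (hσ : TyCon.Conv σ σ') (hs : Conv s s') :
    Conv (.lam σ s) (.lam σ' s') :=
  (map_ty (f := fun σ => .lam σ s) (fun _ _ h => .lam h (.refl _)) hσ).trans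
    (map (fun _ _ h => .lam (.refl _) h) hs)

theorem tlam (κ : Kind) {s s' : Expr} (h : Conv s s') : Conv (.tlam κ s) (.tlam κ s') :=
  map (fun _ _ h => .tlam κ h) h

theorem app {s s' t t' : Expr} (hs : Conv s s') (ht : Conv t t') :
    Conv (.app s t) (.app s' t') :=
  (map (f := fun s => .app s t) (fun _ _ h => .app h (.refl _)) hs).trans
    (map (fun _ _ h => .app (.refl _) h) ht)

theorem tapp {κ : Kind} {s s' : Expr} {φ φ' : TyCon κ} (hs : Conv s s')
    (hφ : TyCon.Conv φ φ') : Conv (.tapp s φ) (.tapp s' φ') :=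
  (map (f := fun s => .tapp s φ) (fun _ _ h => .tapp h (.refl _)) hs).trans
    (map_ty (fun _ _ h => .tapp (.refl _) h) hφ)

theorem of_equiv {s t : Expr} (h : Equiv s t) : Conv s t := by
  induction h with
  | var i => exact refl _
  | sym f => exact refl _
  | lam hσ _ ih => exact .lam hσ ih
  | tlam κ _ ih => exact .tlam κ ih
  | app _ _ ihs iht => exact .app ihs iht
  | tapp _ hφ ih => exact .tapp ih hφ

end Conv

/-! ### Normal forms of expressions -/

/-- An expression without redexes, also in the types written in it, by its structure. -/
def Nf : Expr → Prop
  | .var _ => True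
  | .sym _ => True
  | .lam σ s => σ.Nf ∧ s.Nf
  | .tlam _ s => s.Nf
  | .app s t => s.Nf ∧ t.Nf ∧ ∀ r, ¬ Root (.app s t) r
  | .tapp s φ => s.Nf ∧ φ.Nf ∧ ∀ r, ¬ Root (.tapp s φ) r

theorem nf_of_not_step {s : Expr} (hc : s.IsCanonical) (h : ∀ t, ¬ Step s t) : s.Nf := by
  induction s with
  | var i => trivial
  | sym f => trivial
  | lam σ s ih => exact ⟨hc.1.nf, ih hc.2 fun t ht => h _ (.lam σ ht)⟩
  | tlam κ s ih => exact ih hc fun t ht => h _ (.tlam κ ht)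
  | app s t ihs iht =>
    exact ⟨ihs hc.1 fun r hr => h _ (.appL t hr), iht hc.2 fun r hr => h _ (.appR s hr),
      fun r hr => h _ hr.step⟩
  | tapp s φ ih =>
    exact ⟨ih hc.1 fun r hr => h _ (.tapp φ hr), hc.2.nf, fun r hr => h _ hr.step⟩

theorem Nf.isCanonical {s : Expr} (h : s.Nf) : s.IsCanonical := by
  induction s with
  | var i => trivial
  | sym f => trivial
  | lam σ s ih => exact ⟨h.1.isNormal, ih h.2⟩
  | tlam κ s ih => exact ih h
  | app s t ihs iht => exact ⟨ihs h.1, iht h.2.1⟩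
  | tapp s φ ih => exact ⟨ih h.1, h.2.1.isNormal⟩

theorem Nf.par_eq {s t : Expr} (h : s.Nf) (hp : Par s t) : t = s := by
  induction hp with
  | var i => rfl
  | sym f => rfl
  | lam hσ _ ih => rw [ih h.2, h.1.par_eq hσ]
  | tlam κ _ ih => rw [ih h]
  | app _ _ ihs iht => rw [ihs h.1, iht h.2.1]
  | tapp _ hφ ih => rw [ih h.1, h.2.1.par_eq hφ]
  | appRoot _ _ hr ihs iht =>
    rw [ihs h.1, iht h.2.1] at hr
    exact absurd hr (h.2.2 _)
  | tappRoot _ hφ hr ih =>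
    rw [ih h.1, h.2.1.par_eq hφ] at hr
    exact absurd hr (h.2.2 _)

theorem Nf.pars_eq {s t : Expr} (h : s.Nf) (hp : Pars s t) : t = s := by
  induction hp with
  | refl => rfl
  | tail _ hp ih => subst ih; exact h.par_eq hp

theorem Conv.pars_nf {s t : Expr} (h : Conv s t) (ht : t.Nf) : Pars s t := by
  obtain ⟨u, h₁, h₂⟩ := h
  rwa [ht.pars_eq h₂] at h₁

/-- This is the uniqueness of normal forms, as a literal equality of expressions. -/
theorem Conv.eq_of_nf {s t : Expr} (h : Conv s t) (hs : s.Nf) (ht : t.Nf) : s = t :=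
  (hs.pars_eq (h.pars_nf ht)).symm

end Expr

/-! ### Reduction of renamed expressions -/

theorem TyCon.rename_eq_nat {σ : Ty} {ξ : TyRen} (h : σ.rename ξ = .nat) : σ = .nat := by
  cases σ <;> simp_all [TyCon.rename]

theorem TyCon.rename_eq_arr {σ τ ρ : Ty} {ξ : TyRen} (h : ρ.rename ξ = .arr σ τ) :
    ∃ σ' τ', ρ = .arr σ' τ' := by
  cases ρ <;> simp_all [TyCon.rename]

theorem TyCon.rename_eq_all {κ : Kind} {σ ρ : Ty} {ξ : TyRen} (h : ρ.rename ξ = .all κ σ) :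
    ∃ σ', ρ = .all κ σ' := by
  cases ρ <;> simp_all [TyCon.rename]

namespace Expr

theorem rename_eq_sym {s : Expr} {r : ℕ → ℕ} {f : FSym} (h : s.rename r = .sym f) :
    s = .sym f := by
  cases s <;> simp_all [rename]

theorem rename_eq_lam {s t : Expr} {r : ℕ → ℕ} {σ : Ty} (h : s.rename r = .lam σ t) :
    ∃ t', s = .lam σ t' := by
  cases s <;> simp_all [rename]

theorem rename_eq_tlam {s t : Expr} {r : ℕ → ℕ} {κ : Kind} (h : s.rename r = .tlam κ t) :
    ∃ t', s = .tlam κ t' := by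
  cases s <;> simp_all [rename]

theorem rename_eq_app {s t t' : Expr} {r : ℕ → ℕ} (h : s.rename r = .app t t') :
    ∃ u u', s = .app u u' ∧ u.rename r = t ∧ u'.rename r = t' := by
  cases s <;> simp_all [rename]

theorem rename_eq_tapp {s t : Expr} {r : ℕ → ℕ} {κ : Kind} {φ : TyCon κ}
    (h : s.rename r = .tapp t φ) : ∃ u, s = .tapp u φ ∧ u.rename r = t := by
  cases s with
  | tapp s ψ =>
    simp only [rename, tapp.injEq] at h
    obtain ⟨rfl, h, h'⟩ := h
    cases h'
    exact ⟨s, rfl, h⟩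
  | _ => simp [rename] at h

theorem tyRename_eq_sym {s : Expr} {ξ : TyRen} {f : FSym} (h : s.tyRename ξ = .sym f) :
    s = .sym f := by
  cases s <;> simp_all [tyRename]

theorem tyRename_eq_lam {s t : Expr} {ξ : TyRen} {σ : Ty} (h : s.tyRename ξ = .lam σ t) :
    ∃ σ' t', s = .lam σ' t' := by
  cases s <;> simp_all [tyRename]

theorem tyRename_eq_tlam {s t : Expr} {ξ : TyRen} {κ : Kind} (h : s.tyRename ξ = .tlam κ t) :
    ∃ t', s = .tlam κ t' := by
  cases s <;> simp_all [tyRename]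

theorem tyRename_eq_app {s t t' : Expr} {ξ : TyRen} (h : s.tyRename ξ = .app t t') :
    ∃ u u', s = .app u u' ∧ u.tyRename ξ = t ∧ u'.tyRename ξ = t' := by
  cases s <;> simp_all [tyRename]

theorem tyRename_eq_tapp {s t : Expr} {ξ : TyRen} {κ : Kind} {φ : TyCon κ}
    (h : s.tyRename ξ = .tapp t φ) :
    ∃ (u : Expr) (ψ : TyCon κ), s = .tapp u ψ ∧ u.tyRename ξ = t ∧ ψ.rename ξ = φ := by
  cases s with
  | tapp s ψ =>
    simp only [tyRename, tapp.injEq] at h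
    obtain ⟨rfl, h, h'⟩ := h
    cases h'
    exact ⟨s, ψ, rfl, h, rfl⟩
  | _ => simp [tyRename] at h

/-- The pattern of a redex contains no variable, so a renaming, injective or not, cannot create one.
-/
theorem Root.of_rename {s t : Expr} {r : ℕ → ℕ} (h : Root (s.rename r) t) :
    ∃ t', t = t'.rename r ∧ Root s t' := by
  -- Only the redex in `s` has to be found: stability under renaming and determinism then force `t`
  -- to be the renamed contractum.
  suffices H : ∃ t', Root s t' by
    obtain ⟨t', ht'⟩ := H
    exact ⟨t', h.det (ht'.rename r), ht'⟩
  generalize he : s.rename r = s' at h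
  cases h with
  | beta σ a b =>
    obtain ⟨u, u', rfl, h₁, -⟩ := rename_eq_app he
    obtain ⟨_, rfl⟩ := rename_eq_lam h₁
    exact ⟨_, .beta _ _ _⟩
  | tbeta a φ =>
    obtain ⟨u, rfl, h₁⟩ := rename_eq_tapp he
    obtain ⟨_, rfl⟩ := rename_eq_tlam h₁
    exact ⟨_, .tbeta _ _⟩
  | circNat o n m =>
    obtain ⟨_, _, rfl, h₁, h₂⟩ := rename_eq_app he
    obtain ⟨_, _, rfl, h₃, h₄⟩ := rename_eq_app h₁
    obtain ⟨_, rfl, h₅⟩ := rename_eq_tapp h₃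
    obtain rfl := rename_eq_sym h₅
    obtain rfl := rename_eq_sym h₂
    obtain rfl := rename_eq_sym h₄
    exact ⟨_, .circNat _ _ _⟩
  | circArr o σ τ a b =>
    obtain ⟨_, _, rfl, h₁, h₂⟩ := rename_eq_app he
    obtain ⟨_, _, rfl, h₃, h₄⟩ := rename_eq_app h₁
    obtain ⟨_, rfl, h₅⟩ := rename_eq_tapp h₃
    obtain rfl := rename_eq_sym h₅
    exact ⟨_, .circArr _ _ _ _ _⟩
  | circAll o κ σ a b =>
    obtain ⟨_, _, rfl, h₁, h₂⟩ := rename_eq_app he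
    obtain ⟨_, _, rfl, h₃, h₄⟩ := rename_eq_app h₁
    obtain ⟨_, rfl, h₅⟩ := rename_eq_tapp h₃
    obtain rfl := rename_eq_sym h₅
    exact ⟨_, .circAll _ _ _ _ _⟩
  | flatNat =>
    obtain ⟨_, _, rfl, h₁, h₂⟩ := rename_eq_app he
    obtain ⟨_, rfl, h₅⟩ := rename_eq_tapp h₁
    obtain rfl := rename_eq_sym h₅
    exact ⟨_, .flatNat _⟩
  | flatArr =>
    obtain ⟨_, _, rfl, h₁, h₂⟩ := rename_eq_app he
    obtain ⟨_, rfl, h₅⟩ := rename_eq_tapp h₁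
    obtain rfl := rename_eq_sym h₅
    exact ⟨_, .flatArr _ _ _⟩
  | flatAll =>
    obtain ⟨_, _, rfl, h₁, h₂⟩ := rename_eq_app he
    obtain ⟨_, rfl, h₅⟩ := rename_eq_tapp h₁
    obtain rfl := rename_eq_sym h₅
    exact ⟨_, .flatAll _ _ _⟩
  | liftNat =>
    obtain ⟨_, _, rfl, h₁, h₂⟩ := rename_eq_app he
    obtain ⟨_, rfl, h₅⟩ := rename_eq_tapp h₁
    obtain rfl := rename_eq_sym h₅
    exact ⟨_, .liftNat _⟩
  | liftArr =>
    obtain ⟨_, _, rfl, h₁, h₂⟩ := rename_eq_app he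
    obtain ⟨_, rfl, h₅⟩ := rename_eq_tapp h₁
    obtain rfl := rename_eq_sym h₅
    exact ⟨_, .liftArr _ _ _⟩
  | liftAll =>
    obtain ⟨_, _, rfl, h₁, h₂⟩ := rename_eq_app he
    obtain ⟨_, rfl, h₅⟩ := rename_eq_tapp h₁
    obtain rfl := rename_eq_sym h₅
    exact ⟨_, .liftAll _ _ _⟩

/-- A renaming of type variables produces none of the type formers on which the rules depend. -/
theorem Root.of_tyRename {s t : Expr} {ξ : TyRen} (h : Root (s.tyRename ξ) t) :
    ∃ t', t = t'.tyRename ξ ∧ Root s t' := by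
  suffices H : ∃ t', Root s t' by
    obtain ⟨t', ht'⟩ := H
    exact ⟨t', h.det (ht'.tyRename ξ), ht'⟩
  generalize he : s.tyRename ξ = s' at h
  cases h with
  | beta σ a b =>
    obtain ⟨u, u', rfl, h₁, -⟩ := tyRename_eq_app he
    obtain ⟨_, _, rfl⟩ := tyRename_eq_lam h₁
    exact ⟨_, .beta _ _ _⟩
  | tbeta a φ =>
    obtain ⟨_, _, rfl, h₁, -⟩ := tyRename_eq_tapp he
    obtain ⟨_, rfl⟩ := tyRename_eq_tlam h₁
    exact ⟨_, .tbeta _ _⟩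
  | circNat o n m =>
    obtain ⟨_, _, rfl, h₁, h₂⟩ := tyRename_eq_app he
    obtain ⟨_, _, rfl, h₃, h₄⟩ := tyRename_eq_app h₁
    obtain ⟨_, _, rfl, h₅, h₆⟩ := tyRename_eq_tapp h₃
    obtain rfl := tyRename_eq_sym h₅
    obtain rfl := tyRename_eq_sym h₂
    obtain rfl := tyRename_eq_sym h₄
    obtain rfl := TyCon.rename_eq_nat h₆
    exact ⟨_, .circNat _ _ _⟩
  | circArr o σ τ a b =>
    obtain ⟨_, _, rfl, h₁, h₂⟩ := tyRename_eq_app he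
    obtain ⟨_, _, rfl, h₃, h₄⟩ := tyRename_eq_app h₁
    obtain ⟨_, _, rfl, h₅, h₆⟩ := tyRename_eq_tapp h₃
    obtain rfl := tyRename_eq_sym h₅
    obtain ⟨_, _, rfl⟩ := TyCon.rename_eq_arr h₆
    exact ⟨_, .circArr _ _ _ _ _⟩
  | circAll o κ σ a b =>
    obtain ⟨_, _, rfl, h₁, h₂⟩ := tyRename_eq_app he
    obtain ⟨_, _, rfl, h₃, h₄⟩ := tyRename_eq_app h₁
    obtain ⟨_, _, rfl, h₅, h₆⟩ := tyRename_eq_tapp h₃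
    obtain rfl := tyRename_eq_sym h₅
    obtain ⟨_, rfl⟩ := TyCon.rename_eq_all h₆
    exact ⟨_, .circAll _ _ _ _ _⟩
  | flatNat =>
    obtain ⟨_, _, rfl, h₁, h₂⟩ := tyRename_eq_app he
    obtain ⟨_, _, rfl, h₅, h₆⟩ := tyRename_eq_tapp h₁
    obtain rfl := tyRename_eq_sym h₅
    obtain rfl := TyCon.rename_eq_nat h₆
    exact ⟨_, .flatNat _⟩
  | flatArr =>
    obtain ⟨_, _, rfl, h₁, h₂⟩ := tyRename_eq_app he
    obtain ⟨_, _, rfl, h₅, h₆⟩ := tyRename_eq_tapp h₁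
    obtain rfl := tyRename_eq_sym h₅
    obtain ⟨_, _, rfl⟩ := TyCon.rename_eq_arr h₆
    exact ⟨_, .flatArr _ _ _⟩
  | flatAll =>
    obtain ⟨_, _, rfl, h₁, h₂⟩ := tyRename_eq_app he
    obtain ⟨_, _, rfl, h₅, h₆⟩ := tyRename_eq_tapp h₁
    obtain rfl := tyRename_eq_sym h₅
    obtain ⟨_, rfl⟩ := TyCon.rename_eq_all h₆
    exact ⟨_, .flatAll _ _ _⟩
  | liftNat =>
    obtain ⟨_, _, rfl, h₁, h₂⟩ := tyRename_eq_app he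
    obtain ⟨_, _, rfl, h₅, h₆⟩ := tyRename_eq_tapp h₁
    obtain rfl := tyRename_eq_sym h₅
    obtain rfl := TyCon.rename_eq_nat h₆
    exact ⟨_, .liftNat _⟩
  | liftArr =>
    obtain ⟨_, _, rfl, h₁, h₂⟩ := tyRename_eq_app he
    obtain ⟨_, _, rfl, h₅, h₆⟩ := tyRename_eq_tapp h₁
    obtain rfl := tyRename_eq_sym h₅
    obtain ⟨_, _, rfl⟩ := TyCon.rename_eq_arr h₆
    exact ⟨_, .liftArr _ _ _⟩
  | liftAll =>
    obtain ⟨_, _, rfl, h₁, h₂⟩ := tyRename_eq_app he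
    obtain ⟨_, _, rfl, h₅, h₆⟩ := tyRename_eq_tapp h₁
    obtain rfl := tyRename_eq_sym h₅
    obtain ⟨_, rfl⟩ := TyCon.rename_eq_all h₆
    exact ⟨_, .liftAll _ _ _⟩

theorem nf_rename {s : Expr} {r : ℕ → ℕ} : (s.rename r).Nf ↔ s.Nf := by
  induction s generalizing r with
  | var i => rfl
  | sym f => rfl
  | lam σ s ih => simp only [rename, Nf, ih]
  | tlam κ s ih => simp only [rename, Nf, ih]
  | app s t ihs iht =>
    simp only [rename, Nf, ihs, iht]
    refine and_congr_right fun _ => and_congr_right fun _ => ⟨?_, ?_⟩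
    · exact fun h x hx => h _ (hx.rename r)
    · exact fun h x hx => let ⟨_, _, hx⟩ := Root.of_rename (s := .app s t) hx; h _ hx
  | tapp s φ ih =>
    simp only [rename, Nf, ih]
    refine and_congr_right fun _ => and_congr_right fun _ => ⟨?_, ?_⟩
    · exact fun h x hx => h _ (hx.rename r)
    · exact fun h x hx => let ⟨_, _, hx⟩ := Root.of_rename (s := .tapp s φ) hx; h _ hx

theorem nf_tyRename {s : Expr} {ξ : TyRen} : (s.tyRename ξ).Nf ↔ s.Nf := by
  induction s generalizing ξ with
  | var i => rfl
  | sym f => rfl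
  | lam σ s ih => simp only [tyRename, Nf, ih, TyCon.nf_rename]
  | tlam κ s ih => simp only [tyRename, Nf, ih]
  | app s t ihs iht =>
    simp only [tyRename, Nf, ihs, iht]
    refine and_congr_right fun _ => and_congr_right fun _ => ⟨?_, ?_⟩
    · exact fun h x hx => h _ (hx.tyRename ξ)
    · exact fun h x hx => let ⟨_, _, hx⟩ := Root.of_tyRename (s := .app s t) hx; h _ hx
  | tapp s φ ih =>
    simp only [tyRename, Nf, ih, TyCon.nf_rename]
    refine and_congr_right fun _ => and_congr_right fun _ => ⟨?_, ?_⟩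
    · exact fun h x hx => h _ (hx.tyRename ξ)
    · exact fun h x hx => let ⟨_, _, hx⟩ := Root.of_tyRename (s := .tapp s φ) hx; h _ hx

/-- Reductions lift along renamings. Together with `nf_rename` this transfers a normal form of the
renamed expression back to `s`. -/
theorem Par.of_rename {s t : Expr} {r : ℕ → ℕ} (h : Par (s.rename r) t) :
    ∃ t', t = t'.rename r ∧ Par s t' := by
  induction s generalizing r t with
  | var i => cases h; exact ⟨.var i, rfl, .var i⟩
  | sym f => cases h; exact ⟨.sym f, rfl, .sym f⟩
  | lam σ s ih =>
    obtain ⟨σ', _, rfl, hσ, hs⟩ := h.lam_inv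
    obtain ⟨s', rfl, k⟩ := ih hs
    exact ⟨.lam σ' s', rfl, .lam hσ k⟩
  | tlam κ s ih =>
    obtain ⟨_, rfl, hs⟩ := h.tlam_inv
    obtain ⟨s', rfl, k⟩ := ih hs
    exact ⟨.tlam κ s', rfl, .tlam κ k⟩
  | app s t ihs iht =>
    cases h with
    | app hs ht =>
      obtain ⟨s', rfl, k⟩ := ihs hs
      obtain ⟨t', rfl, l⟩ := iht ht
      exact ⟨.app s' t', rfl, .app k l⟩
    | appRoot hs ht hr =>
      obtain ⟨s', rfl, k⟩ := ihs hs
      obtain ⟨t', rfl, l⟩ := iht ht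
      obtain ⟨x, rfl, m⟩ := Root.of_rename (s := .app s' t') hr
      exact ⟨x, rfl, .appRoot k l m⟩
  | tapp s φ ih =>
    cases h with
    | tapp hs hφ =>
      obtain ⟨s', rfl, k⟩ := ih hs
      exact ⟨.tapp s' _, rfl, .tapp k hφ⟩
    | tappRoot hs hφ hr =>
      obtain ⟨s', rfl, k⟩ := ih hs
      obtain ⟨x, rfl, m⟩ := Root.of_rename (s := .tapp s' _) hr
      exact ⟨x, rfl, .tappRoot k hφ m⟩

theorem Par.of_tyRename {s t : Expr} {ξ : TyRen} (h : Par (s.tyRename ξ) t) :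
    ∃ t', t = t'.tyRename ξ ∧ Par s t' := by
  induction s generalizing ξ t with
  | var i => cases h; exact ⟨.var i, rfl, .var i⟩
  | sym f => cases h; exact ⟨.sym f, rfl, .sym f⟩
  | lam σ s ih =>
    obtain ⟨_, _, rfl, hσ, hs⟩ := h.lam_inv
    obtain ⟨s', rfl, k⟩ := ih hs
    obtain ⟨σ', rfl, l⟩ := hσ.of_rename
    exact ⟨.lam σ' s', rfl, .lam l k⟩
  | tlam κ s ih =>
    obtain ⟨_, rfl, hs⟩ := h.tlam_inv
    obtain ⟨s', rfl, k⟩ := ih hs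
    exact ⟨.tlam κ s', rfl, .tlam κ k⟩
  | app s t ihs iht =>
    cases h with
    | app hs ht =>
      obtain ⟨s', rfl, k⟩ := ihs hs
      obtain ⟨t', rfl, l⟩ := iht ht
      exact ⟨.app s' t', rfl, .app k l⟩
    | appRoot hs ht hr =>
      obtain ⟨s', rfl, k⟩ := ihs hs
      obtain ⟨t', rfl, l⟩ := iht ht
      obtain ⟨x, rfl, m⟩ := Root.of_tyRename (s := .app s' t') hr
      exact ⟨x, rfl, .appRoot k l m⟩
  | tapp s φ ih =>
    cases h with
    | tapp hs hφ =>
      obtain ⟨s', rfl, k⟩ := ih hs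
      obtain ⟨φ', rfl, l⟩ := hφ.of_rename
      exact ⟨.tapp s' φ', rfl, .tapp k l⟩
    | tappRoot hs hφ hr =>
      obtain ⟨s', rfl, k⟩ := ih hs
      obtain ⟨φ', rfl, l⟩ := hφ.of_rename
      obtain ⟨x, rfl, m⟩ := Root.of_tyRename (s := .tapp s' φ') hr
      exact ⟨x, rfl, .tappRoot k l m⟩

theorem Pars.of_rename {s t : Expr} {r : ℕ → ℕ} (h : Pars (s.rename r) t) :
    ∃ t', t = t'.rename r ∧ Pars s t' := by
  induction h with
  | refl => exact ⟨s, rfl, .refl⟩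
  | tail _ h ih =>
    obtain ⟨_, rfl, h'⟩ := ih
    obtain ⟨t', rfl, k⟩ := h.of_rename
    exact ⟨t', rfl, h'.tail k⟩

theorem Pars.of_tyRename {s t : Expr} {ξ : TyRen} (h : Pars (s.tyRename ξ) t) :
    ∃ t', t = t'.tyRename ξ ∧ Pars s t' := by
  induction h with
  | refl => exact ⟨s, rfl, .refl⟩
  | tail _ h ih =>
    obtain ⟨_, rfl, h'⟩ := ih
    obtain ⟨t', rfl, k⟩ := h.of_tyRename
    exact ⟨t', rfl, h'.tail k⟩

/-! ### Weak normalization: candidates -/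

/-- `s` has a normal form. -/
def Wn (s : Expr) : Prop := ∃ t : Expr, t.Nf ∧ Conv s t

theorem Wn.of_conv {s t : Expr} (h : t.Wn) (hc : Conv s t) : s.Wn :=
  let ⟨u, hu, h⟩ := h
  ⟨u, hu, hc.trans h⟩

theorem Wn.of_rename {s : Expr} {r : ℕ → ℕ} (h : (s.rename r).Wn) : s.Wn := by
  obtain ⟨u, hu, h⟩ := h
  obtain ⟨t, rfl, k⟩ := (h.pars_nf hu).of_rename
  exact ⟨t, nf_rename.1 hu, .of_pars k⟩

theorem Wn.of_tyRename {s : Expr} {ξ : TyRen} (h : (s.tyRename ξ).Wn) : s.Wn := by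
  obtain ⟨u, hu, h⟩ := h
  obtain ⟨t, rfl, k⟩ := (h.pars_nf hu).of_tyRename
  exact ⟨t, nf_tyRename.1 hu, .of_pars k⟩

/-- The instance is a renaming of `s`. This yields normalization of the body of an abstraction from
its action on a variable. -/
theorem Wn.of_inst_var {s : Expr} (h : (s.inst (.var 0)).Wn) : s.Wn := by
  rw [inst_var] at h
  exact h.of_rename

theorem Wn.of_tyInst_var {s : Expr} {κ : Kind} (h : (s.tyInst (.var κ 0)).Wn) : s.Wn := by
  rw [tyInst_var] at h
  exact h.of_tyRename

theorem Wn.lam (σ : Ty) {s : Expr} (h : s.Wn) : (Expr.lam σ s).Wn := by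
  obtain ⟨t, ht, hc⟩ := h
  obtain ⟨σ', hσ', hc'⟩ := σ.wn
  exact ⟨.lam σ' t, ⟨hσ', ht⟩, .lam hc' hc⟩

theorem Wn.tlam (κ : Kind) {s : Expr} (h : s.Wn) : (Expr.tlam κ s).Wn := by
  obtain ⟨t, ht, hc⟩ := h
  exact ⟨.tlam κ t, ht, .tlam κ hc⟩

theorem wn_sym (f : FSym) : (Expr.sym f).Wn := ⟨.sym f, trivial, .refl _⟩

theorem wn_tapp_sym (f : FSym) {κ : Kind} (φ : TyCon κ) : (Expr.tapp (.sym f) φ).Wn := by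
  obtain ⟨ψ, hψ, hc⟩ := φ.wn
  exact ⟨.tapp (.sym f) ψ, ⟨trivial, hψ, fun r hr => by cases hr⟩, .tapp (.refl _) hc⟩

/-- With a single argument, `∘_σ` matches no rule, whatever `σ` is. -/
theorem wn_app_op (o : Op) (σ : Ty) {s : Expr} (h : s.Wn) :
    (Expr.app (.tapp (.sym (.op o)) σ) s).Wn := by
  obtain ⟨t, ht, hc⟩ := h
  obtain ⟨τ, hτ, hc'⟩ := σ.wn
  exact ⟨.app (.tapp (.sym (.op o)) τ) t,
    ⟨⟨trivial, hτ, fun r hr => by cases hr⟩, ht, fun r hr => by cases hr⟩,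
    .app (.tapp (.refl _) hc') hc⟩

/-- A variable applied to arguments. -/
inductive Neutral : Expr → Prop
  | var (i : ℕ) : Neutral (.var i)
  | app {s t : Expr} : Neutral s → t.Wn → Neutral (.app s t)
  | tapp {κ : Kind} {s : Expr} (φ : TyCon κ) : Neutral s → Neutral (.tapp s φ)

theorem Neutral.not_root {s t : Expr} (h : Neutral s) : ¬ Root s t := by
  intro hr
  cases hr with
  | beta => cases h with | app h _ => cases h
  | tbeta => cases h with | tapp _ h => cases h
  | circNat | circArr | circAll =>
    cases h with | app h _ => cases h with | app h _ => cases h with | tapp _ h => cases h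
  | flatNat | flatArr | flatAll | liftNat | liftArr | liftAll =>
    cases h with | app h _ => cases h with | tapp _ h => cases h

theorem Nf.wn {s : Expr} (h : s.Nf) : s.Wn := ⟨s, h, .refl s⟩

/-- Neutrality of the normal form is carried through the induction because it is what excludes a
redex at the root of an application. -/
theorem Neutral.exists_nf {s : Expr} (h : Neutral s) :
    ∃ t, Neutral t ∧ t.Nf ∧ Conv s t := by
  induction h with
  | var i => exact ⟨_, .var i, trivial, .refl _⟩
  | app _ ht ih =>
    obtain ⟨s', hs', hn, hc⟩ := ih
    obtain ⟨t', ht', hc'⟩ := ht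
    have hN : Neutral (.app s' t') := .app hs' ht'.wn
    exact ⟨_, hN, ⟨hn, ht', fun _ => hN.not_root⟩, hc.app hc'⟩
  | tapp φ _ ih =>
    obtain ⟨s', hs', hn, hc⟩ := ih
    obtain ⟨ψ, hψ, hc'⟩ := φ.wn
    have hN : Neutral (.tapp s' ψ) := .tapp ψ hs'
    exact ⟨_, hN, ⟨hn, hψ, fun _ => hN.not_root⟩, hc.tapp hc'⟩

theorem Neutral.wn {s : Expr} (h : Neutral s) : s.Wn :=
  let ⟨t, _, ht, hc⟩ := h.exists_nf
  ⟨t, ht, hc⟩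

/-- Candidates of type `σ`: sets of weakly normalizing expressions that are closed under
conversion and under the operations that the function symbols provide at the type `σ`. -/
structure IsCand (σ : Ty) (X : Set Expr) : Prop where
  wn : ∀ s ∈ X, s.Wn
  conv : ∀ s t, Conv s t → t ∈ X → s ∈ X
  neutral : ∀ s, Neutral s → s ∈ X
  circ : ∀ o, ∀ s ∈ X, ∀ t ∈ X, Expr.circ o σ s t ∈ X
  lift : ∀ s : Expr, s.Wn → Expr.lft σ s ∈ X
  flat : ∀ s ∈ X, (Expr.flat σ s).Wn

/-- The type enters the conditions only as the argument of a function symbol, and candidates are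
closed under conversion, which includes conversion of types. -/
theorem IsCand.of_conv {σ τ : Ty} {X : Set Expr} (h : IsCand τ X) (hc : TyCon.Conv σ τ) :
    IsCand σ X where
  wn := h.wn
  conv := h.conv
  neutral := h.neutral
  circ o s hs t ht := h.conv _ _
    (.app (.app (.tapp (.refl _) hc) (.refl _)) (.refl _)) (h.circ o s hs t ht)
  lift s hs := h.conv _ _ (.app (.tapp (.refl _) hc) (.refl _)) (h.lift s hs)
  flat s hs := (h.flat s hs).of_conv (.app (.tapp (.refl _) hc) (.refl _))

theorem Root.conv {s t : Expr} (h : Root s t) : Conv s t := .of_par h.par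

theorem isCand_nat : IsCand .nat {s | s.Wn} where
  wn _ h := h
  conv _ _ hc h := h.of_conv hc
  neutral _ h := h.wn
  circ o s hs t ht := by
    obtain ⟨s', hs', hc⟩ := hs
    obtain ⟨t', ht', hc'⟩ := ht
    refine Wn.of_conv ?_ (.app (.app (.refl _) hc) hc')
    -- On normal arguments the sum or product is either a redex, necessarily of two numerals and
    -- with a numeral as contractum, or already normal.
    by_cases h : ∃ r, Root (.app (.app (.tapp (.sym (.op o)) TyCon.nat) s') t') r
    · obtain ⟨r, hr⟩ := h
      refine Wn.of_conv ?_ hr.conv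
      cases hr
      exact wn_sym _
    · exact Nf.wn ⟨⟨⟨trivial, trivial, fun r hr => by cases hr⟩, hs', fun r hr => by cases hr⟩,
        ht', fun r hr => h ⟨r, hr⟩⟩
  lift s hs := hs.of_conv (Root.liftNat s).conv
  flat s hs := Wn.of_conv hs (Root.flatNat s).conv

/-- At a neutral type the symbols are stuck: its normal form is again neutral, hence none of `nat`,
`→`, `∀`, and no rule applies. This provides denotations for type variables. -/
theorem isCand_neutral {σ : Ty} (h : σ.Neutral) : IsCand σ {s | s.Wn} := by
  obtain ⟨τ, hτ, hc⟩ := σ.wn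
  have hN := h.pars (hc.pars_nf hτ)
  refine IsCand.of_conv (τ := τ) ?_ hc
  exact
    { wn := fun _ h => h
      conv := fun _ _ hc h => Wn.of_conv h hc
      neutral := fun _ h => h.wn
      circ := by
        rintro o s ⟨s', hs', hc⟩ t ⟨t', ht', hc'⟩
        refine Wn.of_conv (Nf.wn ?_) (.app (.app (.refl _) hc) hc')
        exact ⟨⟨⟨trivial, hτ, fun r hr => by cases hr⟩, hs', fun r hr => by cases hr⟩, ht',
          fun r hr => by cases hr <;> cases hN⟩
      lift := by
        rintro s ⟨s', hs', hc⟩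
        refine Wn.of_conv (Nf.wn ?_) (.app (.refl _) hc)
        exact ⟨⟨trivial, hτ, fun r hr => by cases hr⟩, hs', fun r hr => by cases hr <;> cases hN⟩
      flat := by
        rintro s ⟨s', hs', hc⟩
        refine Wn.of_conv (Nf.wn ?_) (.app (.refl _) hc)
        exact ⟨⟨trivial, hτ, fun r hr => by cases hr⟩, hs',
          fun r hr => by cases hr <;> cases hN⟩ }

/-- The function space of candidates. -/
def arrCand (X Y : Set Expr) : Set Expr := {s | s.Wn ∧ ∀ t ∈ X, Expr.app s t ∈ Y}

theorem IsCand.mem_arrCand_of_conv {τ : Ty} {X Y : Set Expr}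
    (hY : IsCand τ Y) {s t : Expr} (hc : Conv s t) (h : t ∈ arrCand X Y) :
    s ∈ arrCand X Y :=
  ⟨h.1.of_conv hc, fun u hu => hY.conv _ _ (.app hc (.refl u)) (h.2 u hu)⟩

/-- The β-contractum settles application. Normalization, which membership demands separately, comes
from the instance at the variable `0`, an element of every candidate. -/
theorem IsCand.lam_mem_arrCand {σ ρ τ : Ty} {X Y : Set Expr} (hX : IsCand σ X)
    (hY : IsCand τ Y) {s : Expr} (h : ∀ t ∈ X, s.inst t ∈ Y) :
    Expr.lam ρ s ∈ arrCand X Y :=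
  ⟨.lam _ (.of_inst_var (hY.wn _ (h _ (hX.neutral _ (.var 0))))),
    fun t ht => hY.conv _ _ (Root.beta ρ s t).conv (h t ht)⟩

/-- The rules at `σ → τ` fall back on the same symbol at `τ`, whose behaviour `hY` records. -/
theorem IsCand.arr {σ τ : Ty} {X Y : Set Expr} (hX : IsCand σ X) (hY : IsCand τ Y) :
    IsCand (.arr σ τ) (arrCand X Y) where
  wn _ h := h.1
  conv _ _ hc h := hY.mem_arrCand_of_conv hc h
  neutral _ h := ⟨h.wn, fun t ht => hY.neutral _ (.app h (hX.wn t ht))⟩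
  circ o s hs t ht := by
    refine hY.mem_arrCand_of_conv (Root.circArr o σ τ s t).conv
      (hX.lam_mem_arrCand hY fun u hu => ?_)
    have h := hY.circ o _ (hs.2 u hu) _ (ht.2 u hu)
    have hw (s : Expr) : s.weaken.subst (subSingle u) = s := weaken_inst s u
    simpa [inst, subst, hw, subSingle, Expr.circ, lft] using h
  lift s hs := by
    refine hY.mem_arrCand_of_conv (Root.liftArr σ τ s).conv
      (hX.lam_mem_arrCand hY fun u hu => ?_)
    have h := hY.lift s hs
    have hw (s : Expr) : s.weaken.subst (subSingle u) = s := weaken_inst s u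
    simpa [inst, subst, hw, subSingle, Expr.circ, lft] using h
  -- Here the domain is used as well: the argument `lift_σ · 0` lies in `X` by the `lift` condition
  -- on `X`.
  flat s hs :=
    (hY.flat _ (hs.2 _ (hX.lift _ (wn_sym _)))).of_conv (Root.flatArr σ τ s).conv

/-- The semantic domain of a kind. -/
def Dom : Kind → Type
  | .star => Set Expr
  | .arr κ₁ κ₂ => Dom κ₁ → Dom κ₂

/-- The elements of the semantic domain that interpret a type constructor `φ`. -/
def Good : (κ : Kind) → TyCon κ → Dom κ → Prop
  | .star, σ, X => IsCand σ X
  | .arr κ₁ κ₂, φ, F => ∀ (ψ : TyCon κ₁) (a : Dom κ₁), Good κ₁ ψ a → Good κ₂ (.app φ ψ) (F a)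

theorem Good.of_conv {κ : Kind} {φ ψ : TyCon κ} {a : Dom κ} (h : Good κ ψ a)
    (hc : TyCon.Conv φ ψ) : Good κ φ a := by
  induction κ with
  | star => exact IsCand.of_conv h hc
  | arr κ₁ κ₂ _ ih => exact fun χ b hb => ih (h χ b hb) (hc.app (.refl _))

/-- The default element of the semantic domain. -/
def base : (κ : Kind) → Dom κ
  | .star => {s : Expr | s.Wn}
  | .arr _ κ₂ => fun _ => base κ₂

theorem good_base {κ : Kind} {φ : TyCon κ} (h : φ.Neutral) : Good κ φ (base κ) := by
  induction κ with
  | star => exact isCand_neutral h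
  | arr κ₁ κ₂ _ ih => exact fun ψ _ _ => ih (.app ψ h)

/-- The rule for `flatten` at `∀` instantiates with `chi κ`, so this constructor needs a denotation
known in advance. -/
theorem good_chi (κ : Kind) : Good κ (chi κ) (base κ) := by
  induction κ with
  | star => exact isCand_nat
  | arr κ₁ κ₂ _ ih =>
    refine fun ψ _ _ => ih.of_conv ?_
    have h : TyCon.Conv (.app (.lam κ₁ (chi κ₂)) ψ) ((chi κ₂).inst ψ) := .rel _ _ (.beta _ _)
    -- The body of the abstraction is closed, so the contractum is `chi κ₂` whatever the argument.
    rwa [TyCon.inst, chi_subst] at h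

/-- The intersection that interprets a quantifier over the kind `κ`. -/
def allCand (κ : Kind) (F : Dom κ → Set Expr) : Set Expr :=
  {s | s.Wn ∧ ∀ (φ : TyCon κ) (a : Dom κ), Good κ φ a → Expr.tapp s φ ∈ F a}

theorem mem_allCand_of_conv {κ : Kind} {σ : Ty} {F : Dom κ → Set Expr}
    (hF : ∀ (φ : TyCon κ) (a : Dom κ), Good κ φ a → IsCand (σ.inst φ) (F a))
    {s t : Expr} (hc : Conv s t) (h : t ∈ allCand κ F) :
    s ∈ allCand κ F :=
  ⟨h.1.of_conv hc, fun φ a ha => (hF φ a ha).conv _ _ (.tapp hc (.refl φ)) (h.2 φ a ha)⟩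

/-- As for term abstractions, normalization of the body comes from an instance at a variable; `base
κ` is a denotation of that variable. -/
theorem tlam_mem_allCand {κ : Kind} {σ : Ty} {F : Dom κ → Set Expr}
    (hF : ∀ (φ : TyCon κ) (a : Dom κ), Good κ φ a → IsCand (σ.inst φ) (F a))
    {s : Expr}
    (h : ∀ (φ : TyCon κ) (a : Dom κ), Good κ φ a → s.tyInst φ ∈ F a) :
    Expr.tlam κ s ∈ allCand κ F :=
  ⟨.tlam κ (.of_tyInst_var ((hF _ _ (good_base (.var κ 0))).wn _
    (h _ _ (good_base (.var κ 0))))),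
    fun φ a ha => (hF φ a ha).conv _ _ (Root.tbeta s φ).conv (h φ a ha)⟩

/-- The impredicative step. The rules at `∀α.σ` pass to instances `σ[α := φ]` that may be larger
than the quantified type; no measure is needed, since `hF` already supplies the closure conditions
at each instance. -/
theorem isCand_all {κ : Kind} {σ : Ty} {F : Dom κ → Set Expr}
    (hF : ∀ (φ : TyCon κ) (a : Dom κ), Good κ φ a → IsCand (σ.inst φ) (F a)) :
    IsCand (.all κ σ) (allCand κ F) where
  wn _ h := h.1
  conv _ _ hc h := mem_allCand_of_conv hF hc h
  neutral _ h := ⟨h.wn, fun φ a ha => (hF φ a ha).neutral _ (.tapp φ h)⟩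
  circ o s hs t ht := by
    refine mem_allCand_of_conv hF (Root.circAll o κ σ s t).conv
      (tlam_mem_allCand hF fun φ a ha => ?_)
    have h := (hF φ a ha).circ o _ (hs.2 φ a ha) _ (ht.2 φ a ha)
    have hw (s : Expr) : (s.tyWeaken κ).tySubst (TySub.single φ) = s := tyWeaken_tyInst s φ
    have hv : TySub.single φ κ 0 = φ := by simp [TySub.single]
    simpa [tyInst, tySubst, hw, TyCon.subst, hv, Expr.circ, TyCon.inst] using h
  lift s hs := by
    refine mem_allCand_of_conv hF (Root.liftAll κ σ s).conv
      (tlam_mem_allCand hF fun φ a ha => ?_)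
    have h := (hF φ a ha).lift s hs
    have hw (s : Expr) : (s.tyWeaken κ).tySubst (TySub.single φ) = s := tyWeaken_tyInst s φ
    simpa [tyInst, tySubst, hw, lft, TyCon.inst] using h
  -- The instance chosen by the rule is the pair of `chi κ` and `base κ`.
  flat s hs :=
    ((hF _ _ (good_chi κ)).flat _ (hs.2 _ _ (good_chi κ))).of_conv (Root.flatAll κ σ s).conv

end Expr

namespace Expr

/-! ### Weak normalization: the interpretation of types -/

/-- Assignments of elements of the semantic domains to type constructor variables. -/
abbrev Env : Type := (κ : Kind) → ℕ → Dom κ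

/-- The assignment `ρ` extended by `a` for the innermost variable of kind `κ`. -/
def Env.cons {κ : Kind} (a : Dom κ) (ρ : Env) : Env := fun κ' n =>
  if h : κ' = κ then
    match n with
    | 0 => h ▸ a
    | m + 1 => ρ κ' m
  else ρ κ' n

theorem Env.cons_zero {κ : Kind} (a : Dom κ) (ρ : Env) : Env.cons a ρ κ 0 = a := by
  simp [Env.cons]

theorem Env.cons_wk {κ : Kind} (a : Dom κ) (ρ : Env) :
    (fun κ' n => Env.cons a ρ κ' (TyRen.wk κ κ' n)) = ρ := by
  funext κ' n
  by_cases h : κ' = κ <;> simp [Env.cons, TyRen.wk, h]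

theorem Env.cons_up {κ : Kind} (a : Dom κ) (ρ : Env) (ξ : TyRen) :
    (fun κ' n => Env.cons a ρ κ' (ξ.up κ κ' n)) = Env.cons a fun κ' n => ρ κ' (ξ κ' n) := by
  funext κ' n
  by_cases h : κ' = κ
  · subst h
    cases n <;> simp [Env.cons, TyRen.up]
  · simp [Env.cons, TyRen.up, h]

/-- The interpretation of type constructors in the semantic domains. -/
def interp : {κ : Kind} → TyCon κ → Env → Dom κ
  | _, .var κ n, ρ => ρ κ n
  | _, .nat, _ => {s : Expr | s.Wn}
  | _, .app φ ψ, ρ => (interp φ ρ) (interp ψ ρ)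
  | _, .lam _ φ, ρ => fun a => interp φ (Env.cons a ρ)
  | _, .all κ σ, ρ => allCand κ fun a => interp σ (Env.cons a ρ)
  | _, .arr σ τ, ρ => arrCand (interp σ ρ) (interp τ ρ)

/-- The interpretation of types as sets of expressions. -/
def interpTy (σ : Ty) (ρ : Env) : Set Expr := interp σ ρ

theorem interp_rename {κ : Kind} (φ : TyCon κ) (ξ : TyRen) (ρ : Env) :
    interp (φ.rename ξ) ρ = interp φ fun κ n => ρ κ (ξ κ n) := by
  induction φ generalizing ξ ρ with
  | var κ n => rfl
  | nat => rfl
  | app φ ψ ih₁ ih₂ => simp only [TyCon.rename, interp, ih₁, ih₂]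
  | lam κ φ ih =>
    simp only [TyCon.rename, interp, ih, Env.cons_up]
    rfl
  | all κ σ ih =>
    simp only [TyCon.rename, interp, ih, Env.cons_up]
    rfl
  | arr σ τ ih₁ ih₂ =>
    simp only [TyCon.rename, interp, ih₁, ih₂]
    rfl

theorem interp_weaken {κ κ' : Kind} (φ : TyCon κ') (a : Dom κ) (ρ : Env) :
    interp (φ.weaken κ) (Env.cons a ρ) = interp φ ρ := by
  rw [TyCon.weaken, interp_rename, Env.cons_wk]

theorem Env.cons_interp_up {κ : Kind} (a : Dom κ) (ρ : Env) (θ : TySub) :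
    (fun κ' n => interp (θ.up κ κ' n) (Env.cons a ρ)) =
      Env.cons a fun κ' n => interp (θ κ' n) ρ := by
  funext κ' n
  by_cases h : κ' = κ
  · subst h
    cases n <;> simp [Env.cons, TySub.up, interp]
    exact interp_weaken _ _ _
  · simp only [TySub.up, h, if_false, Env.cons, dite_false]
    exact interp_weaken _ _ _

theorem interp_subst {κ : Kind} (φ : TyCon κ) (θ : TySub) (ρ : Env) :
    interp (φ.subst θ) ρ = interp φ fun κ n => interp (θ κ n) ρ := by
  induction φ generalizing θ ρ with
  | var κ n => rfl
  | nat => rfl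
  | app φ ψ ih₁ ih₂ => simp only [TyCon.subst, interp, ih₁, ih₂]
  | lam κ φ ih =>
    simp only [TyCon.subst, interp, ih, Env.cons_interp_up]
    rfl
  | all κ σ ih =>
    simp only [TyCon.subst, interp, ih, Env.cons_interp_up]
    rfl
  | arr σ τ ih₁ ih₂ =>
    simp only [TyCon.subst, interp, ih₁, ih₂]
    rfl

theorem interp_inst {κ κ' : Kind} (φ : TyCon κ') (ψ : TyCon κ) (ρ : Env) :
    interp (φ.inst ψ) ρ = interp φ (Env.cons (interp ψ ρ) ρ) := by
  rw [TyCon.inst, interp_subst]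
  congr 1
  funext κ' n
  by_cases h : κ' = κ
  · subst h
    cases n <;> simp [Env.cons, TySub.single, interp]
  · simp [Env.cons, TySub.single, interp, h]

theorem interp_beta {κ : Kind} {φ ψ : TyCon κ} (h : TyCon.Beta φ ψ) (ρ : Env) :
    interp φ ρ = interp ψ ρ := by
  induction h generalizing ρ with
  | beta φ ψ => rw [interp_inst]; rfl
  | appL ψ _ ih => simp only [interp, ih]
  | appR φ _ ih => simp only [interp, ih]
  | lam κ _ ih =>
    simp only [interp, ih]
    rfl
  | all κ _ ih =>
    simp only [interp, ih]
    rfl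
  | arrL τ _ ih =>
    simp only [interp, ih]
    rfl
  | arrR σ _ ih =>
    simp only [interp, ih]
    rfl

/-- Denotations depend on the semantic environment alone and not on a syntactic substitution, so
convertible types denote the same set. This validates the conversion rule of typing. -/
theorem interp_conv {κ : Kind} {φ ψ : TyCon κ} (h : TyCon.Conv φ ψ) (ρ : Env) :
    interp φ ρ = interp ψ ρ := by
  induction h with
  | rel φ ψ h => exact interp_beta h ρ
  | refl => rfl
  | symm _ _ _ ih => exact ih.symm
  | trans _ _ _ _ _ ih₁ ih₂ => exact ih₁.trans ih₂

theorem good_cons {κ : Kind} {φ : TyCon κ} {a : Dom κ} (h : Good κ φ a) {θ : TySub} {ρ : Env}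
    (hθ : ∀ κ n, Good κ (θ κ n) (ρ κ n)) (κ' : Kind) (n : ℕ) :
    Good κ' (TySub.cons φ θ κ' n) (Env.cons a ρ κ' n) := by
  by_cases hκ : κ' = κ
  · subst hκ
    cases n with
    | zero => simpa [TySub.cons, Env.cons] using h
    | succ n => simpa [TySub.cons, Env.cons] using hθ _ n
  · simpa [TySub.cons, Env.cons, hκ] using hθ _ n

/-- Fundamental lemma for type constructors: syntax under `θ` and semantics under `ρ` stay related.
At an abstraction, β-expansion is absorbed by `Good.of_conv`. -/
theorem good_interp {κ : Kind} (φ : TyCon κ) {θ : TySub} {ρ : Env}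
    (hθ : ∀ κ n, Good κ (θ κ n) (ρ κ n)) : Good κ (φ.subst θ) (interp φ ρ) := by
  induction φ generalizing θ ρ with
  | var κ n => exact hθ κ n
  | nat => exact isCand_nat
  | app φ ψ ih₁ ih₂ => exact ih₁ hθ _ _ (ih₂ hθ)
  | lam κ φ ih =>
    refine fun ψ a ha => (ih (good_cons ha hθ)).of_conv ?_
    rw [← TyCon.subst_up_inst]
    exact .rel _ _ (.beta _ _)
  | all κ σ ih =>
    refine isCand_all fun φ a ha => ?_
    rw [TyCon.subst_up_inst]
    exact ih (good_cons ha hθ)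
  | arr σ τ ih₁ ih₂ => exact IsCand.arr (ih₁ hθ) (ih₂ hθ)

/-- After unfolding the quantifier and the arrows, what is asked of an arbitrary candidate is
exactly its `circ`, `flat` or `lift` condition. -/
theorem sym_mem_interpTy (f : FSym) (ρ : Env) : Expr.sym f ∈ interpTy f.type ρ := by
  cases f with
  | num n => exact wn_sym _
  | op o =>
    refine ⟨wn_sym _, fun φ a (ha : IsCand φ a) => ?_⟩
    simp only [interp, Env.cons_zero]
    exact ⟨wn_tapp_sym _ _, fun s hs => ⟨wn_app_op o φ (ha.wn s hs),
      fun t ht => ha.circ o s hs t ht⟩⟩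
  | flatten =>
    refine ⟨wn_sym _, fun φ a (ha : IsCand φ a) => ?_⟩
    simp only [interp, Env.cons_zero]
    exact ⟨wn_tapp_sym _ _, fun s hs => ha.flat s hs⟩
  | lift =>
    refine ⟨wn_sym _, fun φ a (ha : IsCand φ a) => ?_⟩
    simp only [interp, Env.cons_zero]
    exact ⟨wn_tapp_sym _ _, fun s hs => ha.lift s hs⟩

/-- Fundamental lemma for terms. Types and terms are substituted simultaneously so that the
induction passes through both kinds of binder. -/
theorem mem_interpTy_of_hasType {Γ : Decl} {s : Expr} {σ : Ty} (h : HasType Γ s σ)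
    {θ : TySub} {ρ : Env} (hθ : ∀ κ n, Good κ (θ κ n) (ρ κ n)) {u : ℕ → Expr}
    (hu : ∀ i, u i ∈ interpTy (Γ i) ρ) : (s.tySubst θ).subst u ∈ interpTy σ ρ := by
  induction h generalizing θ ρ u with
  | var Γ i => exact hu i
  | sym Γ f => exact sym_mem_interpTy f ρ
  | @lam Γ σ τ s _ ih =>
    refine (good_interp σ hθ).lam_mem_arrCand (good_interp τ hθ) fun t ht => ?_
    rw [subst_subUp_inst]
    refine ih hθ fun i => ?_
    cases i with
    | zero => exact ht
    | succ i => exact hu i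
  | @tlam Γ κ σ s _ ih =>
    refine tlam_mem_allCand (σ := σ.subst (θ.up κ)) (fun φ a ha => ?_) fun φ a ha => ?_
    · rw [TyCon.subst_up_inst]
      exact good_interp σ (good_cons ha hθ)
    -- The instance of the body is `s` under `θ` extended by `φ`; the values of `u`, weakened under
    -- the binder, return to themselves.
    · rw [← tyInst_subst, tySubst_up_tyInst]
      refine ih (good_cons ha hθ) fun i => ?_
      rw [interpTy, Decl.weaken, interp_weaken]
      exact hu i
  | app _ _ ihs iht => exact (ihs hθ hu).2 _ (iht hθ hu)
  | tapp φ _ ih =>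
    rw [interpTy, interp_inst]
    exact (ih hθ hu).2 _ _ (good_interp φ hθ)
  | conv _ hc ih =>
    rw [interpTy, ← interp_conv hc]
    exact ih hθ hu

/-- The identity substitutions are admissible: type variables are interpreted by `base`, and term
variables are neutral, hence in every candidate. -/
theorem wn_of_hasType {Γ : Decl} {s : Expr} {σ : Ty} (h : HasType Γ s σ) : s.Wn := by
  have hθ : ∀ (κ : Kind) (n : ℕ), Good κ (.var κ n) (base κ) := fun κ n => good_base (.var κ n)
  have hc (σ : Ty) : IsCand (σ.subst TyCon.var) (interpTy σ fun κ _ => base κ) :=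
    good_interp σ hθ
  have := mem_interpTy_of_hasType h hθ fun i => (hc (Γ i)).neutral _ (.var i)
  rw [tySubst_var, subst_var] at this
  exact (hc σ).wn s this

end Expr

/-! ### Typing -/

theorem FSym.type_subst (f : FSym) (θ : TySub) : f.type.subst θ = f.type := by
  cases f <;> simp [FSym.type, TyCon.subst, TySub.up]

namespace HasType

theorem rename {Γ : Decl} {s : Expr} {σ : Ty} (h : HasType Γ s σ) {Δ : Decl} {r : ℕ → ℕ}
    (hr : ∀ i, Δ (r i) = Γ i) : HasType Δ (s.rename r) σ := by
  induction h generalizing Δ r with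
  | var Γ i => rw [← hr i]; exact .var Δ (r i)
  | sym Γ f => exact .sym Δ f
  | lam _ ih =>
    refine .lam (ih fun i => ?_)
    cases i with
    | zero => rfl
    | succ i => exact hr i
  | tlam _ ih => exact .tlam (ih fun i => by rw [Decl.weaken, hr]; rfl)
  | app _ _ ihs iht => exact .app (ihs hr) (iht hr)
  | tapp φ _ ih => exact .tapp φ (ih hr)
  | conv _ hc ih => exact .conv (ih hr) hc

theorem weaken {Γ : Decl} {s : Expr} {σ : Ty} (h : HasType Γ s σ) (τ : Ty) :
    HasType (Γ.cons τ) s.weaken σ :=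
  h.rename fun _ => rfl

theorem tySubst {Γ : Decl} {s : Expr} {σ : Ty} (h : HasType Γ s σ) (θ : TySub) :
    HasType (fun i => (Γ i).subst θ) (s.tySubst θ) (σ.subst θ) := by
  induction h generalizing θ with
  | var Γ i => exact .var (fun i => (Γ i).subst θ) i
  | sym Γ f => rw [FSym.type_subst]; exact .sym _ f
  | @lam Γ σ τ s _ ih =>
    refine .lam ?_
    convert ih θ using 1
    funext i
    cases i <;> rfl
  | @tlam Γ κ σ s _ ih =>
    refine .tlam ?_
    convert ih (θ.up κ) using 1
    funext i
    exact (TyCon.weaken_subst_up κ (Γ i) θ).symm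
  | app _ _ ihs iht => exact .app (ihs θ) (iht θ)
  | tapp φ _ ih => rw [TyCon.inst_subst]; exact .tapp _ (ih θ)
  | conv _ hc ih => exact .conv (ih θ) (hc.subst θ)

theorem tyWeaken {Γ : Decl} {s : Expr} {σ : Ty} (h : HasType Γ s σ) (κ : Kind) :
    HasType (Γ.weaken κ) (s.tyWeaken κ) (σ.weaken κ) := by
  unfold Decl.weaken
  simpa only [Expr.tyWeaken, TyCon.weaken, Expr.tyRename_eq_tySubst,
    TyCon.rename_eq_subst] using h.tySubst _

theorem tyInst {Γ : Decl} {κ : Kind} {s : Expr} {σ : Ty} (h : HasType (Γ.weaken κ) s σ)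
    (φ : TyCon κ) : HasType Γ (s.tyInst φ) (σ.inst φ) := by
  have h := h.tySubst (TySub.single φ)
  have hΓ : (fun i => (Γ.weaken κ i).subst (TySub.single φ)) = Γ :=
    funext fun i => TyCon.weaken_inst (Γ i) φ
  rwa [hΓ] at h

/-- Needed for invariance of typing under `≡`, where the annotation of an abstraction, and with it
the declaration of its variable, changes to a convertible type. -/
theorem decl_conv {Γ : Decl} {s : Expr} {σ : Ty} (h : HasType Γ s σ) {Δ : Decl}
    (hΔ : ∀ i, TyCon.Conv (Δ i) (Γ i)) : HasType Δ s σ := by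
  induction h generalizing Δ with
  | var Γ i => exact .conv (.var Δ i) (hΔ i)
  | sym Γ f => exact .sym Δ f
  | lam _ ih =>
    refine .lam (ih fun i => ?_)
    cases i with
    | zero => exact .refl _
    | succ i => exact hΔ i
  | tlam _ ih => exact .tlam (ih fun i => (hΔ i).rename _)
  | app _ _ ihs iht => exact .app (ihs hΔ) (iht hΔ)
  | tapp φ _ ih => exact .tapp φ (ih hΔ)
  | conv _ hc ih => exact .conv (ih hΔ) hc

theorem subst {Γ : Decl} {s : Expr} {σ : Ty} (h : HasType Γ s σ) {Δ : Decl} {u : ℕ → Expr}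
    (hu : ∀ i, HasType Δ (u i) (Γ i)) : HasType Δ (s.subst u) σ := by
  induction h generalizing Δ u with
  | var Γ i => exact hu i
  | sym Γ f => exact .sym Δ f
  | lam _ ih =>
    refine .lam (ih fun i => ?_)
    cases i with
    | zero => exact .var _ 0
    | succ i => exact (hu i).weaken _
  | tlam _ ih => exact .tlam (ih fun i => (hu i).tyWeaken _)
  | app _ _ ihs iht => exact .app (ihs hu) (iht hu)
  | tapp φ _ ih => exact .tapp φ (ih hu)
  | conv _ hc ih => exact .conv (ih hu) hc

theorem inst {Γ : Decl} {s t : Expr} {σ τ : Ty} (h : HasType (Γ.cons σ) s τ)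
    (ht : HasType Γ t σ) : HasType Γ (s.inst t) τ := by
  refine h.subst fun i => ?_
  cases i with
  | zero => exact ht
  | succ i => exact .var Γ i

/-! ### Inversion of typing and subject reduction. -/

theorem sym_inv {Γ : Decl} {f : FSym} {ρ : Ty} (h : HasType Γ (.sym f) ρ) :
    TyCon.Conv f.type ρ := by
  generalize hs : Expr.sym f = s at h
  induction h with
  | sym => cases hs; exact .refl _
  | conv _ hc ih => exact (ih hs).trans hc
  | _ => cases hs

theorem lam_inv {Γ : Decl} {σ ρ : Ty} {s : Expr} (h : HasType Γ (.lam σ s) ρ) :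
    ∃ τ, HasType (Γ.cons σ) s τ ∧ TyCon.Conv (.arr σ τ) ρ := by
  generalize hs : Expr.lam σ s = s at h
  induction h with
  | lam h => cases hs; exact ⟨_, h, .refl _⟩
  | conv _ hc ih => exact let ⟨τ, h, hc'⟩ := ih hs; ⟨τ, h, hc'.trans hc⟩
  | _ => cases hs

theorem tlam_inv {Γ : Decl} {κ : Kind} {ρ : Ty} {s : Expr} (h : HasType Γ (.tlam κ s) ρ) :
    ∃ τ, HasType (Γ.weaken κ) s τ ∧ TyCon.Conv (.all κ τ) ρ := by
  generalize hs : Expr.tlam κ s = s at h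
  induction h with
  | tlam h => cases hs; exact ⟨_, h, .refl _⟩
  | conv _ hc ih => exact let ⟨τ, h, hc'⟩ := ih hs; ⟨τ, h, hc'.trans hc⟩
  | _ => cases hs

theorem app_inv {Γ : Decl} {ρ : Ty} {s t : Expr} (h : HasType Γ (.app s t) ρ) :
    ∃ σ, HasType Γ s (.arr σ ρ) ∧ HasType Γ t σ := by
  generalize hs : Expr.app s t = s at h
  induction h with
  | app h h' => cases hs; exact ⟨_, h, h'⟩
  | conv _ hc ih =>
    obtain ⟨σ, h, h'⟩ := ih hs
    exact ⟨σ, h.conv (.arr (.refl _) hc), h'⟩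
  | _ => cases hs

theorem tapp_inv {Γ : Decl} {κ : Kind} {ρ : Ty} {s : Expr} {φ : TyCon κ}
    (h : HasType Γ (.tapp s φ) ρ) :
    ∃ σ, HasType Γ s (.all κ σ) ∧ TyCon.Conv (σ.inst φ) ρ := by
  generalize hs : Expr.tapp s φ = s at h
  induction h with
  | tapp φ h => cases hs; exact ⟨_, h, .refl _⟩
  | conv _ hc ih => exact let ⟨τ, h, hc'⟩ := ih hs; ⟨τ, h, hc'.trans hc⟩
  | _ => cases hs

theorem equiv {Γ : Decl} {s t : Expr} {σ : Ty} (h : HasType Γ s σ) (he : Expr.Equiv s t) :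
    HasType Γ t σ := by
  induction h generalizing t with
  | var Γ i => cases he; exact .var Γ i
  | sym Γ f => cases he; exact .sym Γ f
  | lam _ ih =>
    cases he with
    | lam hc he =>
      refine .conv (.lam ((ih he).decl_conv fun i => ?_)) (.arr hc.symm (.refl _))
      cases i with
      | zero => exact hc.symm
      | succ i => exact .refl _
  | tlam _ ih => cases he with | tlam _ he => exact .tlam (ih he)
  | app _ _ ihs iht => cases he with | app h₁ h₂ => exact .app (ihs h₁) (iht h₂)
  | tapp φ _ ih =>
    cases he with
    | tapp he hc => exact .conv (.tapp _ (ih he)) (.inst (.refl _) hc.symm)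
  | conv _ hc ih => exact .conv (ih he) hc

theorem op_inv {Γ : Decl} {o : Op} {σ ρ : Ty}
    (h : HasType Γ (.tapp (.sym (.op o)) σ) ρ) : TyCon.Conv (.arr σ (.arr σ σ)) ρ := by
  obtain ⟨τ, h, hc⟩ := h.tapp_inv
  simpa [TyCon.inst, TyCon.subst, TySub.single] using
    (h.sym_inv.all_all.2.inst (.refl σ)).trans hc

theorem flatten_inv {Γ : Decl} {σ ρ : Ty}
    (h : HasType Γ (.tapp (.sym .flatten) σ) ρ) : TyCon.Conv (.arr σ .nat) ρ := by
  obtain ⟨τ, h, hc⟩ := h.tapp_inv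
  simpa [TyCon.inst, TyCon.subst, TySub.single] using
    (h.sym_inv.all_all.2.inst (.refl σ)).trans hc

theorem lift_inv {Γ : Decl} {σ ρ : Ty}
    (h : HasType Γ (.tapp (.sym .lift) σ) ρ) : TyCon.Conv (.arr .nat σ) ρ := by
  obtain ⟨τ, h, hc⟩ := h.tapp_inv
  simpa [TyCon.inst, TyCon.subst, TySub.single] using
    (h.sym_inv.all_all.2.inst (.refl σ)).trans hc

theorem circ_inv {Γ : Decl} {o : Op} {σ ρ : Ty} {s t : Expr}
    (h : HasType Γ (.circ o σ s t) ρ) :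
    HasType Γ s σ ∧ HasType Γ t σ ∧ TyCon.Conv σ ρ := by
  obtain ⟨τ, h, ht⟩ := h.app_inv
  obtain ⟨τ', h, hs⟩ := h.app_inv
  obtain ⟨h₁, h₂⟩ := h.op_inv.arr_arr
  obtain ⟨h₂, h₃⟩ := h₂.arr_arr
  exact ⟨hs.conv h₁.symm, ht.conv h₂.symm, h₃⟩

theorem flat_inv {Γ : Decl} {σ ρ : Ty} {s : Expr} (h : HasType Γ (.flat σ s) ρ) :
    HasType Γ s σ ∧ TyCon.Conv .nat ρ := by
  obtain ⟨τ, h, hs⟩ := h.app_inv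
  obtain ⟨h₁, h₂⟩ := h.flatten_inv.arr_arr
  exact ⟨hs.conv h₁.symm, h₂⟩

theorem lft_inv {Γ : Decl} {σ ρ : Ty} {s : Expr} (h : HasType Γ (.lft σ s) ρ) :
    HasType Γ s .nat ∧ TyCon.Conv σ ρ := by
  obtain ⟨τ, h, hs⟩ := h.app_inv
  obtain ⟨h₁, h₂⟩ := h.lift_inv.arr_arr
  exact ⟨hs.conv h₁.symm, h₂⟩

theorem circ {Γ : Decl} (o : Op) {σ : Ty} {s t : Expr} (hs : HasType Γ s σ)
    (ht : HasType Γ t σ) : HasType Γ (.circ o σ s t) σ := by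
  refine .app (.app ?_ hs) ht
  simpa [TyCon.inst, TyCon.subst, TySub.single] using HasType.tapp σ (.sym Γ (.op o))

theorem flat {Γ : Decl} {σ : Ty} {s : Expr} (hs : HasType Γ s σ) :
    HasType Γ (.flat σ s) .nat := by
  refine .app ?_ hs
  simpa [TyCon.inst, TyCon.subst, TySub.single] using HasType.tapp σ (.sym Γ .flatten)

theorem lft {Γ : Decl} (σ : Ty) {s : Expr} (hs : HasType Γ s .nat) :
    HasType Γ (.lft σ s) σ := by
  refine .app ?_ hs
  simpa [TyCon.inst, TyCon.subst, TySub.single] using HasType.tapp σ (.sym Γ .lift)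

theorem tapp_var {Γ : Decl} {κ : Kind} {σ : Ty} {s : Expr} (h : HasType Γ s (.all κ σ)) :
    HasType (Γ.weaken κ) (.tapp (s.tyWeaken κ) (TyCon.var κ 0)) σ := by
  simpa only [TyCon.weaken_up_inst_var] using HasType.tapp (.var κ 0) (h.tyWeaken κ)

/-- Subject reduction. -/
theorem step {s t : Expr} (hst : Expr.Step s t) {Γ : Decl} {ρ : Ty} (h : HasType Γ s ρ) :
    HasType Γ t ρ := by
  induction hst generalizing Γ ρ with
  | lam σ _ ih => obtain ⟨τ, h, hc⟩ := h.lam_inv; exact .conv (.lam (ih h)) hc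
  | tlam κ _ ih => obtain ⟨τ, h, hc⟩ := h.tlam_inv; exact .conv (.tlam (ih h)) hc
  | appR u _ ih => obtain ⟨τ, h, h'⟩ := h.app_inv; exact .app h (ih h')
  | appL u _ ih => obtain ⟨τ, h, h'⟩ := h.app_inv; exact .app (ih h) h'
  | tapp φ _ ih => obtain ⟨τ, h, hc⟩ := h.tapp_inv; exact .conv (.tapp φ (ih h)) hc
  | beta σ s t =>
    obtain ⟨τ, h, h'⟩ := h.app_inv
    obtain ⟨τ', h, hc⟩ := h.lam_inv
    exact (h.inst (h'.conv hc.arr_arr.1.symm)).conv hc.arr_arr.2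
  | tbeta s φ =>
    obtain ⟨τ, h, hc⟩ := h.tapp_inv
    obtain ⟨τ', h, hc'⟩ := h.tlam_inv
    exact (h.tyInst φ).conv ((hc'.all_all.2.inst (.refl φ)).trans hc)
  | circNat o n m => exact .conv (.sym Γ _) h.circ_inv.2.2
  | circArr o σ τ s t =>
    obtain ⟨hs, ht, hc⟩ := h.circ_inv
    exact .conv (.lam (.circ o (.app (hs.weaken σ) (.var _ 0)) (.app (ht.weaken σ) (.var _ 0)))) hc
  | circAll o κ σ s t =>
    obtain ⟨hs, ht, hc⟩ := h.circ_inv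
    exact .conv (.tlam (.circ o hs.tapp_var ht.tapp_var)) hc
  | flatNat s => exact h.flat_inv.1.conv h.flat_inv.2
  | flatArr σ τ s =>
    obtain ⟨hs, hc⟩ := h.flat_inv
    exact .conv (.flat (.app hs (.lft σ (.sym Γ (.num 0))))) hc
  | flatAll κ σ s =>
    obtain ⟨hs, hc⟩ := h.flat_inv
    exact .conv (.flat (.tapp (chi κ) hs)) hc
  | liftNat s => exact h.lft_inv.1.conv h.lft_inv.2
  | liftArr σ τ s =>
    obtain ⟨hs, hc⟩ := h.lft_inv
    exact .conv (.lam (.lft τ (hs.weaken σ))) hc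
  | liftAll κ σ s =>
    obtain ⟨hs, hc⟩ := h.lft_inv
    exact .conv (.tlam (.lft σ (hs.tyWeaken κ))) hc

end HasType

/-! ### Reduction on interpretation terms -/

namespace Expr

/-- A reduction step, or a change of types up to convertibility. -/
def StepOrEquiv (s t : Expr) : Prop := Step s t ∨ Equiv s t

/-- Reductions inside types turn into `≡`, contractions at the root into rule steps. Hence a
parallel reduction becomes a sequence of `⇝` on classes. -/
theorem Par.stepOrEquiv {s t : Expr} (h : Par s t) :
    Relation.ReflTransGen StepOrEquiv s t := by
  have mono {f : Expr → Expr} (h₁ : ∀ s t, Step s t → Step (f s) (f t))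
      (h₂ : ∀ s t, Equiv s t → Equiv (f s) (f t)) {s t : Expr}
      (h : Relation.ReflTransGen StepOrEquiv s t) :
      Relation.ReflTransGen StepOrEquiv (f s) (f t) :=
    h.lift f fun _ _ h => h.imp (h₁ _ _) (h₂ _ _)
  have app {s s' t t' : Expr} (h : Relation.ReflTransGen StepOrEquiv s s')
      (h' : Relation.ReflTransGen StepOrEquiv t t') :
      Relation.ReflTransGen StepOrEquiv (.app s t) (.app s' t') :=
    (mono (f := fun s => .app s t) (fun _ _ h => .appL t h) (fun _ _ h => .app h (.refl t)) h).trans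
      (mono (fun _ _ h => .appR s' h) (fun _ _ h => .app (.refl s') h) h')
  have tapp {κ : Kind} {s s' : Expr} {φ φ' : TyCon κ}
      (h : Relation.ReflTransGen StepOrEquiv s s') (h' : TyCon.Par φ φ') :
      Relation.ReflTransGen StepOrEquiv (.tapp s φ) (.tapp s' φ') :=
    (mono (f := fun s => .tapp s φ) (fun _ _ h => .tapp φ h)
      (fun _ _ h => .tapp h (.refl φ)) h).tail (.inr (.tapp (.refl s') (.of_par h')))
  induction h with
  | var i => exact .refl
  | sym f => exact .refl
  | lam hσ _ ih =>
    exact (mono (fun _ _ h => .lam _ h) (fun _ _ h => .lam (.refl _) h) ih).tail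
      (.inr (.lam (.of_par hσ) (.refl _)))
  | tlam κ _ ih => exact mono (fun _ _ h => .tlam κ h) (fun _ _ h => .tlam κ h) ih
  | app _ _ ihs iht => exact app ihs iht
  | tapp _ hφ ih => exact tapp ih hφ
  | appRoot _ _ hr ihs iht => exact (app ihs iht).tail (.inl hr.step)
  | tappRoot _ hφ hr ih => exact (tapp ih hφ).tail (.inl hr.step)

theorem Pars.stepOrEquiv {s t : Expr} (h : Pars s t) :
    Relation.ReflTransGen StepOrEquiv s t := by
  induction h with
  | refl => exact .refl
  | tail _ h ih => exact ih.trans h.stepOrEquiv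

theorem exists_canonical (s : Expr) : ∃ t : Expr, Equiv s t ∧ t.IsCanonical := by
  induction s with
  | var i => exact ⟨_, .var i, trivial⟩
  | sym f => exact ⟨_, .sym f, trivial⟩
  | lam σ s ih =>
    obtain ⟨t, he, ht⟩ := ih
    obtain ⟨τ, hτ, hc⟩ := σ.wn
    exact ⟨_, .lam hc he, hτ.isNormal, ht⟩
  | tlam κ s ih =>
    obtain ⟨t, he, ht⟩ := ih
    exact ⟨_, .tlam κ he, ht⟩
  | app s t ihs iht =>
    obtain ⟨s', he, hs⟩ := ihs
    obtain ⟨t', he', ht⟩ := iht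
    exact ⟨_, .app he he', hs, ht⟩
  | tapp s φ ih =>
    obtain ⟨t, he, ht⟩ := ih
    obtain ⟨ψ, hψ, hc⟩ := φ.wn
    exact ⟨_, .tapp he hc, ht, hψ.isNormal⟩

/-! ### Reduction steps of equivalent expressions. -/

theorem Equiv.tapp_sym_inv {f : FSym} {κ : Kind} {φ : TyCon κ} {u : Expr}
    (h : Equiv (.tapp (.sym f) φ) u) : ∃ φ', u = .tapp (.sym f) φ' ∧ TyCon.Conv φ φ' := by
  cases h with
  | tapp h hc => cases h; exact ⟨_, rfl, hc⟩

theorem Equiv.circ_inv {o : Op} {σ : Ty} {s t u : Expr} (h : Equiv (.circ o σ s t) u) :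
    ∃ σ' s' t', u = .circ o σ' s' t' ∧ TyCon.Conv σ σ' ∧ Equiv s s' ∧ Equiv t t' := by
  unfold Expr.circ at h
  cases h with
  | app h ht =>
    cases h with
    | app h hs =>
      obtain ⟨σ', rfl, hc⟩ := h.tapp_sym_inv
      exact ⟨_, _, _, rfl, hc, hs, ht⟩

theorem Equiv.flat_inv {σ : Ty} {s u : Expr} (h : Equiv (.flat σ s) u) :
    ∃ σ' s', u = .flat σ' s' ∧ TyCon.Conv σ σ' := by
  unfold Expr.flat at h
  cases h with
  | app h hs =>
    obtain ⟨σ', rfl, hc⟩ := h.tapp_sym_inv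
    exact ⟨_, _, rfl, hc⟩

theorem Equiv.lft_inv {σ : Ty} {s u : Expr} (h : Equiv (.lft σ s) u) :
    ∃ σ' s', u = .lft σ' s' ∧ TyCon.Conv σ σ' := by
  unfold Expr.lft at h
  cases h with
  | app h hs =>
    obtain ⟨σ', rfl, hc⟩ := h.tapp_sym_inv
    exact ⟨_, _, rfl, hc⟩

/-- A redex visible in some representative is visible in one with normal types: if a normal type is
convertible to `nat`, an arrow or a quantified type, it has that very form. The new contractum need
not be related to `t`; for testing normality its existence is enough. -/
theorem Step.exists_of_equiv {s t u : Expr} (h : Step s t) (he : Equiv s u)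
    (hu : u.IsCanonical) : ∃ v, Step u v := by
  induction h generalizing u with
  | lam σ _ ih =>
    cases he with | lam _ he => exact let ⟨_, h⟩ := ih he hu.2; ⟨_, .lam _ h⟩
  | tlam κ _ ih =>
    cases he with | tlam _ he => exact let ⟨_, h⟩ := ih he hu; ⟨_, .tlam _ h⟩
  | appR w _ ih =>
    cases he with | app _ he => exact let ⟨_, h⟩ := ih he hu.2; ⟨_, .appR _ h⟩
  | appL w _ ih =>
    cases he with | app he _ => exact let ⟨_, h⟩ := ih he hu.1; ⟨_, .appL _ h⟩
  | tapp φ _ ih =>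
    cases he with | tapp he _ => exact let ⟨_, h⟩ := ih he hu.1; ⟨_, .tapp _ h⟩
  | beta σ s t =>
    cases he with | app he _ => cases he with | lam _ _ => exact ⟨_, .beta _ _ _⟩
  | tbeta s φ =>
    cases he with | tapp he _ => cases he with | tlam _ _ => exact ⟨_, .tbeta _ _⟩
  | circNat o n m =>
    obtain ⟨σ', s', t', rfl, hc, hs, ht⟩ := he.circ_inv
    obtain rfl := (hc.pars_nf hu.1.1.2.nf).nat_inv
    cases hs
    cases ht
    exact ⟨_, .circNat o n m⟩
  | circArr o σ τ s t =>
    obtain ⟨σ', s', t', rfl, hc, -, -⟩ := he.circ_inv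
    obtain ⟨_, _, rfl, -⟩ := (hc.pars_nf hu.1.1.2.nf).arr_inv
    exact ⟨_, .circArr _ _ _ _ _⟩
  | circAll o κ σ s t =>
    obtain ⟨σ', s', t', rfl, hc, -, -⟩ := he.circ_inv
    obtain ⟨_, rfl, -⟩ := (hc.pars_nf hu.1.1.2.nf).all_inv
    exact ⟨_, .circAll _ _ _ _ _⟩
  | flatNat s =>
    obtain ⟨σ', s', rfl, hc⟩ := he.flat_inv
    obtain rfl := (hc.pars_nf hu.1.2.nf).nat_inv
    exact ⟨_, .flatNat _⟩
  | flatArr σ τ s =>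
    obtain ⟨σ', s', rfl, hc⟩ := he.flat_inv
    obtain ⟨_, _, rfl, -⟩ := (hc.pars_nf hu.1.2.nf).arr_inv
    exact ⟨_, .flatArr _ _ _⟩
  | flatAll κ σ s =>
    obtain ⟨σ', s', rfl, hc⟩ := he.flat_inv
    obtain ⟨_, rfl, -⟩ := (hc.pars_nf hu.1.2.nf).all_inv
    exact ⟨_, .flatAll _ _ _⟩
  | liftNat s =>
    obtain ⟨σ', s', rfl, hc⟩ := he.lft_inv
    obtain rfl := (hc.pars_nf hu.1.2.nf).nat_inv
    exact ⟨_, .liftNat _⟩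
  | liftArr σ τ s =>
    obtain ⟨σ', s', rfl, hc⟩ := he.lft_inv
    obtain ⟨_, _, rfl, -⟩ := (hc.pars_nf hu.1.2.nf).arr_inv
    exact ⟨_, .liftArr _ _ _⟩
  | liftAll κ σ s =>
    obtain ⟨σ', s', rfl, hc⟩ := he.lft_inv
    obtain ⟨_, rfl, -⟩ := (hc.pars_nf hu.1.2.nf).all_inv
    exact ⟨_, .liftAll _ _ _⟩

theorem Nf.not_step {s : Expr} (h : s.Nf) (t : Expr) : ¬ Step s t := by
  intro hs
  induction hs with
  | lam σ _ ih => exact ih h.2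
  | tlam κ _ ih => exact ih h
  | appR u _ ih => exact ih h.2.1
  | appL u _ ih => exact ih h.1
  | tapp φ _ ih => exact ih h.1
  | beta σ s t => exact h.2.2 _ (.beta σ s t)
  | tbeta s φ => exact h.2.2 _ (.tbeta s φ)
  | circNat o n m => exact h.2.2 _ (.circNat o n m)
  | circArr o σ τ s t => exact h.2.2 _ (.circArr o σ τ s t)
  | circAll o κ σ s t => exact h.2.2 _ (.circAll o κ σ s t)
  | flatNat s => exact h.2.2 _ (.flatNat s)
  | flatArr σ τ s => exact h.2.2 _ (.flatArr σ τ s)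
  | flatAll κ σ s => exact h.2.2 _ (.flatAll κ σ s)
  | liftNat s => exact h.2.2 _ (.liftNat s)
  | liftArr σ τ s => exact h.2.2 _ (.liftArr σ τ s)
  | liftAll κ σ s => exact h.2.2 _ (.liftAll κ σ s)

end Expr

namespace ITerm

variable {Γ : Decl}

theorem reds_of_pars {s t : Expr} (h : Expr.Pars s t) (hs : ∃ σ, Interp.HasType Γ s σ) :
    ∃ ht : ∃ σ, Interp.HasType Γ t σ,
      Relation.ReflTransGen Red (Preterm.toTerm ⟨s, hs⟩) (Preterm.toTerm ⟨t, ht⟩) := by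
  replace h := h.stepOrEquiv
  induction h with
  | refl => exact ⟨hs, .refl⟩
  | tail _ h ih =>
    obtain ⟨⟨σ, hσ⟩, h'⟩ := ih
    cases h with
    | inl h => exact ⟨⟨σ, hσ.step h⟩, h'.tail ⟨_, _, rfl, rfl, h⟩⟩
    | inr h =>
      -- A change within the class adds no step: both expressions represent the same term.
      refine ⟨⟨σ, hσ.equiv h⟩, ?_⟩
      convert h' using 1
      exact Quotient.sound (s := Preterm.setoid Γ) h.symm

theorem isNormal_of_nf {p : Preterm Γ} (h : p.1.Nf) : p.toTerm.IsNormal := by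
  rintro t ⟨q, r, hq, -, hs⟩
  obtain ⟨v, hv⟩ := hs.exists_of_equiv (Quotient.exact hq) h.isCanonical
  exact h.not_step v hv

theorem not_step_of_isNormal {p : Preterm Γ} (h : p.toTerm.IsNormal) (t : Expr) :
    ¬ Expr.Step p.1 t := fun ht =>
  let ⟨σ, hσ⟩ := p.2
  h _ ⟨p, ⟨t, σ, hσ.step ht⟩, rfl, rfl, ht⟩

theorem exists_nf_of_isNormal {t : ITerm Γ} (h : t.IsNormal) :
    ∃ p : Preterm Γ, p.toTerm = t ∧ p.1.Nf := by
  obtain ⟨⟨s, σ, hσ⟩, rfl⟩ := Quotient.exists_rep t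
  obtain ⟨c, he, hc⟩ := s.exists_canonical
  have hq : Preterm.toTerm ⟨c, σ, hσ.equiv he⟩ = Preterm.toTerm (Γ := Γ) ⟨s, σ, hσ⟩ :=
    Quotient.sound (s := Preterm.setoid Γ) he.symm
  refine ⟨_, hq, Expr.nf_of_not_step hc (not_step_of_isNormal ?_)⟩
  rw [hq]
  exact h

theorem conv_of_reds {s t : ITerm Γ} (h : Relation.ReflTransGen Red s t) {p q : Preterm Γ}
    (hp : p.toTerm = s) (hq : q.toTerm = t) : Expr.Conv p.1 q.1 := by
  induction h generalizing q with
  | refl => exact .of_equiv (Quotient.exact (hp.trans hq.symm))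
  | tail _ h ih =>
    obtain ⟨p', q', hp', hq', hs⟩ := h
    exact ((ih hp').trans (.of_par hs.par)).trans
      (.of_equiv (Quotient.exact (hq'.trans hq.symm)))

/-- Existence is weak normalization of the representative. For uniqueness, any other normal class
has a redex-free representative convertible to the first, and hence equal to it. -/
theorem existsUnique_normalForm (s : ITerm Γ) : ∃! u, s.HasNormalForm u := by
  obtain ⟨⟨s, σ, hσ⟩, rfl⟩ := Quotient.exists_rep s
  obtain ⟨t, ht, hc⟩ := Expr.wn_of_hasType hσ
  obtain ⟨hty, hr⟩ := reds_of_pars (hc.pars_nf ht) ⟨σ, hσ⟩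
  refine ⟨_, ⟨hr, isNormal_of_nf ht⟩, ?_⟩
  rintro u ⟨hu, hn⟩
  obtain ⟨q, rfl, hq⟩ := exists_nf_of_isNormal hn
  have hc' := conv_of_reds hu rfl rfl
  exact congrArg Preterm.toTerm (Subtype.ext ((hc'.symm.trans hc).eq_of_nf hq ht))

end ITerm

/-! ### Closed terms -/

theorem TyRen.up_eq_self {κ κ' : Kind} {ξ : TyRen} {n : ℕ}
    (h : ∀ m, TyRen.wk κ κ' m = n → ξ κ' m = m) : ξ.up κ κ' n = n := by
  by_cases hκ : κ' = κ
  · cases n with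
    | zero => simp [TyRen.up, hκ]
    | succ n => simpa [TyRen.up, hκ] using h n (by simp [TyRen.wk, hκ])
  · simpa [TyRen.up, hκ] using h n (by simp [TyRen.wk, hκ])

theorem TyRen.wk_eq_up {κ κ' : Kind} {ξ : TyRen} {n m : ℕ}
    (h : TyRen.wk κ κ' n = ξ.up κ κ' m) : ∃ k, m = TyRen.wk κ κ' k ∧ n = ξ κ' k := by
  by_cases hκ : κ' = κ
  · cases m with
    | zero => simp [TyRen.up, TyRen.wk, hκ] at h
    | succ m => exact ⟨m, by simp [TyRen.wk, hκ], by simpa [TyRen.up, TyRen.wk, hκ] using h⟩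
  · exact ⟨m, by simp [TyRen.wk, hκ], by simpa [TyRen.up, TyRen.wk, hκ] using h⟩

theorem TyCon.rename_eq_self {κ : Kind} (φ : TyCon κ) {ξ : TyRen}
    (h : ∀ v ∈ φ.ftv, ξ v.1 v.2 = v.2) : φ.rename ξ = φ := by
  induction φ generalizing ξ with
  | var κ n => exact congrArg _ (h (κ, n) rfl)
  | nat => rfl
  | app φ ψ ih₁ ih₂ =>
    rw [rename, ih₁ fun v hv => h v (.inl hv), ih₂ fun v hv => h v (.inr hv)]
  | lam κ φ ih =>
    rw [rename, ih fun v hv => TyRen.up_eq_self fun m hm => h (v.1, m) ?_]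
    exact (congrArg (fun n => (v.1, n) ∈ φ.ftv) hm).mpr hv
  | all κ φ ih =>
    rw [rename, ih fun v hv => TyRen.up_eq_self fun m hm => h (v.1, m) ?_]
    exact (congrArg (fun n => (v.1, n) ∈ φ.ftv) hm).mpr hv
  | arr σ τ ih₁ ih₂ =>
    rw [rename, ih₁ fun v hv => h v (.inl hv), ih₂ fun v hv => h v (.inr hv)]

theorem TyCon.exists_of_mem_ftv_rename {κ : Kind} (φ : TyCon κ) {ξ : TyRen} {κ' : Kind} {n : ℕ}
    (h : (κ', n) ∈ (φ.rename ξ).ftv) : ∃ m, (κ', m) ∈ φ.ftv ∧ n = ξ κ' m := by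
  induction φ generalizing ξ n with
  | var κ m => cases h; exact ⟨m, rfl, rfl⟩
  | nat => cases h
  | app φ ψ ih₁ ih₂ =>
    rcases h with h | h
    · exact (ih₁ h).imp fun _ h => h.imp_left .inl
    · exact (ih₂ h).imp fun _ h => h.imp_left .inr
  | lam κ φ ih =>
    obtain ⟨m, hm, he⟩ := ih h
    obtain ⟨k, rfl, hk⟩ := TyRen.wk_eq_up he
    exact ⟨k, hm, hk⟩
  | all κ φ ih =>
    obtain ⟨m, hm, he⟩ := ih h
    obtain ⟨k, rfl, hk⟩ := TyRen.wk_eq_up he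
    exact ⟨k, hm, hk⟩
  | arr σ τ ih₁ ih₂ =>
    rcases h with h | h
    · exact (ih₁ h).imp fun _ h => h.imp_left .inl
    · exact (ih₂ h).imp fun _ h => h.imp_left .inr

namespace Expr

theorem tyRename_eq_self (s : Expr) {ξ : TyRen} (h : ∀ v ∈ s.ftv, ξ v.1 v.2 = v.2) :
    s.tyRename ξ = s := by
  induction s generalizing ξ with
  | var i => rfl
  | sym f => rfl
  | lam σ s ih =>
    rw [tyRename, ih fun v hv => h v (.inr hv), σ.rename_eq_self fun v hv => h v (.inl hv)]
  | tlam κ s ih =>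
    rw [tyRename, ih fun v hv => TyRen.up_eq_self fun m hm => h (v.1, m) ?_]
    exact (congrArg (fun n => (v.1, n) ∈ s.ftv) hm).mpr hv
  | app s t ihs iht =>
    rw [tyRename, ihs fun v hv => h v (.inl hv), iht fun v hv => h v (.inr hv)]
  | tapp s φ ih =>
    rw [tyRename, ih fun v hv => h v (.inl hv), φ.rename_eq_self fun v hv => h v (.inr hv)]

theorem exists_of_mem_ftv_tyRename (s : Expr) {ξ : TyRen} {κ : Kind} {n : ℕ}
    (h : (κ, n) ∈ (s.tyRename ξ).ftv) : ∃ m, (κ, m) ∈ s.ftv ∧ n = ξ κ m := by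
  induction s generalizing ξ n with
  | var i => cases h
  | sym f => cases h
  | lam σ s ih =>
    rcases h with h | h
    · exact (σ.exists_of_mem_ftv_rename h).imp fun _ h => h.imp_left .inl
    · exact (ih h).imp fun _ h => h.imp_left .inr
  | tlam κ s ih =>
    obtain ⟨m, hm, he⟩ := ih h
    obtain ⟨k, rfl, hk⟩ := TyRen.wk_eq_up he
    exact ⟨k, hm, hk⟩
  | app s t ihs iht =>
    rcases h with h | h
    · exact (ihs h).imp fun _ h => h.imp_left .inl
    · exact (iht h).imp fun _ h => h.imp_left .inr
  | tapp s φ ih =>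
    rcases h with h | h
    · exact (ih h).imp fun _ h => h.imp_left .inl
    · exact (φ.exists_of_mem_ftv_rename h).imp fun _ h => h.imp_left .inr

theorem rename_eq_self (s : Expr) {r : ℕ → ℕ} (h : ∀ i ∈ s.fv, r i = i) :
    s.rename r = s := by
  induction s generalizing r with
  | var i => exact congrArg _ (h i rfl)
  | sym f => rfl
  | lam σ s ih =>
    rw [rename, ih fun i hi => ?_]
    cases i with
    | zero => rfl
    | succ i => exact congrArg Nat.succ (h i hi)
  | tlam κ s ih => rw [rename, ih h]
  | app s t ihs iht =>
    rw [rename, ihs fun i hi => h i (.inl hi), iht fun i hi => h i (.inr hi)]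
  | tapp s φ ih => rw [rename, ih h]

theorem exists_of_mem_fv_rename (s : Expr) {r : ℕ → ℕ} {i : ℕ} (h : i ∈ (s.rename r).fv) :
    ∃ j ∈ s.fv, i = r j := by
  induction s generalizing r i with
  | var j => cases h; exact ⟨j, rfl, rfl⟩
  | sym f => cases h
  | lam σ s ih =>
    obtain ⟨j, hj, he⟩ := ih h
    cases j with
    | zero => cases he
    | succ j => exact ⟨j, hj, Nat.succ.inj he⟩
  | tlam κ s ih => exact ih h
  | app s t ihs iht =>
    rcases h with h | h
    · exact (ihs h).imp fun _ h => h.imp_left .inl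
    · exact (iht h).imp fun _ h => h.imp_left .inr
  | tapp s φ ih => exact ih h

/-- Every free variable of the shifted expression is the successor of a free variable of `s`. So `0`
is not free, and `i + 1` is free only if `i` is. -/
theorem fv_eq_empty_of_rename {s : Expr} (h : s.rename Nat.succ = s) : s.fv = ∅ := by
  refine Set.eq_empty_of_forall_notMem fun i => ?_
  induction i with
  | zero =>
    intro hi
    rw [← h] at hi
    obtain ⟨j, -, he⟩ := s.exists_of_mem_fv_rename hi
    cases he
  | succ i ih =>
    intro hi
    rw [← h] at hi
    obtain ⟨j, hj, he⟩ := s.exists_of_mem_fv_rename hi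
    cases he
    exact ih hj

theorem ftv_eq_empty_of_tyRename {s : Expr} (h : s.tyRename (fun _ n => n + 1) = s) :
    s.ftv = ∅ := by
  refine Set.eq_empty_of_forall_notMem fun ⟨κ, n⟩ => ?_
  induction n with
  | zero =>
    intro hi
    rw [← h] at hi
    obtain ⟨j, -, he⟩ := s.exists_of_mem_ftv_tyRename hi
    cases he
  | succ n ih =>
    intro hi
    rw [← h] at hi
    obtain ⟨j, hj, he⟩ := s.exists_of_mem_ftv_tyRename hi
    cases he
    exact ih hj

/-- Shifting the reduction `s ⟶ t` gives another one from `s`, which is closed and so unchanged by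
the shift. By uniqueness of normal forms `t` equals its own shift. -/
theorem Pars.fv_eq_empty {s t : Expr} (h : Pars s t) (ht : t.Nf) (hs : s.fv = ∅) :
    t.fv = ∅ := by
  refine fv_eq_empty_of_rename ?_
  have h' : Pars (s.rename Nat.succ) (t.rename Nat.succ) := h.lift _ fun _ _ h => h.rename _
  rw [s.rename_eq_self (by simp [hs])] at h'
  exact ((Conv.of_pars h').symm.trans (.of_pars h)).eq_of_nf (nf_rename.2 ht) ht

/-- The same argument, shifting the type variables of all kinds at once. -/
theorem Pars.ftv_eq_empty {s t : Expr} (h : Pars s t) (ht : t.Nf) (hs : s.ftv = ∅) :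
    t.ftv = ∅ := by
  refine ftv_eq_empty_of_tyRename ?_
  have h' : Pars (s.tyRename fun _ n => n + 1) (t.tyRename fun _ n => n + 1) :=
    h.lift _ fun _ _ h => h.tyRename _
  rw [s.tyRename_eq_self (by simp [hs])] at h'
  exact ((Conv.of_pars h').symm.trans (.of_pars h)).eq_of_nf (nf_tyRename.2 ht) ht

end Expr

theorem ITerm.HasNormalForm.isClosed {Γ : Decl} {s u : ITerm Γ} (h : s.HasNormalForm u)
    (hs : s.IsClosed) : u.IsClosed := by
  obtain ⟨p, hp, -, hfv, hftv⟩ := hs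
  obtain ⟨q, hq, hn⟩ := exists_nf_of_isNormal h.2
  have hr := (conv_of_reds h.1 hp hq).pars_nf hn
  exact ⟨q, hq, hn.isCanonical, hr.fv_eq_empty hn hfv, hr.ftv_eq_empty hn hftv⟩

/-! ### Closed normal terms of type `nat` -/

/-- Type constructors built by an introduction form. -/
inductive TyCon.IsIntro : {κ : Kind} → TyCon κ → Prop
  | nat : IsIntro .nat
  | lam (κ₁ : Kind) {κ₂ : Kind} (φ : TyCon κ₂) : IsIntro (.lam κ₁ φ)
  | all (κ : Kind) (σ : Ty) : IsIntro (.all κ σ)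
  | arr (σ τ : Ty) : IsIntro (.arr σ τ)

/-- The operator of a closed normal application would be an introduction form of arrow kind, that
is, an abstraction, and the application a redex. -/
theorem TyCon.Nf.isIntro {κ : Kind} {φ : TyCon κ} (h : φ.Nf) (hc : φ.ftv = ∅) :
    φ.IsIntro := by
  induction φ with
  | var κ n => exact absurd hc (Set.singleton_ne_empty _)
  | nat => exact .nat
  | app φ ψ ih _ =>
    have hi := ih h.1 (Set.union_empty_iff.1 hc).1
    cases hi
    exact absurd rfl (h.2.2 _)
  | lam κ φ _ => exact .lam κ φ
  | all κ σ _ => exact .all κ σ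
  | arr σ τ _ _ => exact .arr σ τ

namespace Expr

/-- Abstractions, numerals and partially applied function symbols. -/
inductive Value : Expr → Prop
  | lam (σ : Ty) (s : Expr) : Value (.lam σ s)
  | tlam (κ : Kind) (s : Expr) : Value (.tlam κ s)
  | sym (f : FSym) : Value (.sym f)
  | op (o : Op) (σ : Ty) : Value (.tapp (.sym (.op o)) σ)
  | opApp (o : Op) (σ : Ty) {s : Expr} : Value s → Value (.app (.tapp (.sym (.op o)) σ) s)
  | flatten (σ : Ty) : Value (.tapp (.sym .flatten) σ)
  | lift (σ : Ty) : Value (.tapp (.sym .lift) σ)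

/-- Every other value has a type convertible to an arrow or a quantified type, which confluence
separates from `nat`. -/
theorem Value.eq_num {Γ : Decl} {s : Expr} (hv : Value s) (h : HasType Γ s .nat) :
    ∃ n, s = .num n := by
  cases hv with
  | lam σ s => exact absurd h.lam_inv.choose_spec.2.symm TyCon.Conv.not_nat_arr
  | tlam κ s => exact absurd h.tlam_inv.choose_spec.2.symm TyCon.Conv.not_nat_all
  | sym f =>
    cases f with
    | num n => exact ⟨n, rfl⟩
    | op o => exact absurd h.sym_inv.symm TyCon.Conv.not_nat_all
    | flatten => exact absurd h.sym_inv.symm TyCon.Conv.not_nat_all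
    | lift => exact absurd h.sym_inv.symm TyCon.Conv.not_nat_all
  | op o σ => exact absurd h.op_inv.symm TyCon.Conv.not_nat_arr
  | opApp o σ hs =>
    obtain ⟨τ, h, -⟩ := h.app_inv
    exact absurd h.op_inv.arr_arr.2.symm TyCon.Conv.not_nat_arr
  | flatten σ => exact absurd h.flatten_inv.symm TyCon.Conv.not_nat_arr
  | lift σ => exact absurd h.lift_inv.symm TyCon.Conv.not_nat_arr

/-- A progress argument. Induction enters applications only, never binders, so the subexpressions
considered remain closed; typing restricts the head, and every fully applied head would give a
redex. -/
theorem Nf.value {Γ : Decl} {s : Expr} {ρ : Ty} (hn : s.Nf) (h : HasType Γ s ρ)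
    (hfv : s.fv = ∅) (hftv : s.ftv = ∅) : Value s := by
  induction s generalizing Γ ρ with
  | var i => exact absurd hfv (Set.singleton_ne_empty _)
  | sym f => exact .sym f
  | lam σ s _ => exact .lam σ s
  | tlam κ s _ => exact .tlam κ s
  | app s t ihs iht =>
    obtain ⟨τ, hs, ht⟩ := h.app_inv
    obtain ⟨hfv₁, hfv₂⟩ := Set.union_empty_iff.1 hfv
    obtain ⟨hftv₁, hftv₂⟩ := Set.union_empty_iff.1 hftv
    have hvt := iht hn.2.1 ht hfv₂ hftv₂
    have hvs := ihs hn.1 hs hfv₁ hftv₁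
    cases hvs with
    | lam σ s => exact absurd (.beta σ s t) (hn.2.2 _)
    | tlam κ s => exact absurd hs.tlam_inv.choose_spec.2.symm TyCon.Conv.not_arr_all
    | sym f =>
      cases f with
      | num n => exact absurd hs.sym_inv TyCon.Conv.not_nat_arr
      | op o => exact absurd hs.sym_inv.symm TyCon.Conv.not_arr_all
      | flatten => exact absurd hs.sym_inv.symm TyCon.Conv.not_arr_all
      | lift => exact absurd hs.sym_inv.symm TyCon.Conv.not_arr_all
    | op o σ => exact .opApp o σ hvt
    | @opApp o σ s hvs =>
      -- The type argument is closed and normal, hence `nat`, an arrow or a quantified type. A rule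
      -- applies in each case; for `nat` this needs both arguments to be numerals, which is why the
      -- argument in `Value.opApp` must be a value.
      have hi := hn.1.1.2.1.isIntro
        (Set.union_empty_iff.1 (Set.union_empty_iff.1 hftv₁).1).2
      cases hi with
      | nat =>
        obtain ⟨hs, ht, -⟩ := HasType.circ_inv (o := o) (σ := .nat) h
        obtain ⟨n, rfl⟩ := hvs.eq_num hs
        obtain ⟨m, rfl⟩ := hvt.eq_num ht
        exact absurd (.circNat o n m) (hn.2.2 _)
      | all κ σ => exact absurd (.circAll o κ σ s t) (hn.2.2 _)
      | arr σ τ => exact absurd (.circArr o σ τ s t) (hn.2.2 _)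
    | flatten σ =>
      cases hn.1.2.1.isIntro (Set.union_empty_iff.1 hftv₁).2 with
      | nat => exact absurd (.flatNat t) (hn.2.2 _)
      | all κ σ => exact absurd (.flatAll κ σ t) (hn.2.2 _)
      | arr σ τ => exact absurd (.flatArr σ τ t) (hn.2.2 _)
    | lift σ =>
      cases hn.1.2.1.isIntro (Set.union_empty_iff.1 hftv₁).2 with
      | nat => exact absurd (.liftNat t) (hn.2.2 _)
      | all κ σ => exact absurd (.liftAll κ σ t) (hn.2.2 _)
      | arr σ τ => exact absurd (.liftArr σ τ t) (hn.2.2 _)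
  | tapp s φ ih =>
    obtain ⟨τ, hs, -⟩ := h.tapp_inv
    have hvs := ih hn.1 hs hfv (Set.union_empty_iff.1 hftv).1
    cases hvs with
    | lam σ s => exact absurd hs.lam_inv.choose_spec.2 TyCon.Conv.not_arr_all
    | tlam κ s =>
      -- Injectivity of `∀` makes the kinds of the binder and of the argument agree, as the redex
      -- requires.
      obtain ⟨rfl, -⟩ := hs.tlam_inv.choose_spec.2.all_all
      exact absurd (.tbeta s φ) (hn.2.2 _)
    | sym f =>
      cases f with
      | num n => exact absurd hs.sym_inv TyCon.Conv.not_nat_all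
      | op o => obtain ⟨rfl, -⟩ := hs.sym_inv.all_all; exact .op o φ
      | flatten => obtain ⟨rfl, -⟩ := hs.sym_inv.all_all; exact .flatten φ
      | lift => obtain ⟨rfl, -⟩ := hs.sym_inv.all_all; exact .lift φ
    | op o σ => exact absurd hs.op_inv TyCon.Conv.not_arr_all
    | opApp o σ hv =>
      obtain ⟨τ, h, -⟩ := hs.app_inv
      exact absurd h.op_inv.arr_arr.2 TyCon.Conv.not_arr_all
    | flatten σ => exact absurd hs.flatten_inv TyCon.Conv.not_arr_all
    | lift σ => exact absurd hs.lift_inv TyCon.Conv.not_arr_all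

end Expr

theorem ITerm.isFinal_nat_iff {Γ : Decl} (s : ITerm Γ) :
    (s.IsFinal ∧ s.HasType TyCon.nat) ↔ ∃ n : ℕ, s = ITerm.num n := by
  constructor
  · rintro ⟨⟨⟨p, rfl, hc, hfv, hftv⟩, hn⟩, q, hq, hty⟩
    -- The type is given for some representative `q`; invariance of typing under `≡` moves it to the
    -- canonical one.
    have hty := hty.equiv (Quotient.exact hq)
    have hnf := Expr.nf_of_not_step hc (not_step_of_isNormal hn)
    obtain ⟨n, he⟩ := (hnf.value hty hfv hftv).eq_num hty
    exact ⟨n, congrArg Preterm.toTerm (Subtype.ext he)⟩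
  · rintro ⟨n, rfl⟩
    exact ⟨⟨⟨_, rfl, trivial, rfl, rfl⟩, isNormal_of_nf trivial⟩, _, rfl, .sym Γ _⟩

end Interp

theorem mainTheorem5 (Γ : Interp.Decl) :
    (∀ s : Interp.ITerm Γ, ∃! u : Interp.ITerm Γ, s.HasNormalForm u) ∧
    (∀ s u : Interp.ITerm Γ, s.HasNormalForm u → s.IsClosed → u.IsClosed) ∧
    (∀ s : Interp.ITerm Γ,
      (s.IsFinal ∧ s.HasType Interp.TyCon.nat) ↔ ∃ n : ℕ, s = Interp.ITerm.num n) :=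
  ⟨Interp.ITerm.existsUnique_normalForm, fun _ _ h => h.isClosed,
    Interp.ITerm.isFinal_nat_iff⟩
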